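/- **Theorem (Main).** There is an absolute constant $C$ such that the following holds for every fixed integer $k\ge 2$. There is a randomized algorithm (one program, depending only on $k$) whose input is a rational $\varepsilon\in(0,1]$ (as numerator and denominator) and a labeling of the edges of the complete graph on $n$ vertices by $+$ and $-$ (as an $n\times n$ matrix), with the following properties. For a clustering of the vertices, an edge is a *disagreement* if it is labeled $-$ and has both ends in one cluster, or is labeled $+$ and has its ends in different clusters; let $\mathrm{OPT}$ be the minimum number of disagreements over all clusterings of the vertices into at most $k$ clusters. 1. For every $n$, every labeling and every $\varepsilon$, the algorithm outputs, with probability at least $1-1/n$ over its random choices, a clustering into at most $k$ clusters with at most $(1+\varepsilon)\cdot\mathrm{OPT}$ disagreements. (For $n=0$ no bound on the probability is claimed.) 2. For every $\varepsilon$ there are a function $T:\mathbb N\to\mathbb N$ and a number $n_0$ (both may depend on $k$ and $\varepsilon$) such that for every $n$, every labeling with $n$ vertices and all outcomes of the random choices the algorithm halts within $T(n)$ steps, and $$T(n)\ \le\ n^{\,C\cdot 100^k/\varepsilon^2}\,\log n\qquad\text{for all } n\ge n_0 .$$ In particular, for every fixed $k\ge2$ the problem of minimizing disagreements with at most $k$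 clusters on complete graphs has a randomized polynomial-time approximation scheme, with running time $n^{O(100^k/\varepsilon^2)}\log n$. Here algorithms are programs of a randomized random access machine with finitely many registers and arrays of natural numbers, whose unit-cost steps are: assigning a constant, addition, truncated subtraction, reading or writing an array cell, drawing a uniformly random element of $\{0,1,\dots,m\}$ with $m$ the content of a register, and control flow by comparison of two registers (branching, while loops, sequencing). -/

import Mathlib

/-! ## Correlation clustering with at most `k` clusters -/

/-- A labeling of the edges of the complete graph on `Fin n`: `true` stands for `+`, `false` for
`-`.  The values on the diagonal of `Sym2 (Fin n)` (the non-edges `s(v, v)`) are never used. -/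
abbrev EdgeLabeling (n : ℕ) := Sym2 (Fin n) → Bool

/-- The number of disagreements of the clustering `c` (vertex `v` is put into the cluster `c v`):
the number of edges `uv` that are labeled `-` with both ends in one cluster, or labeled `+` with
the ends in different clusters.  Each edge is counted once, as the pair `(u, v)` with `u < v`. -/
def disagreements {n : ℕ} {α : Type} [DecidableEq α] (L : EdgeLabeling n) (c : Fin n → α) : ℕ :=
  (Finset.univ.filter fun p : Fin n × Fin n =>
    p.1 < p.2 ∧ ¬ (L s(p.1, p.2) = true ↔ c p.1 = c p.2)).card

/-- The optimum of the minimization problem with at most `k` clusters: the least number of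
disagreements of a clustering into `k` (possibly empty) clusters. -/
noncomputable def minDisagreements {n : ℕ} (k : ℕ) (L : EdgeLabeling n) : ℕ :=
  ⨅ c : Fin n → Fin k, disagreements L c

/-! ## A randomized random access machine

The unit-cost machine with addition and subtraction (and no multiplication).  Programs are
structured; a program mentions finitely many registers and finitely many arrays. -/

/-- Contents of the registers and of the arrays; all cells hold natural numbers. -/
structure RamStore where
  reg : ℕ → ℕ
  arr : ℕ → ℕ → ℕ

/-- Programs. Below, `R x` is the register `x` and `M a` is the array `a`. -/
inductive RamProg : Type
  /-- `R x := c` -/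
  | const (x c : ℕ)
  /-- `R x := R y + R z` -/
  | add (x y z : ℕ)
  /-- `R x := R y - R z` (zero if `R y ≤ R z`) -/
  | sub (x y z : ℕ)
  /-- `R x := M a [R i]` -/
  | load (x a i : ℕ)
  /-- `M a [R i] := R y` -/
  | store (a i y : ℕ)
  /-- `R x :=` a uniformly random element of `{0, 1, …, R y}`, independent of the past -/
  | rand (x y : ℕ)
  /-- do nothing -/
  | skip
  /-- first `p`, then `q` -/
  | seq (p q : RamProg)
  /-- if `R x < R y` then `p` else `q` -/
  | ite (x y : ℕ) (p q : RamProg)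
  /-- while `R x < R y` do `p` -/
  | loop (x y : ℕ) (p : RamProg)

/-- Assign the value `v` to the register `x`. -/
def RamStore.setReg (s : RamStore) (x v : ℕ) : RamStore :=
  { s with reg := Function.update s.reg x v }

/-- Assign the value `v` to the cell `i` of the array `a`. -/
def RamStore.setArr (s : RamStore) (a i v : ℕ) : RamStore :=
  { s with arr := Function.update s.arr a (Function.update (s.arr a) i v) }

/-- A configuration: the list of the program parts that are still to be executed, in this order,
and the store.  The machine has halted when the list is empty. -/
abbrev RamConfig := List RamProg × RamStore

/-- The distribution of the configuration after one elementary step.  Every assignment, load,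
store and random draw, every evaluation of the guard of a branch or loop, and also every unpacking
of a sequential composition is one step.  A halted machine stays as it is. -/
noncomputable def ramStep : RamConfig → PMF RamConfig
  | ([], s) => PMF.pure ([], s)
  | (.const x c :: K, s) => PMF.pure (K, s.setReg x c)
  | (.add x y z :: K, s) => PMF.pure (K, s.setReg x (s.reg y + s.reg z))
  | (.sub x y z :: K, s) => PMF.pure (K, s.setReg x (s.reg y - s.reg z))
  | (.load x a i :: K, s) => PMF.pure (K, s.setReg x (s.arr a (s.reg i)))
  | (.store a i y :: K, s) => PMF.pure (K, s.setArr a (s.reg i) (s.reg y))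
  | (.rand x y :: K, s) =>
      (PMF.uniformOfFintype (Fin (s.reg y + 1))).map fun v => (K, s.setReg x v)
  | (.skip :: K, s) => PMF.pure (K, s)
  | (.seq p q :: K, s) => PMF.pure (p :: q :: K, s)
  | (.ite x y p q :: K, s) => PMF.pure ((if s.reg x < s.reg y then p else q) :: K, s)
  | (.loop x y p :: K, s) =>
      PMF.pure (if s.reg x < s.reg y then p :: .loop x y p :: K else K, s)

/-- The distribution of the configuration after `t` steps. -/
noncomputable def ramRun : ℕ → RamConfig → PMF RamConfig
  | 0, cfg => PMF.pure cfg
  | t + 1, cfg => (ramStep cfg).bind (ramRun t)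

/-! ## Clustering algorithms on the machine -/

/-- The initial store on input `(ε, L)`: the registers `0`, `1`, `2` hold the number `n` of
vertices, the numerator of `ε` and the denominator of `ε`, and the array `0` holds the matrix of
the labeling, row by row (cell `u * n + v` is `1` if `uv` is an edge labeled `+`, otherwise `0`).
Everything else is `0`. -/
noncomputable def clusterInput {n : ℕ} (ε : ℚ) (L : EdgeLabeling n) : RamStore where
  reg x := if x = 0 then n else if x = 1 then ε.num.toNat else if x = 2 then ε.den else 0
  arr a i := open Classical in
    if a = 0 ∧ ∃ u v : Fin n, u ≠ v ∧ L s(u, v) = true ∧ i = (u : ℕ) * n + v then 1 else 0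

/-- The output clustering: cell `v` of the array `1` names the cluster of the vertex `v`. -/
def clusterOutput (n : ℕ) (s : RamStore) : Fin n → ℕ := fun v => s.arr 1 v

/-- The clustering `c` uses only the clusters `0, …, k - 1`, and its number of disagreements is at
most `1 + ε` times the optimum over all clusterings into at most `k` clusters. -/
def IsApproxClustering {n : ℕ} (k : ℕ) (ε : ℚ) (L : EdgeLabeling n) (c : Fin n → ℕ) : Prop :=
  (∀ v, c v < k) ∧ (disagreements L c : ℝ) ≤ (1 + (ε : ℝ)) * (minDisagreements k L : ℝ)

/-! ## Deterministic execution with running times -/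

/-! The algorithm makes no random choice. It runs through all advice strings of a fixed format,
builds a clustering from each, and keeps the cheapest. For fixed k and ε only the first 6k + 3
digits of a string have a range that grows with n, so there are polynomially many strings, with an
exponent that does not depend on ε. It remains to see that some string describes a (1 +
ε)-approximation; this is `exists_advice`, which rests on `exists_ops`.

Let W be the set of vertices not yet colored and D a clustering of W that is to be matched. Suppose
first that D has more than γ|W|² disagreements. Then an additive error that is a small multiple of
|W|² is harmless, and sampling achieves it (`exists_sample`). The sample is an arithmetic
progression modulo a prime between |W| and 2|W|; by pairwise independence some progression estimates
the codegrees well in mean square (`exists_progression`). Since ‖Af‖² = ∑ f(u) f(w) codeg(u, w), a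
function f whose sums over the types (the adjacency patterns to the sample) are small is almost
annihilated by the adjacency matrix A (`sum_sq_mulVec_le`). Hence clusterings with almost the same
color counts in each type have almost the same cost (`cost_le_of_types`). Such counts are reached by
cutting the list of vertices into boundedly many blocks and choosing one color for each pair of a
block and a type (`exists_block_colors`); these choices form a word of constant length.

Suppose now that D has few disagreements. There is a gap between large and small clusters
(`exists_gap`). A large cluster contains a pivot whose row is almost the indicator of the cluster
(`exists_pivot`); all small clusters are represented by the zero row. If every vertex joins the
nearest representative, a vertex that changes its cluster already had linearly many disagreements,
so few vertices move and the loss is a factor 1 + e (`exists_regroup`). The vertices nearest to the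
zero row stay uncolored, and the argument is repeated with the remaining colors. There are at most k
levels, and `exists_parameters` makes (1 + e)^k at most 1 + ε.

On the machine side, `Spec` is a Hoare calculus with step counts for deterministic runs, and
`Eval.ramRun_eq` turns such a run into a point mass. -/

@[simp] theorem RamStore.reg_setReg (s : RamStore) (x v y : ℕ) :
    (s.setReg x v).reg y = if y = x then v else s.reg y := by
  simp [RamStore.setReg, Function.update_apply]

@[simp] theorem RamStore.arr_setReg (s : RamStore) (x v : ℕ) : (s.setReg x v).arr = s.arr := rfl

@[simp] theorem RamStore.reg_setArr (s : RamStore) (a i v : ℕ) : (s.setArr a i v).reg = s.reg := rfl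

@[simp] theorem RamStore.arr_setArr (s : RamStore) (a i v b : ℕ) :
    (s.setArr a i v).arr b = if b = a then Function.update (s.arr a) i v else s.arr b := by
  simp [RamStore.setArr, Function.update_apply]

theorem RamStore.reg_ite (c : Prop) [Decidable c] (s t : RamStore) (x : ℕ) :
    (if c then s else t).reg x = if c then s.reg x else t.reg x := by split <;> rfl

theorem RamStore.arr_ite (c : Prop) [Decidable c] (s t : RamStore) (a i : ℕ) :
    (if c then s else t).arr a i = if c then s.arr a i else t.arr a i := by split <;> rfl

namespace RamProg

/-- `Eval p s t s'`: started in the store `s`, the program `p` makes no random choice and ends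
after exactly `t` steps in the store `s'`. -/
inductive Eval : RamProg → RamStore → ℕ → RamStore → Prop
  | const (x c s) : Eval (.const x c) s 1 (s.setReg x c)
  | add (x y z s) : Eval (.add x y z) s 1 (s.setReg x (s.reg y + s.reg z))
  | sub (x y z s) : Eval (.sub x y z) s 1 (s.setReg x (s.reg y - s.reg z))
  | load (x a i s) : Eval (.load x a i) s 1 (s.setReg x (s.arr a (s.reg i)))
  | store (a i y s) : Eval (.store a i y) s 1 (s.setArr a (s.reg i) (s.reg y))
  | skip (s) : Eval .skip s 1 s
  | seq {p q s t s' t' s''} : Eval p s t s' → Eval q s' t' s'' →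
      Eval (.seq p q) s (t + t' + 1) s''
  | ite {x y p q s t s'} : Eval (if s.reg x < s.reg y then p else q) s t s' →
      Eval (.ite x y p q) s (t + 1) s'
  | loop_done {x y p s} : ¬ s.reg x < s.reg y → Eval (.loop x y p) s 1 s
  | loop_step {x y p s t s' t' s''} : s.reg x < s.reg y → Eval p s t s' →
      Eval (.loop x y p) s' t' s'' → Eval (.loop x y p) s (t + t' + 1) s''

theorem ramRun_add (t t' : ℕ) (cfg : RamConfig) :
    ramRun (t + t') cfg = (ramRun t cfg).bind (ramRun t') := by
  induction t generalizing cfg with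
  | zero => simp [ramRun]
  | succ t ih =>
    rw [Nat.add_right_comm]
    simp only [ramRun, PMF.bind_bind]
    congr 1
    funext c
    exact ih c

theorem ramRun_halted (t : ℕ) (s : RamStore) : ramRun t ([], s) = PMF.pure ([], s) := by
  induction t with
  | zero => rfl
  | succ t ih => simp [ramRun, ramStep, ih]

/-- Without random choices every step has a point mass as its distribution. The arbitrary
continuation `K` is what makes the induction pass through sequencing and loops. -/
theorem Eval.ramRun_eq {p s t s'} (h : Eval p s t s') (K : List RamProg) :
    ramRun t (p :: K, s) = PMF.pure (K, s') := by
  induction h generalizing K with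
  | const | add | sub | load | store | skip => simp [ramRun, ramStep]
  | seq _ _ ih ih' =>
    rw [Nat.add_comm, ramRun_add]
    simp [ramRun, ramStep, ramRun_add, ih, ih']
  | ite _ ih => simp [ramRun, ramStep, ih]
  | loop_done h => simp [ramRun, ramStep, h]
  | loop_step h _ _ ih ih' =>
    rw [Nat.add_comm, ramRun_add]
    simp [ramRun, ramStep, ramRun_add, h, ih, ih']

theorem Eval.ramRun_of_le {p s t s'} (h : Eval p s t s') {T : ℕ} (hT : t ≤ T) :
    ramRun T ([p], s) = PMF.pure ([], s') := by
  obtain ⟨r, rfl⟩ := Nat.exists_eq_add_of_le hT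
  rw [ramRun_add, h.ramRun_eq, PMF.pure_bind, ramRun_halted]

/-- Does the program contain an assignment to the register `r`? -/
def writesReg (r : ℕ) : RamProg → Bool
  | .const x _ | .add x _ _ | .sub x _ _ | .load x _ _ | .rand x _ => r == x
  | .store _ _ _ | .skip => false
  | .seq p q | .ite _ _ p q => writesReg r p || writesReg r q
  | .loop _ _ p => writesReg r p

/-- Does the program contain an assignment to a cell of the array `a`? -/
def writesArr (a : ℕ) : RamProg → Bool
  | .store b _ _ => a == b
  | .seq p q | .ite _ _ p q => writesArr a p || writesArr a q
  | .loop _ _ p => writesArr a p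
  | _ => false

/-- The stores agree on everything that the program does not assign to. -/
structure Frame (p : RamProg) (s s' : RamStore) : Prop where
  reg : ∀ r, writesReg r p = false → s'.reg r = s.reg r
  arr : ∀ a, writesArr a p = false → s'.arr a = s.arr a

theorem Frame.refl (p : RamProg) (s : RamStore) : Frame p s s := ⟨fun _ _ => rfl, fun _ _ => rfl⟩

theorem Frame.trans {p s s' s''} (h : Frame p s s') (h' : Frame p s' s'') : Frame p s s'' :=
  ⟨fun r hr => (h'.reg r hr).trans (h.reg r hr), fun a ha => (h'.arr a ha).trans (h.arr a ha)⟩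

theorem Frame.mono {p q s s'} (h : Frame p s s') (hr : ∀ r, writesReg r q = false →
    writesReg r p = false) (ha : ∀ a, writesArr a q = false → writesArr a p = false) :
    Frame q s s' :=
  ⟨fun r h1 => h.reg r (hr r h1), fun a h1 => h.arr a (ha a h1)⟩

/-- The conditions on `writesReg` and `writesArr` are decided by computation, so each later use
closes them by `rfl`, and loop invariants need only mention what the body changes. -/
theorem Eval.frame {p s t s'} (h : Eval p s t s') : Frame p s s' := by
  induction h with
  | const | add | sub | load =>
    exact ⟨fun r hr => by simp_all [writesReg], fun _ _ => rfl⟩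
  | store => exact ⟨fun _ _ => rfl, fun a ha => by simp_all [writesArr]⟩
  | skip => exact Frame.refl _ _
  | seq _ _ ih ih' =>
    exact (ih.mono (by simp +contextual [writesReg]) (by simp +contextual [writesArr])).trans
      (ih'.mono (by simp [writesReg]) (by simp [writesArr]))
  | @ite x y p q s t s' _ ih =>
    refine ih.mono (fun r hr => ?_) fun a ha => ?_ <;> split <;> simp_all [writesReg, writesArr]
  | loop_done => exact Frame.refl _ _
  | loop_step _ _ _ ih ih' => exact (ih.mono (by simp [writesReg]) (by simp [writesArr])).trans ih'

/-- Total correctness with a time bound: from `s`, the program ends within `B` steps in a store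
that satisfies `Q`. -/
def Spec (p : RamProg) (s : RamStore) (B : ℕ) (Q : RamStore → Prop) : Prop :=
  ∃ t s', Eval p s t s' ∧ t ≤ B ∧ Q s'

theorem Spec.mono {p s B B' Q Q'} (h : Spec p s B Q) (hB : B ≤ B')
    (hQ : ∀ s', Q s' → Frame p s s' → Q' s') : Spec p s B' Q' := by
  obtain ⟨t, s', he, ht, hq⟩ := h
  exact ⟨t, s', he, ht.trans hB, hQ s' hq he.frame⟩

theorem Spec.le {p s B B' Q} (h : Spec p s B Q) (hB : B ≤ B') : Spec p s B' Q :=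
  h.mono hB fun _ hs _ => hs

theorem Spec.seq {p q s B B' Q Q'} (h : Spec p s B Q)
    (h' : ∀ s', Q s' → Frame p s s' → Spec q s' B' Q') :
    Spec (.seq p q) s (B + B' + 1) Q' := by
  obtain ⟨t, s', he, ht, hq⟩ := h
  obtain ⟨t', s'', he', ht', hq'⟩ := h' s' hq he.frame
  exact ⟨_, s'', he.seq he', by omega, hq'⟩

theorem Spec.ite {x y p q s B Q} (h : s.reg x < s.reg y → Spec p s B Q)
    (h' : ¬ s.reg x < s.reg y → Spec q s B Q) : Spec (.ite x y p q) s (B + 1) Q := by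
  by_cases hc : s.reg x < s.reg y
  · obtain ⟨t, s', he, ht, hq⟩ := h hc
    exact ⟨_, s', .ite (by rwa [if_pos hc]), by omega, hq⟩
  · obtain ⟨t, s', he, ht, hq⟩ := h' hc
    exact ⟨_, s', .ite (by rwa [if_neg hc]), by omega, hq⟩

/-- The final store of a loop-free program without random choices. -/
def run : RamProg → RamStore → RamStore
  | .const x c, s => s.setReg x c
  | .add x y z, s => s.setReg x (s.reg y + s.reg z)
  | .sub x y z, s => s.setReg x (s.reg y - s.reg z)
  | .load x a i, s => s.setReg x (s.arr a (s.reg i))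
  | .store a i y, s => s.setArr a (s.reg i) (s.reg y)
  | .seq p q, s => run q (run p s)
  | .ite x y p q, s => if s.reg x < s.reg y then run p s else run q s
  | _, s => s

/-- The program has no loops and no random choices. -/
def straight : RamProg → Bool
  | .rand _ _ | .loop _ _ _ => false
  | .seq p q | .ite _ _ p q => straight p && straight q
  | _ => true

/-- A bound for the number of steps of a loop-free program. -/
def size : RamProg → ℕ
  | .seq p q | .ite _ _ p q => size p + size q + 1
  | _ => 1

/-- Loop-free code is executed symbolically: the final store is a term that `simp` can evaluate, so
invariants are needed for loops only. -/
theorem spec_run {p : RamProg} (hp : straight p = true) (s : RamStore) :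
    Spec p s (size p) (· = run p s) := by
  induction p generalizing s with
  | rand | loop => simp [straight] at hp
  | const => exact ⟨_, _, .const .., le_rfl, rfl⟩
  | add => exact ⟨_, _, .add .., le_rfl, rfl⟩
  | sub => exact ⟨_, _, .sub .., le_rfl, rfl⟩
  | load => exact ⟨_, _, .load .., le_rfl, rfl⟩
  | store => exact ⟨_, _, .store .., le_rfl, rfl⟩
  | skip => exact ⟨_, _, .skip .., le_rfl, rfl⟩
  | seq p q ih ih' =>
    simp only [straight, Bool.and_eq_true] at hp
    refine Spec.seq (ih hp.1 s) ?_
    rintro _ rfl -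
    exact ih' hp.2 _
  | ite x y p q ih ih' =>
    simp only [straight, Bool.and_eq_true] at hp
    refine Spec.ite (fun h => ?_) fun h => ?_
    · exact (ih hp.1 s).mono (by omega) fun s' hs _ => by simp [hs, run, h]
    · exact (ih' hp.2 s).mono (by omega) fun s' hs _ => by simp [hs, run, h]

theorem Spec.last {p s B Q} (h : Spec p s B Q) : Spec (.seq p .skip) s (B + 2) Q :=
  h.seq (B' := 1) fun _ hs _ => ⟨_, _, .skip _, le_rfl, hs⟩

theorem Spec.seq_run {p q : RamProg} {s : RamStore} {B : ℕ} {Q : RamStore → Prop}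
    (hp : straight p = true) (h : Frame p s (run p s) → Spec q (run p s) B Q) :
    Spec (.seq p q) s (size p + B + 1) Q :=
  (spec_run hp s).seq fun s' hs hF => by subst hs; exact h hF

theorem Spec.of_run {p : RamProg} {s : RamStore} {Q : RamStore → Prop}
    (hp : straight p = true) (h : Frame p s (run p s) → Q (run p s)) : Spec p s (size p) Q :=
  (spec_run hp s).mono le_rfl fun s' hs hF => by subst hs; exact h hF

/-- Sequential composition of a list of programs. -/
def block : List RamProg → RamProg
  | [] => .skip
  | p :: l => .seq p (block l)

/-- `R x := R x + 1`, using the scratch register `50`. -/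
def inc (x : ℕ) : RamProg := .seq (.const 50 1) (.add x x 50)

/-- `for R i := 0, …, R l - 1 do p`. -/
def forTo (i l : ℕ) (p : RamProg) : RamProg :=
  .seq (.const i 0) (.loop i l (.seq p (inc i)))

/-- The five extra steps per iteration are the guard, the unpacking of the body, and the three steps
of `inc`. The invariant is asserted after the increment because `inc` also overwrites the scratch
register 50. -/
theorem spec_forTo {i l : ℕ} {p : RamProg} {s : RamStore} {B : ℕ} {Q : RamStore → Prop} (N : ℕ)
    (Inv : ℕ → RamStore → Prop) (hN : s.reg l = N)
    (hil : (i == 50 || i == l || l == 50 || writesReg i p || writesReg l p) = false)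
    (h0 : Inv 0 (s.setReg i 0))
    (hstep : ∀ j < N, ∀ s', Inv j s' → s'.reg i = j → s'.reg l = N →
      Frame (forTo i l p) s s' →
      Spec p s' B fun s'' => Inv (j + 1) ((s''.setReg 50 1).setReg i (j + 1)))
    (hQ : ∀ s', Inv N s' → Frame (forTo i l p) s s' → Q s') :
    Spec (forTo i l p) s (N * (B + 5) + 3) Q := by
  simp only [Bool.or_eq_false_iff, beq_eq_false_iff_ne, ne_eq] at hil
  obtain ⟨⟨⟨⟨hi50, hne⟩, hl50⟩, hi⟩, hl⟩ := hil
  have main : ∀ r j s', r + j = N → Inv j s' → s'.reg i = j → s'.reg l = N →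
      Frame (forTo i l p) s s' →
      Spec (.loop i l (.seq p (inc i))) s' (r * (B + 5) + 1) Q := by
    intro r
    induction r with
    | zero =>
      intro j s' hj hI h1 h2 hF
      have hjN : j = N := by omega
      exact ⟨_, s', .loop_done (by omega), by omega, hQ s' (hjN ▸ hI) hF⟩
    | succ r ih =>
      intro j s' hj hI h1 h2 hF
      obtain ⟨t, s'', he, ht, hq⟩ := hstep j (by omega) s' hI h1 h2 hF
      have hi'' : s''.reg i = j := (he.frame.reg i hi).trans h1
      have hl'' : s''.reg l = N := (he.frame.reg l hl).trans h2
      have hb : Eval (.seq p (inc i)) s' (t + (1 + 1 + 1) + 1)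
          ((s''.setReg 50 1).setReg i (j + 1)) := by
        refine he.seq ?_
        have h3 : Eval (inc i) s'' (1 + 1 + 1) _ := .seq (.const ..) (.add ..)
        simpa [hi50, hi''] using h3
      have hF' : Frame (forTo i l p) s ((s''.setReg 50 1).setReg i (j + 1)) :=
        hF.trans (hb.frame.mono (fun r => by
          simp +contextual [forTo, writesReg]) (fun a => by simp +contextual [forTo, writesArr]))
      obtain ⟨t', s3, he', ht', hq'⟩ := ih (j + 1) _ (by omega) hq (by simp)
        (by simp [Ne.symm hne, hl50, hl'']) hF'
      exact ⟨_, s3, .loop_step (by omega) hb he', by rw [Nat.succ_mul]; omega, hq'⟩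
  have h1 : Spec (.const i 0) s 1 (· = s.setReg i 0) := ⟨_, _, .const .., le_rfl, rfl⟩
  refine (h1.seq (B' := N * (B + 5) + 1) ?_).mono (by omega) fun _ h _ => h
  rintro _ rfl hF
  refine main N 0 _ (by omega) h0 (by simp) (by simp [Ne.symm hne, hN]) (hF.mono ?_ ?_)
  · intro r; simp +contextual [forTo, writesReg]
  · intro r; simp [forTo, writesArr]

/-- A loop whose guard register `x` is raised to at least `R y` in some iteration, at the latest
in the `N`-th. -/
theorem spec_loop {x y : ℕ} {p : RamProg} {s : RamStore} {B N : ℕ} {Q : RamStore → Prop}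
    (Inv : ℕ → RamStore → Prop) (h0 : Inv 0 s)
    (hstep : ∀ j s', Inv j s' → s'.reg x < s'.reg y → j < N ∧
      (Frame p s s' → Spec p s' B fun s'' => Inv (j + 1) s''))
    (hQ : ∀ j s', Inv j s' → ¬ s'.reg x < s'.reg y → Q s') :
    Spec (.loop x y p) s (N * (B + 1) + 1) Q := by
  have main : ∀ r j s', r + j = N → Inv j s' → Frame p s s' →
      Spec (.loop x y p) s' (r * (B + 1) + 1) Q := by
    intro r
    induction r with
    | zero =>
      intro j s' hj hI hF
      by_cases hc : s'.reg x < s'.reg y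
      · have := (hstep j s' hI hc).1
        omega
      · exact ⟨_, s', .loop_done hc, by omega, hQ j s' hI hc⟩
    | succ r ih =>
      intro j s' hj hI hF
      by_cases hc : s'.reg x < s'.reg y
      · obtain ⟨t, s'', he, ht, hq⟩ := (hstep j s' hI hc).2 hF
        obtain ⟨t', s3, he', ht', hq'⟩ := ih (j + 1) _ (by omega) hq (hF.trans he.frame)
        exact ⟨_, s3, .loop_step hc he he', by rw [Nat.succ_mul]; omega, hq'⟩
      · exact ⟨_, s', .loop_done hc, by omega, hQ j s' hI hc⟩
  exact main N 0 s (by omega) h0 (Frame.refl _ _)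

end RamProg

/-! ## The algorithm as a function -/

namespace CorrClust

open Finset

/-- The number of `x < n` with `al x > 0` in which the rows `u` and `v` of `a` differ. -/
def rowDist (n : ℕ) (a : ℕ → ℕ → ℕ) (al : ℕ → ℕ) (u v : ℕ) : ℕ :=
  ∑ x ∈ range n, if 0 < al x ∧ a u x ≠ a v x then 1 else 0

/-- The state of the peeling phase: the colors assigned so far (vertices with a color `≥ k` are
uncolored), the vertices of the current level, and the distances to their current pivots. -/
structure PeelState where
  col : ℕ → ℕ
  alive : ℕ → ℕ
  best : ℕ → ℕ

/-- Start a new level with the uncolored vertices. -/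
def newLevel (k n : ℕ) (st : PeelState) : PeelState where
  col := st.col
  alive u := if st.col u < k then 0 else 1
  best _ := n + 1

/-- Give the color `c` to the vertices of the current level that are closer to the pivot `v` than
to all earlier pivots. -/
def pivot (n : ℕ) (a : ℕ → ℕ → ℕ) (v c : ℕ) (st : PeelState) : PeelState where
  col u := if 0 < st.alive u ∧ rowDist n a st.alive u v < st.best u then c else st.col u
  alive := st.alive
  best u := if 0 < st.alive u ∧ rowDist n a st.alive u v < st.best u
    then rowDist n a st.alive u v else st.best u

/-- One operation of the peeling phase. -/
def peelOp (k n : ℕ) (a : ℕ → ℕ → ℕ) (r v c : ℕ) (st : PeelState) : PeelState :=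
  pivot n a v c (if 0 < r then newLevel k n st else st)

/-- The state after `t` peeling operations, which are described by the digits of `z`. -/
def peel (k n : ℕ) (a : ℕ → ℕ → ℕ) (z : ℕ → ℕ) : ℕ → PeelState
  | 0 => ⟨fun _ => k, fun _ => 0, fun _ => 0⟩
  | t + 1 => peelOp k n a (z (3 * t)) (z (3 * t + 1)) (z (3 * t + 2)) (peel k n a z t)

/-- The arithmetic progression modulo `p` with difference `b` that starts at `x`. -/
def walk (p b x : ℕ) : ℕ → ℕ
  | 0 => x
  | j + 1 => if walk p b x j + b < p then walk p b x j + b else walk p b x j + b - p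

/-- The adjacencies of `u` to the first `j` sample vertices `ls (walk p b x i)`, as a binary
number. -/
def typ (N : ℕ) (ls : ℕ → ℕ) (a : ℕ → ℕ → ℕ) (p b x u : ℕ) : ℕ → ℕ
  | 0 => 0
  | j + 1 => 2 * typ N ls a p b x u j +
      if walk p b x j < N then a (ls (walk p b x j)) u else 0

/-- Color the first `i` vertices of the list `ls` according to the word `w`. -/
def fill (G g : ℕ) (ls : ℕ → ℕ) (ty w col : ℕ → ℕ) : ℕ → ℕ → ℕ
  | 0 => col
  | i + 1 => Function.update (fill G g ls ty w col i) (ls i) (w (G * (i / g) + ty (ls i)))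

/-- Color all uncolored vertices. -/
noncomputable def sampleColor (k n m G q : ℕ) (a : ℕ → ℕ → ℕ) (p b x : ℕ) (w col : ℕ → ℕ) :
    ℕ → ℕ :=
  let P := fun u => u < n ∧ k ≤ col u
  fill G (Nat.count P n / q + 1) (Nat.nth P)
    (fun u => typ (Nat.count P n) (Nat.nth P) a p b x u m) w col (Nat.count P n)

/-- The clustering that is described by the digits of `z`. -/
noncomputable def candidate (k n m G q : ℕ) (a : ℕ → ℕ → ℕ) (z : ℕ → ℕ) : ℕ → ℕ :=
  sampleColor k n m G q a (z (6 * k)) (z (6 * k + 1)) (z (6 * k + 2))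
    (fun i => z (6 * k + 3 + i)) (peel k n a z (2 * k)).col

/-- The number of disagreements of the clustering `c`, each counted twice. -/
def cost (n : ℕ) (a : ℕ → ℕ → ℕ) (c : ℕ → ℕ) : ℕ :=
  ∑ u ∈ range n, ∑ v ∈ range n, if c u = c v then 1 - a u v else a u v

/-- The search starts with n² + 1 as the best cost; by this bound the first candidate is always
accepted. -/
theorem cost_le {n : ℕ} {a : ℕ → ℕ → ℕ} (ha : ∀ u < n, ∀ v < n, a u v ≤ 1) (c : ℕ → ℕ) :
    cost n a c ≤ n * n := by
  have : ∀ u ∈ range n, (∑ v ∈ range n, if c u = c v then 1 - a u v else a u v) ≤ n := by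
    intro u hu
    refine (sum_le_card_nsmul _ _ 1 fun v hv => ?_).trans (by simp)
    have := ha u (mem_range.1 hu) v (mem_range.1 hv)
    split_ifs <;> omega
  exact (sum_le_card_nsmul _ _ n this).trans (by simp)

/-- The bounds of the digits. -/
def digitBound (k n L : ℕ) (j : ℕ) : ℕ :=
  if j < 6 * k + 3 then 2 * n + k else if j < 6 * k + 3 + L then k - 1 else 0

theorem fill_congr {G g : ℕ} {ls ty w col col' : ℕ → ℕ} {i u : ℕ} (h : col u = col' u) :
    fill G g ls ty w col i u = fill G g ls ty w col' i u := by
  induction i with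
  | zero => exact h
  | succ i ih => simp [fill, Function.update_apply, ih]

theorem fill_of_forall_ne {G g : ℕ} {ls ty w col : ℕ → ℕ} {N u : ℕ} (h : ∀ i < N, ls i ≠ u) :
    fill G g ls ty w col N u = col u := by
  induction N with
  | zero => rfl
  | succ N ih =>
    rw [fill, Function.update_of_ne (h N (Nat.lt_succ_self N)).symm]
    exact ih fun i hi => h i (by omega)

theorem fill_apply {G g : ℕ} {ls ty w col : ℕ → ℕ} {N i : ℕ}
    (hinj : ∀ i < N, ∀ j < N, ls i = ls j → i = j) (hi : i < N) :
    fill G g ls ty w col N (ls i) = w (G * (i / g) + ty (ls i)) := by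
  induction N with
  | zero => omega
  | succ N ih =>
    rcases Nat.lt_succ_iff_lt_or_eq.1 hi with h | rfl
    · rw [fill, Function.update_of_ne fun he => h.ne (hinj i hi N (by omega) he)]
      exact ih (fun i hi j hj => hinj i (by omega) j (by omega)) h
    · rw [fill, Function.update_self]

/-! ### Enumeration of a finite set of vertices in increasing order -/

section Enumeration

variable {P : ℕ → Prop} [DecidablePred P] {n : ℕ}

theorem count_eq_card (hP : ∀ u, P u → u < n) :
    ∃ hf : (Set.ofPred P).Finite, hf.toFinset.card = Nat.count P n := by
  refine ⟨(Set.finite_lt_nat n).subset hP, ?_⟩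
  rw [Nat.count_eq_card_filter_range]
  congr 1
  ext u
  simpa [Set.mem_ofPred_eq] using hP u

theorem nth_inj (hP : ∀ u, P u → u < n) : ∀ i < Nat.count P n, ∀ j < Nat.count P n,
    Nat.nth P i = Nat.nth P j → i = j := by
  obtain ⟨hf, hc⟩ := count_eq_card hP
  intro i hi j hj h
  exact Nat.nth_injOn hf (by rw [hc]; exact hi) (by rw [hc]; exact hj) h

theorem nth_spec (hP : ∀ u, P u → u < n) {i : ℕ} (hi : i < Nat.count P n) : P (Nat.nth P i) := by
  obtain ⟨hf, hc⟩ := count_eq_card hP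
  exact Nat.nth_mem _ fun _ => hc ▸ hi

theorem exists_nth_eq (hP : ∀ u, P u → u < n) {u : ℕ} (hu : P u) :
    ∃ i < Nat.count P n, Nat.nth P i = u :=
  ⟨Nat.count P u, Nat.count_strict_mono hu (hP u hu), Nat.nth_count hu⟩

end Enumeration

theorem sampleColor_lt {k n m G q : ℕ} {a : ℕ → ℕ → ℕ} {p b x : ℕ} {w col : ℕ → ℕ}
    (hw : ∀ i, w i < k) {u : ℕ} (hu : u < n) :
    sampleColor k n m G q a p b x w col u < k := by
  have hP : ∀ u, (u < n ∧ k ≤ col u) → u < n := fun u h => h.1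
  by_cases h : u < n ∧ k ≤ col u
  · obtain ⟨i, hi, he⟩ := exists_nth_eq hP h
    simp only [sampleColor]
    conv_lhs => rw [← he]
    rw [fill_apply (nth_inj hP) hi]
    exact hw _
  · rw [sampleColor, fill_of_forall_ne]
    · omega
    · rintro i hi rfl
      exact h (nth_spec hP hi)

/-- The program controls the color array only below `n`, so the coloring must not depend on anything
beyond. -/
theorem sampleColor_congr {k n m G q : ℕ} {a : ℕ → ℕ → ℕ} {p b x : ℕ} {w col col' : ℕ → ℕ}
    (h : ∀ u < n, col u = col' u) {u : ℕ} (hu : u < n) :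
    sampleColor k n m G q a p b x w col u = sampleColor k n m G q a p b x w col' u := by
  have hP : (fun u => u < n ∧ k ≤ col u) = fun u => u < n ∧ k ≤ col' u := by
    funext u
    by_cases hu : u < n
    · simp [h u hu]
    · simp [hu]
  simp only [sampleColor, hP]
  exact fill_congr (h u hu)

theorem rowDist_congr {n : ℕ} {a : ℕ → ℕ → ℕ} {al al' : ℕ → ℕ} (h : ∀ x < n, al x = al' x)
    (u v : ℕ) : rowDist n a al u v = rowDist n a al' u v :=
  sum_congr rfl fun x hx => by rw [h x (mem_range.1 hx)]

theorem cost_congr {n : ℕ} {a : ℕ → ℕ → ℕ} {c c' : ℕ → ℕ} (h : ∀ u < n, c u = c' u) :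
    cost n a c = cost n a c' :=
  sum_congr rfl fun u hu => sum_congr rfl fun v hv => by
    rw [h u (mem_range.1 hu), h v (mem_range.1 hv)]

end CorrClust

/-! ## The program -/

namespace RamProg

open Finset CorrClust

/-- The matrix in array `0`, whose rows start at the addresses in array `2`. -/
def mat (s : RamStore) (u v : ℕ) : ℕ := s.arr 0 (s.arr 2 u + v)

/-- The registers that are constant after the initialization. -/
structure Env (k n m G q L : ℕ) (s : RamStore) : Prop where
  r0 : s.reg 0 = n
  r3 : s.reg 3 = k
  r4 : s.reg 4 = m
  r5 : s.reg 5 = G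
  r6 : s.reg 6 = q
  r7 : s.reg 7 = L
  r9 : s.reg 9 = 1
  r11 : s.reg 11 = 0
  r12 : s.reg 12 = 2 * k
  r13 : s.reg 13 = 6 * k + 3
  r17 : s.reg 17 = n + 1

theorem Env.frame {k n m G q L : ℕ} {s s' : RamStore} {p : RamProg} (h : Env k n m G q L s)
    (hf : Frame p s s')
    (hp : ([0, 3, 4, 5, 6, 7, 9, 11, 12, 13, 17].any fun r => writesReg r p) = false) :
    Env k n m G q L s' := by
  simp only [List.any_cons, List.any_nil, Bool.or_eq_false_iff] at hp
  obtain ⟨h0, h3, h4, h5, h6, h7, h9, h11, h12, h13, h17, -⟩ := hp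
  exact ⟨(hf.reg 0 h0).trans h.r0, (hf.reg 3 h3).trans h.r3, (hf.reg 4 h4).trans h.r4,
    (hf.reg 5 h5).trans h.r5, (hf.reg 6 h6).trans h.r6, (hf.reg 7 h7).trans h.r7,
    (hf.reg 9 h9).trans h.r9, (hf.reg 11 h11).trans h.r11, (hf.reg 12 h12).trans h.r12,
    (hf.reg 13 h13).trans h.r13, (hf.reg 17 h17).trans h.r17⟩

/-- `R 32 :=` the distance of the rows `R 20` and `R 23`. -/
def rowDistP : RamProg := block [block [.const 32 0, .load 33 2 20, .load 34 2 23],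
  forTo 21 0 (block [.load 35 6 21, .ite 11 35 (block [.add 36 33 21, .load 36 0 36,
    .add 37 34 21, .load 37 0 37, .ite 36 37 (inc 32) (.ite 37 36 (inc 32) .skip)]) .skip])]

theorem rowDistP_spec {s : RamStore} {n : ℕ} (h0 : s.reg 0 = n) (h11 : s.reg 11 = 0) :
    Spec rowDistP s (n * 50 + 50) fun s' =>
      s'.reg 32 = rowDist n (mat s) (s.arr 6) (s.reg 20) (s.reg 23) := by
  apply Spec.le
  · apply Spec.seq_run
    · rfl
    intro hF
    apply Spec.last
    apply spec_forTo n (fun j s' => s'.reg 32 =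
        ∑ x ∈ range j, if 0 < s.arr 6 x ∧ mat s (s.reg 20) x ≠ mat s (s.reg 23) x then 1 else 0)
        (by simp [block, run, h0]) rfl (by simp [block, run])
    · intro j hj s' hI hi hl hF'
      apply Spec.of_run
      · rfl
      intro _
      have e11 := (hF'.reg 11 rfl).trans (hF.reg 11 rfl)
      have e33 := hF'.reg 33 rfl
      have e34 := hF'.reg 34 rfl
      have a6 := (hF'.arr 6 rfl).trans (hF.arr 6 rfl)
      have a0 := (hF'.arr 0 rfl).trans (hF.arr 0 rfl)
      simp [block, run] at e33 e34
      simp [block, run, inc, mat, hi, e11, e33, e34, a6, a0, h11, sum_range_succ, hI, RamStore.reg_ite]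
      grind
    · exact fun _ h _ => h
  · simp [size, block, inc]; omega

/-- The relation between the arrays `5`, `6`, `7` and a state of the peeling phase. -/
def Represents (n : ℕ) (s : RamStore) (st : PeelState) : Prop :=
  ∀ u < n, s.arr 5 u = st.col u ∧ s.arr 6 u = st.alive u ∧ s.arr 7 u = st.best u

/-- The operation `newLevel`. -/
def newLevelP : RamProg := forTo 20 0 (block [.load 30 5 20,
  .ite 30 3 (.store 6 20 11) (.store 6 20 9), .store 7 20 17])

theorem newLevelP_spec {k n m G q L : ℕ} {s : RamStore} {st : PeelState}
    (he : Env k n m G q L s) (hs : Represents n s st) :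
    Spec newLevelP s (n * 30 + 30) fun s' => Represents n s' (newLevel k n st) := by
  apply Spec.le
  · apply spec_forTo n (fun j s' => ∀ u < n, s'.arr 5 u = st.col u ∧
      s'.arr 6 u = (if u < j then (newLevel k n st).alive u else st.alive u) ∧
      s'.arr 7 u = (if u < j then (newLevel k n st).best u else st.best u)) he.r0 rfl
      (by simpa [Represents] using hs)
    · intro j hj s' hI hi hl hF
      apply Spec.of_run
      · rfl
      intro _ u hu
      have he' := he.frame hF rfl
      obtain ⟨h5, h6, h7⟩ := hI u hu
      have h5j := (hI j hj).1
      simp [block, run, hi, h5j, he'.r3, he'.r11, he'.r9, he'.r17, RamStore.arr_ite, RamStore.reg_ite,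
        Function.update_apply, h5, h6, h7, newLevel]
      split_ifs <;> grind
    · intro s' h _ u hu
      simpa [hu, newLevel] using h u hu
  · simp [size, block]; omega

/-- The operation `pivot` for the row `R 23` and the color `R 24`. -/
def pivotP : RamProg := forTo 20 0 (block [.load 30 6 20, .ite 11 30 (block [rowDistP,
  block [.load 31 7 20, .ite 32 31 (block [.store 7 20 32, .store 5 20 24]) .skip]]) .skip])

theorem pivotP_spec {k n m G q L : ℕ} {s : RamStore} {st : PeelState}
    (he : Env k n m G q L s) (hs : Represents n s st) :
    Spec pivotP s (n * (n * 50 + 100) + 30) fun s' =>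
      Represents n s' (pivot n (mat s) (s.reg 23) (s.reg 24) st) := by
  set new := pivot n (mat s) (s.reg 23) (s.reg 24) st with hnew
  apply Spec.le
  · apply spec_forTo n (fun j s' => ∀ u < n, s'.arr 6 u = st.alive u ∧
      s'.arr 5 u = (if u < j then new.col u else st.col u) ∧
      s'.arr 7 u = (if u < j then new.best u else st.best u)) he.r0 rfl
      (by intro u hu; simpa [and_comm, and_assoc, and_left_comm] using hs u hu)
    · intro j hj s' hI hi hl hF
      have he' := he.frame hF rfl
      apply Spec.seq_run
      · rfl
      intro hF1
      apply Spec.last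
      have he1 := he'.frame hF1 rfl
      have hr30 : (run (.load 30 6 20) s').reg 30 = st.alive j := by
        simp [run, hi, (hI j hj).1]
      have hI1 : ∀ u < n, (run (.load 30 6 20) s').arr 6 u = st.alive u := fun u hu => by
        simp [run, (hI u hu).1]
      have hmat : mat (run (.load 30 6 20) s') = mat s := by
        funext u v
        simp [mat, run, hF.arr 0 rfl, hF.arr 2 rfl]
      have h23 : (run (.load 30 6 20) s').reg 23 = s.reg 23 := by simp [run, hF.reg 23 rfl]
      have h24 : (run (.load 30 6 20) s').reg 24 = s.reg 24 := by simp [run, hF.reg 24 rfl]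
      have h20 : (run (.load 30 6 20) s').reg 20 = j := by simp [run, hi]
      have h57 : ∀ u < n, (run (.load 30 6 20) s').arr 5 u = (if u < j then new.col u else st.col u)
        ∧ (run (.load 30 6 20) s').arr 7 u = (if u < j then new.best u else st.best u) :=
        fun u hu => (hI u hu).2
      generalize run (.load 30 6 20) s' = s1 at *
      apply Spec.ite
      · intro hlt
        rw [he1.r11, hr30] at hlt
        apply Spec.seq (rowDistP_spec he1.r0 he1.r11)
        intro s2 h2 hF2
        apply Spec.last
        apply Spec.of_run
        · rfl
        intro _ u hu
        rw [hmat, h23, h20, rowDist_congr hI1] at h2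
        have h20' := (hF2.reg 20 rfl).trans h20
        have h24' := (hF2.reg 24 rfl).trans h24
        have a5 := hF2.arr 5 rfl
        have a6 := hF2.arr 6 rfl
        have a7 := hF2.arr 7 rfl
        have h6 := hI1 u hu
        have h5 := h57 u hu
        have h5j := h57 j hj
        simp only [block, run, RamStore.arr_ite, RamStore.reg_setReg, RamStore.arr_setReg,
          RamStore.arr_setArr, RamStore.reg_setArr, h20', h24', a5, a6, a7, h2, hnew, pivot] at *
        simp at h5j
        grind
      · intro hlt
        rw [he1.r11, hr30] at hlt
        apply Spec.le
        · apply Spec.of_run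
          · rfl
          intro _ u hu
          have h6 := hI1 u hu
          have h5 := h57 u hu
          simp only [block, run, RamStore.arr_setReg, hnew, pivot] at *
          grind
        · simp only [size]; omega
    · intro s' h _ u hu
      obtain ⟨h6, h5, h7⟩ := h u hu
      simp only [hu, if_true] at h5 h7
      exact ⟨h5, h6, h7⟩
  · simp [size, block]
    nlinarith

end RamProg

/-! ### Peeling and the list of uncolored vertices on the machine -/

namespace RamProg

open Finset CorrClust

/-- The peeling phase. -/
def peelP : RamProg := block [
  forTo 20 0 (block [.store 5 20 3, .store 6 20 11, .store 7 20 11]), .const 40 0,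
  forTo 41 12 (block [block [.load 22 3 40, inc 40, .load 23 3 40, inc 40, .load 24 3 40, inc 40],
    .ite 11 22 newLevelP .skip, pivotP])]

theorem peelP_spec {k n m G q L : ℕ} {s : RamStore} (he : Env k n m G q L s) :
    Spec peelP s (2 * k * (n * (n * 50 + 130) + 120) + n * 30 + 30) fun s' =>
      Represents n s' (peel k n (mat s) (s.arr 3) (2 * k)) := by
  apply Spec.le
  · apply Spec.seq
    · apply spec_forTo n (Q := fun s' => Represents n s' (peel k n (mat s) (s.arr 3) 0))
        (fun j s' => ∀ u < j, s'.arr 5 u = k ∧ s'.arr 6 u = 0 ∧ s'.arr 7 u = 0) he.r0 rfl (by simp)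
      · intro j hj s' hI hi hl hF
        apply Spec.of_run
        · rfl
        intro _ u hu
        have he' := he.frame hF rfl
        simp only [block, run, hi, he'.r3, he'.r11, RamStore.arr_setArr, RamStore.reg_setArr,
          RamStore.arr_setReg]
        rcases Nat.lt_succ_iff_lt_or_eq.1 hu with hu | hu
        · simp [hI u hu, hu.ne]
        · simp [hu]
      · exact fun s' h _ u hu => h u hu
    intro s1 h1 hF1
    have he1 := he.frame hF1 rfl
    apply Spec.seq_run
    · rfl
    intro hF2
    have he2 := he1.frame hF2 rfl
    apply Spec.last
    apply spec_forTo (2 * k) (fun j s' => Represents n s' (peel k n (mat s) (s.arr 3) j) ∧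
      s'.reg 40 = 3 * j) he2.r12 rfl ⟨h1, by simp [run]⟩
    · rintro j hj s3 ⟨hR, h40⟩ hi hl hF3
      have he3 := he2.frame hF3 rfl
      have a3 : s3.arr 3 = s.arr 3 :=
        (hF3.arr 3 rfl).trans ((hF2.arr 3 rfl).trans (hF1.arr 3 rfl))
      have hm : mat s3 = mat s := by
        funext u v
        simp [mat, (hF3.arr 2 rfl).trans ((hF2.arr 2 rfl).trans (hF1.arr 2 rfl)),
          (hF3.arr 0 rfl).trans ((hF2.arr 0 rfl).trans (hF1.arr 0 rfl))]
      apply Spec.seq_run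
      · rfl
      intro hF4
      have he4 := he3.frame hF4 rfl
      have hm4 : mat (run (block [.load 22 3 40, inc 40, .load 23 3 40, inc 40, .load 24 3 40,
        inc 40]) s3) = mat s := by rw [← hm]; rfl
      have hR4 : Represents n (run (block [.load 22 3 40, inc 40, .load 23 3 40, inc 40,
        .load 24 3 40, inc 40]) s3) (peel k n (mat s) (s.arr 3) j) := hR
      have hr : (run (block [.load 22 3 40, inc 40, .load 23 3 40, inc 40, .load 24 3 40,
        inc 40]) s3).reg 22 = s.arr 3 (3 * j) ∧ (run (block [.load 22 3 40, inc 40, .load 23 3 40,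
        inc 40, .load 24 3 40, inc 40]) s3).reg 23 = s.arr 3 (3 * j + 1) ∧
        (run (block [.load 22 3 40, inc 40, .load 23 3 40, inc 40, .load 24 3 40,
        inc 40]) s3).reg 24 = s.arr 3 (3 * j + 2) ∧ (run (block [.load 22 3 40, inc 40,
        .load 23 3 40, inc 40, .load 24 3 40, inc 40]) s3).reg 40 = 3 * (j + 1) := by
        simp [run, block, inc, h40, a3]
        omega
      generalize run (block [.load 22 3 40, inc 40, .load 23 3 40, inc 40, .load 24 3 40,
        inc 40]) s3 = s4 at hr hR4 hm4 he4 hF4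
      obtain ⟨h22, h23, h24, h40'⟩ := hr
      apply Spec.seq (Q := fun s' => Represents n s' (if 0 < s.arr 3 (3 * j) then
        newLevel k n (peel k n (mat s) (s.arr 3) j) else (peel k n (mat s) (s.arr 3) j)))
        (B := n * 30 + 31)
      · apply Spec.ite
        · intro hlt
          rw [he4.r11, h22] at hlt
          simp only [hlt, if_true]
          exact newLevelP_spec he4 hR4
        · intro hlt
          rw [he4.r11, h22] at hlt
          simp only [hlt, if_false]
          exact (Spec.of_run rfl fun _ => hR4).le (by simp only [size]; omega)
      intro s5 hR5 hF5
      have he5 := he4.frame hF5 rfl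
      apply Spec.last
      apply (pivotP_spec he5 hR5).mono le_rfl
      intro s6 hR6 hF6
      have hm5 : mat s5 = mat s := by
        rw [← hm4]; funext u v; simp [mat, hF5.arr 0 rfl, hF5.arr 2 rfl]
      refine ⟨?_, ?_⟩
      · rw [hm5, (hF5.reg 23 rfl).trans h23, (hF5.reg 24 rfl).trans h24] at hR6
        exact hR6
      · simp [(hF6.reg 40 rfl).trans ((hF5.reg 40 rfl).trans h40')]
    · exact fun s' h _ => h.1
  · simp [size, block, inc]
    ring_nf
    omega

/-- Compute the list of uncolored vertices. -/
def listP : RamProg := block [.const 25 0, forTo 20 0 (block [.load 30 5 20,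
  .ite 30 3 .skip (block [.store 8 25 20, inc 25])])]

theorem listP_spec {k n m G q L : ℕ} {s : RamStore} (he : Env k n m G q L s) {P : ℕ → Prop}
    [DecidablePred P] (hP : ∀ u, P u ↔ u < n ∧ k ≤ s.arr 5 u) :
    Spec listP s (n * 30 + 30) fun s' => s'.reg 25 = Nat.count P n ∧
      ∀ i < Nat.count P n, s'.arr 8 i = Nat.nth P i := by
  apply Spec.le
  · apply Spec.seq_run
    · rfl
    intro hF1
    apply Spec.last
    have he1 := he.frame hF1 rfl
    apply spec_forTo n (fun j s' => s'.reg 25 = Nat.count P j ∧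
      ∀ i < Nat.count P j, s'.arr 8 i = Nat.nth P i) he1.r0 rfl (by simp [run])
    · rintro j hj s' ⟨h25, h8⟩ hi hl hF
      have he' := he1.frame hF rfl
      have a5 : s'.arr 5 = s.arr 5 := (hF.arr 5 rfl).trans (hF1.arr 5 rfl)
      apply Spec.of_run
      · rfl
      intro _
      have hPj : P j ↔ ¬ s.arr 5 j < k := by rw [hP]; simp [hj]
      by_cases hlt : s.arr 5 j < k
      · have : ¬ P j := by simp [hPj, hlt]
        simpa [block, run, inc, hi, a5, he'.r3, hlt, Nat.count_succ, this, h25] using h8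
      · have hj' : P j := by simp [hPj, hlt]
        have hc : Nat.count P (j + 1) = Nat.count P j + 1 := by simp [Nat.count_succ, hj']
        rw [hc]
        simp only [block, run, inc, RamStore.reg_setReg, RamStore.arr_setReg, hi, a5, he'.r3,
          Nat.reduceEqDiff, if_true, if_false, hlt]
        refine ⟨by simp [h25], fun i hi' => ?_⟩
        rcases Nat.lt_succ_iff_lt_or_eq.1 hi' with h | h
        · simp [h25, h.ne, h8 i h]
        · simp [h25, h, Nat.nth_count hj']
    · exact fun s' h _ => h
  · simp [size, block, inc]; omega

/-- `R 31 := R 25 / R 6 + 1`. -/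
def blockSizeP : RamProg := block [.const 31 1, .const 29 0, forTo 20 25 (block [inc 29,
  .ite 29 6 .skip (block [.const 29 0, inc 31])])]

/-- The machine cannot divide; quotients and remainders of a loop counter are kept up to date by
this recursion. The digits of the advice counter follow the same rule. -/
theorem succ_mod_div (j q : ℕ) (hq : 0 < q) : (j + 1) % q = (if j % q + 1 < q then j % q + 1 else 0) ∧
    (j + 1) / q = if j % q + 1 < q then j / q else j / q + 1 := by
  have h1 := Nat.div_add_mod j q
  have h2 := Nat.mod_lt j hq
  split_ifs with h
  · have := (Nat.div_mod_unique (a := j + 1) (c := j % q + 1) (d := j / q) hq).2 ⟨by omega, h⟩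
    exact ⟨this.2, this.1⟩
  · have h3 : j + 1 = q * (j / q + 1) := by rw [Nat.mul_succ]; omega
    rw [h3]
    simp [hq]

theorem blockSizeP_spec {k n m G q L N : ℕ} {s : RamStore} (he : Env k n m G q L s) (hq : 0 < q)
    (hN : s.reg 25 = N) :
    Spec blockSizeP s (N * 30 + 30) fun s' => s'.reg 31 = N / q + 1 := by
  apply Spec.le
  · apply Spec.seq_run
    · rfl
    intro hF1
    apply Spec.seq_run
    · rfl
    intro hF2
    apply Spec.last
    have he1 := (he.frame hF1 rfl).frame hF2 rfl
    apply spec_forTo N (fun j s' => s'.reg 31 = j / q + 1 ∧ s'.reg 29 = j % q)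
      (by simp [run, hN]) rfl (by simp [run])
    · rintro j hj s' ⟨h31, h29⟩ hi hl hF
      have he' := he1.frame hF rfl
      apply Spec.of_run
      · rfl
      intro _
      obtain ⟨e1, e2⟩ := succ_mod_div j q hq
      simp [block, run, inc, h29, h31, he'.r6, e1, e2, RamStore.reg_ite]
      split_ifs <;> simp_all
    · exact fun s' h _ => h.1
  · simp [size, block, inc]; omega

end RamProg

/-! ### Sampling, evaluation of the cost and update of the best clustering -/

namespace RamProg

open Finset CorrClust

/-- `R 26 :=` the type of the vertex `R 23`. -/
def typP : RamProg := block [block [.const 26 0, .add 27 46 11],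
  forTo 21 4 (block [.add 26 26 26, .ite 27 25 (block [.load 33 8 27, .load 34 2 33,
    .add 34 34 23, .load 34 0 34, .add 26 26 34]) .skip, .add 27 27 43,
    .ite 27 42 .skip (.sub 27 27 42)])]

theorem typP_spec {k n m G q L N : ℕ} {s : RamStore} (he : Env k n m G q L s)
    (hN : s.reg 25 = N) {ls : ℕ → ℕ} (hls : ∀ i < N, s.arr 8 i = ls i) :
    Spec typP s (m * 50 + 50) fun s' => s'.reg 26 =
      typ N ls (mat s) (s.reg 42) (s.reg 43) (s.reg 46) (s.reg 23) m := by
  apply Spec.le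
  · apply Spec.seq_run
    · rfl
    intro hF1
    have he1 := he.frame hF1 rfl
    apply Spec.last
    apply spec_forTo m (fun j s' => s'.reg 26 =
      typ N ls (mat s) (s.reg 42) (s.reg 43) (s.reg 46) (s.reg 23) j ∧
      s'.reg 27 = walk (s.reg 42) (s.reg 43) (s.reg 46) j) he1.r4 rfl
      (by simp [block, run, typ, walk, he.r11])
    · rintro j hj s' ⟨h26, h27⟩ hi hl hF
      apply Spec.of_run
      · rfl
      intro _
      have e25 := ((hF.reg 25 rfl).trans (hF1.reg 25 rfl)).trans hN
      have e23 := (hF.reg 23 rfl).trans (hF1.reg 23 rfl)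
      have e42 := (hF.reg 42 rfl).trans (hF1.reg 42 rfl)
      have e43 := (hF.reg 43 rfl).trans (hF1.reg 43 rfl)
      have a0 := (hF.arr 0 rfl).trans (hF1.arr 0 rfl)
      have a2 := (hF.arr 2 rfl).trans (hF1.arr 2 rfl)
      have a8 := (hF.arr 8 rfl).trans (hF1.arr 8 rfl)
      simp only [typ, walk]
      generalize walk (s.reg 42) (s.reg 43) (s.reg 46) j = x at *
      generalize typ N ls (mat s) (s.reg 42) (s.reg 43) (s.reg 46) (s.reg 23) j = y at *
      by_cases hx : x < N <;> by_cases hp : x + s.reg 43 < s.reg 42 <;>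
        simp [block, run, h26, h27, e25, e23, e42, e43, a0, a2, a8, hx, hp, hls, mat, two_mul]
    · exact fun s' h _ => h.1
  · simp [size, block]
    omega

/-- The coloring of the listed vertices. -/
def fillP : RamProg := block [block [.const 28 0, .const 29 0, .const 45 3, .sub 44 13 45,
  .load 42 3 44, inc 44, .load 43 3 44, inc 44, .load 46 3 44],
  forTo 20 25 (block [.load 23 8 20, typP, block [.add 35 28 26, .add 35 35 13, .load 35 3 35,
    .store 5 23 35, inc 29, .ite 29 31 .skip (block [.const 29 0, .add 28 28 5])]])]

theorem fillP_spec {k n m G q L N g : ℕ} {s : RamStore} (he : Env k n m G q L s)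
    (hN : s.reg 25 = N) {ls : ℕ → ℕ} (hls : ∀ i < N, s.arr 8 i = ls i) (hg : s.reg 31 = g)
    (hg0 : 0 < g) :
    Spec fillP s (N * (m * 50 + 120) + 50) fun s' => s'.arr 5 =
      fill G g ls (fun u => typ N ls (mat s) (s.arr 3 (6 * k)) (s.arr 3 (6 * k + 1))
        (s.arr 3 (6 * k + 2)) u m) (fun i => s.arr 3 (6 * k + 3 + i)) (s.arr 5) N := by
  set ty := fun u => typ N ls (mat s) (s.arr 3 (6 * k)) (s.arr 3 (6 * k + 1))
        (s.arr 3 (6 * k + 2)) u m with hty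
  apply Spec.le
  · apply Spec.seq_run
    · rfl
    intro hF1
    have he1 := he.frame hF1 rfl
    apply Spec.last
    -- Register 29 is the position inside the current block and register 28 the offset of that block
    -- in the word.
    apply spec_forTo N (fun i s' => s'.arr 5 =
      fill G g ls ty (fun i => s.arr 3 (6 * k + 3 + i)) (s.arr 5) i ∧
      s'.reg 28 = G * (i / g) ∧ s'.reg 29 = i % g) ((hF1.reg 25 rfl).trans hN) rfl
      (by simp [block, run, inc, fill])
    · rintro i hi s1 ⟨h5, h28, h29⟩ hi1 - hF2
      have he2 := he1.frame hF2 rfl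
      have a8 := (hF2.arr 8 rfl).trans (hF1.arr 8 rfl)
      have a3 := (hF2.arr 3 rfl).trans (hF1.arr 3 rfl)
      have a2 := (hF2.arr 2 rfl).trans (hF1.arr 2 rfl)
      have a0 := (hF2.arr 0 rfl).trans (hF1.arr 0 rfl)
      have e25 := ((hF2.reg 25 rfl).trans (hF1.reg 25 rfl)).trans hN
      have e31 := ((hF2.reg 31 rfl).trans (hF1.reg 31 rfl)).trans hg
      have e42 := hF2.reg 42 rfl
      have e43 := hF2.reg 43 rfl
      have e46 := hF2.reg 46 rfl
      simp [block, run, inc, he.r13] at e42 e43 e46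
      apply Spec.seq_run
      · rfl
      intro hF3
      have he3 := he2.frame hF3 rfl
      apply Spec.seq (typP_spec he3 (N := N) (by simp [run, e25]) (ls := ls)
        (by simpa [run, a8] using hls))
      intro s2 h26 hF4
      have he4 := he3.frame hF4 rfl
      apply Spec.last
      apply Spec.of_run
      · rfl
      intro _
      have hm : mat (run (.load 23 8 20) s1) = mat s := by
        funext u v
        simp [mat, run, a0, a2]
      have e23 : s2.reg 23 = ls i := (hF4.reg 23 rfl).trans (by simp [run, hi1, a8, hls i hi])
      have e26 : s2.reg 26 = ty (ls i) := by
        rw [h26, hm]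
        simp [run, e42, e43, e46, hi1, a8, hls i hi, hty]
      have b28 : s2.reg 28 = G * (i / g) := (hF4.reg 28 rfl).trans (by simp [run, h28])
      have b29 : s2.reg 29 = i % g := (hF4.reg 29 rfl).trans (by simp [run, h29])
      have b31 : s2.reg 31 = g := (hF4.reg 31 rfl).trans (by simp [run, e31])
      have b5 := (hF4.arr 5 rfl).trans h5
      have b3 : s2.arr 3 = s.arr 3 := (hF4.arr 3 rfl).trans a3
      obtain ⟨e1, e2⟩ := succ_mod_div i g hg0
      rw [e1, e2]
      by_cases hlt : i % g + 1 < g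
      · simp [block, run, inc, b29, b31, hlt, b28, e23, e26, b5, b3, fill, he4.r13,
          Nat.add_comm]
      · simp [block, run, inc, b29, b31, hlt, b28, e23, e26, b5, b3, fill, he4.r13, he4.r5,
          Nat.add_comm, Nat.mul_succ]
    · exact fun s' h _ => h.1
  · simp [size, block, inc]
    nlinarith

/-- The coloring of the uncolored vertices. -/
def sampleColorP : RamProg := block [listP, blockSizeP, fillP]

theorem sampleColorP_spec {k n m G q L : ℕ} {s : RamStore} (he : Env k n m G q L s) (hq : 0 < q) :
    Spec sampleColorP s (n * (m * 50 + 180) + 120) fun s' => s'.arr 5 =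
      sampleColor k n m G q (mat s) (s.arr 3 (6 * k)) (s.arr 3 (6 * k + 1)) (s.arr 3 (6 * k + 2))
        (fun i => s.arr 3 (6 * k + 3 + i)) (s.arr 5) := by
  set P := fun u => u < n ∧ k ≤ s.arr 5 u with hP
  have hNn : Nat.count P n ≤ n := Nat.count_le _
  apply Spec.le
  · apply Spec.seq (listP_spec he (P := P) fun u => Iff.rfl)
    rintro s1 ⟨h25, h8⟩ hF1
    have he1 := he.frame hF1 rfl
    apply Spec.seq (blockSizeP_spec he1 hq h25)
    intro s2 h31 hF2
    have he2 := he1.frame hF2 rfl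
    apply Spec.last
    apply (fillP_spec he2 (N := Nat.count P n) ((hF2.reg 25 rfl).trans h25) (ls := Nat.nth P)
      (by rw [hF2.arr 8 rfl]; exact h8) h31 (Nat.succ_pos _)).mono le_rfl
    intro s3 h3 _
    have hm : mat s2 = mat s := by
      funext u v
      simp [mat, (hF2.arr 0 rfl).trans (hF1.arr 0 rfl), (hF2.arr 2 rfl).trans (hF1.arr 2 rfl)]
    rw [h3, hm, (hF2.arr 3 rfl).trans (hF1.arr 3 rfl), (hF2.arr 5 rfl).trans (hF1.arr 5 rfl)]
    rfl
  · nlinarith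

/-- `R 47 :=` the cost of the clustering in array `5`. -/
def costP : RamProg := block [.const 47 0, forTo 20 0 (block [block [.load 30 5 20, .load 33 2 20],
  forTo 21 0 (block [.load 32 5 21, .add 34 33 21, .load 34 0 34, .ite 30 32 (.add 47 47 34)
    (.ite 32 30 (.add 47 47 34) (block [.sub 34 9 34, .add 47 47 34]))])])]

theorem costP_spec {k n m G q L : ℕ} {s : RamStore} (he : Env k n m G q L s) :
    Spec costP s (n * (n * 50 + 50) + 50) fun s' => s'.reg 47 = cost n (mat s) (s.arr 5) := by
  apply Spec.le
  · apply Spec.seq_run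
    · rfl
    intro hF1
    have he1 := he.frame hF1 rfl
    apply Spec.last
    apply spec_forTo n (fun u s' => s'.reg 47 = ∑ x ∈ range u, ∑ v ∈ range n,
      if s.arr 5 x = s.arr 5 v then 1 - mat s x v else mat s x v) he1.r0 rfl (by simp [run])
    · rintro u hu s1 h47 hu1 - hF2
      have he2 := he1.frame hF2 rfl
      have a5 := (hF2.arr 5 rfl).trans (hF1.arr 5 rfl)
      have a2 := (hF2.arr 2 rfl).trans (hF1.arr 2 rfl)
      have a0 := (hF2.arr 0 rfl).trans (hF1.arr 0 rfl)
      apply Spec.seq_run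
      · rfl
      intro hF3
      have he3 := he2.frame hF3 rfl
      apply Spec.last
      apply spec_forTo n (fun v s' => s'.reg 47 = ∑ x ∈ range u, (∑ v ∈ range n,
        if s.arr 5 x = s.arr 5 v then 1 - mat s x v else mat s x v) + ∑ x ∈ range v,
        if s.arr 5 u = s.arr 5 x then 1 - mat s u x else mat s u x) he3.r0 rfl
        (by simp [block, run, h47])
      · rintro v hv s2 h47' hv1 - hF4
        have he4 := he3.frame hF4 rfl
        have e30 := hF4.reg 30 rfl
        have e33 := hF4.reg 33 rfl
        have b5 := ((hF4.arr 5 rfl).trans (hF3.arr 5 rfl)).trans a5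
        have b0 := ((hF4.arr 0 rfl).trans (hF3.arr 0 rfl)).trans a0
        simp [block, run, a5, a2, hu1] at e30 e33
        apply Spec.of_run
        · rfl
        intro _
        rw [sum_range_succ, ← add_assoc]
        rcases lt_trichotomy (s.arr 5 u) (s.arr 5 v) with h | h | h
        · simp [block, run, e30, e33, b5, b0, hv1, h, h.ne, h47', mat]
        · simp [block, run, e30, e33, b5, b0, hv1, h, h47', mat, he4.r9]
        · simp [block, run, e30, e33, b5, b0, hv1, h, h.ne', h.not_gt, h47', mat]
      · intro s' h _
        rw [RamStore.reg_setReg, RamStore.reg_setReg, sum_range_succ]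
        simpa using h
    · exact fun s' h _ => h
  · simp [size, block]
    nlinarith

/-- Store the current clustering if it is the best so far. -/
def updateP : RamProg := .ite 47 10 (block [.add 10 47 11,
  forTo 20 0 (block [.load 30 5 20, .store 1 20 30])]) .skip

theorem updateP_spec {k n m G q L : ℕ} {s : RamStore} (he : Env k n m G q L s) :
    Spec updateP s (n * 30 + 30) fun s' =>
      (s.reg 47 < s.reg 10 → s'.reg 10 = s.reg 47 ∧ ∀ u < n, s'.arr 1 u = s.arr 5 u) ∧
      (¬ s.reg 47 < s.reg 10 → s'.reg 10 = s.reg 10 ∧ s'.arr 1 = s.arr 1) := by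
  apply Spec.le
  · apply Spec.ite
    · intro hlt
      apply Spec.seq_run
      · rfl
      intro hF1
      have he1 := he.frame hF1 rfl
      apply Spec.last
      apply spec_forTo n (fun j s' => ∀ u < j, s'.arr 1 u = s.arr 5 u) he1.r0 rfl (by simp)
      · rintro j hj s' hI hi - hF2
        apply Spec.of_run
        · rfl
        intro _ u hu
        have a5 := (hF2.arr 5 rfl).trans (hF1.arr 5 rfl)
        rcases Nat.lt_succ_iff_lt_or_eq.1 hu with h | h
        · simp [block, run, hi, a5, h.ne, hI u h]
        · simp [block, run, hi, a5, h]
      · intro s' h hF2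
        have := hF2.reg 10 rfl
        simp [run, he.r11] at this
        exact ⟨fun _ => ⟨this, h⟩, fun h => (h hlt).elim⟩
    · intro hlt
      apply Spec.le
      · apply Spec.of_run
        · rfl
        intro _
        exact ⟨fun h => (hlt h).elim, fun _ => ⟨rfl, rfl⟩⟩
      · simp only [size]; omega
  · simp [size, block]
    omega

end RamProg

/-! ### Mixed radix digits -/

namespace CorrClust

open Finset

/-- The place value of the digit `j` in the mixed radix system with digits `≤ ub j`. -/
def place (ub : ℕ → ℕ) (j : ℕ) : ℕ := ∏ i ∈ range j, (ub i + 1)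

/-- The digit `j` of `t`. -/
def digit (ub : ℕ → ℕ) (t j : ℕ) : ℕ := t / place ub j % (ub j + 1)

theorem place_succ (ub : ℕ → ℕ) (j : ℕ) : place ub (j + 1) = place ub j * (ub j + 1) :=
  prod_range_succ ..

theorem place_pos (ub : ℕ → ℕ) (j : ℕ) : 0 < place ub j := prod_pos fun _ _ => Nat.succ_pos _

theorem digit_le (ub : ℕ → ℕ) (t j : ℕ) : digit ub t j ≤ ub j :=
  Nat.lt_succ_iff.1 (Nat.mod_lt _ (Nat.succ_pos _))

/-- Divisibility of t + 1 by the place value of j means that all lower digits of t are maximal, that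
is, the increment carries into position j. The three cases are: the carry is absorbed, it is passed
on, there is none. -/
theorem digit_succ (ub : ℕ → ℕ) (t j : ℕ) :
    (place ub j ∣ t + 1 → digit ub t j < ub j →
      digit ub (t + 1) j = digit ub t j + 1 ∧ ¬ place ub (j + 1) ∣ t + 1) ∧
    (place ub j ∣ t + 1 → ¬ digit ub t j < ub j →
      digit ub (t + 1) j = 0 ∧ place ub (j + 1) ∣ t + 1) ∧
    (¬ place ub j ∣ t + 1 → digit ub (t + 1) j = digit ub t j ∧ ¬ place ub (j + 1) ∣ t + 1) := by
  have hM := place_pos ub j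
  have key : place ub j ∣ t + 1 → (place ub (j + 1) ∣ t + 1 ↔ digit ub (t + 1) j = 0) := by
    intro h
    rw [place_succ, digit]
    conv_lhs => rw [← Nat.mul_div_cancel' h]
    rw [Nat.mul_dvd_mul_iff_left hM, Nat.dvd_iff_mod_eq_zero]
  obtain ⟨e1, e2⟩ := RamProg.succ_mod_div (t / place ub j) (ub j + 1) (Nat.succ_pos _)
  have hs : (t + 1) / place ub j = t / place ub j + if place ub j ∣ t + 1 then 1 else 0 :=
    Nat.succ_div
  refine ⟨fun h h' => ?_, fun h h' => ?_, fun h => ?_⟩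
  · have : digit ub (t + 1) j = digit ub t j + 1 := by
      rw [if_pos h] at hs
      simp only [digit] at *
      rw [hs, e1, if_pos (by omega)]
    exact ⟨this, by rw [key h, this]; omega⟩
  · have : digit ub (t + 1) j = 0 := by
      rw [if_pos h] at hs
      simp only [digit] at *
      rw [hs, e1, if_neg (by omega)]
    exact ⟨this, by rw [key h, this]⟩
  · rw [if_neg h] at hs
    exact ⟨by simp only [digit, hs, Nat.add_zero],
      fun h' => h ((Dvd.intro _ (place_succ ub j).symm).trans h')⟩

/-- Counting up to `place ub L` therefore visits every digit string. The top digit is added at its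
place value, which leaves the lower digits unchanged. -/
theorem exists_digit_eq (ub z : ℕ → ℕ) (hz : ∀ j, z j ≤ ub j) (L : ℕ) :
    ∃ t < place ub L, ∀ j < L, digit ub t j = z j := by
  induction L with
  | zero => exact ⟨0, place_pos ub 0, by simp⟩
  | succ L ih =>
    obtain ⟨t, ht, h⟩ := ih
    refine ⟨t + place ub L * z L, ?_, fun j hj => ?_⟩
    · rw [place_succ]
      nlinarith [hz L, Nat.zero_le (place ub L)]
    · rcases Nat.lt_succ_iff_lt_or_eq.1 hj with hj | rfl
      · rw [← h j hj]
        obtain ⟨r, hr⟩ : place ub (j + 1) ∣ place ub L :=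
          prod_dvd_prod_of_subset _ _ _ (range_subset_range.2 hj)
        rw [digit, digit, hr, place_succ, Nat.mul_assoc, Nat.mul_assoc,
          Nat.add_mul_div_left _ _ (place_pos ub j), Nat.add_mul_mod_self_left]
      · rw [digit, Nat.add_mul_div_left _ _ (place_pos ub j), Nat.div_eq_of_lt ht, Nat.zero_add,
          Nat.mod_eq_of_lt (Nat.lt_succ_iff.2 (hz j))]

end CorrClust

/-! ### The counter that runs through the advice strings -/

namespace RamProg

open Finset CorrClust

/-- Pass to the next digit string, or set `R 8 := 1` if there is none. -/
def nextP : RamProg := block [.const 48 1, forTo 20 7 (.ite 11 48 (block [.load 30 3 20,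
  .load 31 4 20, .ite 30 31 (block [inc 30, .store 3 20 30, .const 48 0]) (.store 3 20 11)]) .skip),
  .ite 11 48 (.const 8 1) .skip]

/-- Register 48 is the carry. A carry out of the last digit means that `place (s.arr 4) L` divides t
+ 1, which for the values of t that occur happens only at the end of the enumeration. -/
theorem nextP_spec {k n m G q L t : ℕ} {s : RamStore} (he : Env k n m G q L s)
    (h3 : ∀ j, s.arr 3 j = digit (s.arr 4) t j) (hub : ∀ j ≥ L, s.arr 4 j = 0) :
    Spec nextP s (L * 40 + 40) fun s' => (∀ j, s'.arr 3 j = digit (s.arr 4) (t + 1) j) ∧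
      (t + 1 < place (s.arr 4) L → s'.reg 8 = s.reg 8) ∧
      (t + 1 = place (s.arr 4) L → s'.reg 8 = 1) := by
  apply Spec.le
  · apply Spec.seq_run
    · rfl
    intro hF1
    have he1 := he.frame hF1 rfl
    apply Spec.seq
    · apply spec_forTo (Q := fun s' => (∀ i, s'.arr 3 i = digit (s.arr 4) (t + 1) i) ∧
        s'.reg 48 = if place (s.arr 4) L ∣ t + 1 then 1 else 0)
        L (fun j s' => (∀ i, s'.arr 3 i =
        if i < j then digit (s.arr 4) (t + 1) i else digit (s.arr 4) t i) ∧
        s'.reg 48 = if place (s.arr 4) j ∣ t + 1 then 1 else 0) he1.r7 rfl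
      · simp [run, h3, place]
      · rintro j hj s' ⟨hI, h48⟩ hi - hF2
        have he2 := he1.frame hF2 rfl
        have a4 := (hF2.arr 4 rfl).trans (hF1.arr 4 rfl)
        have h3j := hI j
        simp only [lt_irrefl, if_false] at h3j
        apply Spec.of_run
        · rfl
        intro _
        obtain ⟨d1, d2, d3⟩ := digit_succ (s.arr 4) t j
        have step : ∀ x : ℕ → ℕ, x j = digit (s.arr 4) (t + 1) j →
            (∀ i ≠ j, x i = s'.arr 3 i) → ∀ i, x i =
              if i < j + 1 then digit (s.arr 4) (t + 1) i else digit (s.arr 4) t i := by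
          intro x hx hx' i
          rcases lt_trichotomy i j with h | rfl | h
          · rw [hx' i h.ne, hI, if_pos h, if_pos (by omega)]
          · rw [hx, if_pos (by omega)]
          · rw [hx' i h.ne', hI, if_neg (by omega), if_neg (by omega)]
        by_cases hd : place (s.arr 4) j ∣ t + 1
        · rw [if_pos hd] at h48
          by_cases hl : digit (s.arr 4) t j < s.arr 4 j
          · obtain ⟨d4, d5⟩ := d1 hd hl
            simp only [block, run, inc, RamStore.reg_setReg, RamStore.arr_setReg, hi, a4, he2.r11,
              h48, h3j, Nat.reduceEqDiff, if_true, if_false, hl, Nat.zero_lt_one]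
            refine ⟨step _ ?_ ?_, by simp [d5]⟩
            · simp [d4]
            · intro i hij
              simp [hij]
          · obtain ⟨d4, d5⟩ := d2 hd hl
            simp only [block, run, inc, RamStore.reg_setReg, RamStore.arr_setReg, hi, a4, he2.r11,
              h48, h3j, Nat.reduceEqDiff, if_true, if_false, hl, Nat.zero_lt_one]
            refine ⟨step _ ?_ ?_, by simp [d5, h48]⟩
            · simp [d4]
            · intro i hij
              simp [hij]
        · obtain ⟨d4, d5⟩ := d3 hd
          rw [if_neg hd] at h48
          have : run (ite 11 48 (block [load 30 3 20, load 31 4 20, ite 30 31 (block [inc 30,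
            store 3 20 30, const 48 0]) (store 3 20 11)]) skip) s' = s' := by
            simp [run, h48]
          rw [this]
          refine ⟨step _ (by simp [d4, h3j]) fun _ _ => rfl, by simp [d5, h48]⟩
      · rintro s' ⟨h, h'⟩ -
        refine ⟨fun i => ?_, h'⟩
        rw [h i]
        split_ifs with hiL
        · rfl
        -- Beyond position `L` the bound is 0, so both digits are residues modulo 1.
        · simp [digit, hub i (by omega), Nat.mod_one]
    rintro s1 ⟨hz, h48⟩ hF2
    have he2 := he1.frame hF2 rfl
    apply Spec.last
    apply Spec.of_run
    · rfl
    intro _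
    refine ⟨?_, fun h => ?_, fun h => ?_⟩
    · simpa [run, RamStore.arr_ite] using hz
    · rw [if_neg fun hd => by have := Nat.le_of_dvd (Nat.succ_pos t) hd; omega] at h48
      simp [run, he2.r11, h48, (hF2.reg 8 rfl).trans (hF1.reg 8 rfl)]
    · rw [if_pos (by rw [h])] at h48
      simp [run, he2.r11, h48]
  · simp [size, block, inc]
    omega

end RamProg

/-! ### Initialization of constants, row addresses and digit bounds -/

namespace RamProg

open Finset CorrClust

theorem rowIndex_inj {n u v u' v' : ℕ} (hv : v < n) (hv' : v' < n) (h : u * n + v = u' * n + v') :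
    u = u' ∧ v = v' := by
  have h1 := (Nat.div_mod_unique (a := u * n + v) (c := v) (d := u) (by omega)).2
    ⟨by rw [Nat.mul_comm n, Nat.add_comm], hv⟩
  have h2 := (Nat.div_mod_unique (a := u' * n + v') (c := v') (d := u') (by omega)).2
    ⟨by rw [Nat.mul_comm n, Nat.add_comm], hv'⟩
  rw [h] at h1
  exact ⟨h1.1.symm.trans h2.1, h1.2.symm.trans h2.2⟩

/-- `R x := 2 ^ R y`. -/
def powP (x y : ℕ) : RamProg := block [.const x 1, forTo 20 y (.add x x x)]

theorem powP_spec {x y N : ℕ} {s : RamStore} (hN : s.reg y = N) (hxy : y ≠ x) (hx : x ≠ 20)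
    (hx' : x ≠ 50) (hy : y ≠ 20) (hy' : y ≠ 50) :
    Spec (powP x y) s (N * 6 + 10) fun s' => s'.reg x = 2 ^ N := by
  apply Spec.le
  · apply Spec.seq_run
    · rfl
    intro hF1
    apply Spec.last
    apply spec_forTo N (fun j s' => s'.reg x = 2 ^ j) (by simp [run, hN, hxy])
    · simp [writesReg, hxy, hx.symm, hy.symm, hy']
    · simp [run, hx]
    · intro j hj s' hI hi _ hF2
      apply Spec.of_run
      · rfl
      intro _
      simp [run, hx, hx', hI, pow_succ, mul_two]
    · exact fun s' h _ => h
  · simp [size]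
    omega

/-- Compute the constants, the addresses of the rows and the bounds of the digits, and complete
the diagonal of the matrix. -/
def setupP (k c : ℕ) : RamProg := block [
  block [.const 3 k, .const 9 1, .const 12 (2 * k), .const 13 (6 * k + 3), .const 14 c,
    .add 15 2 14],
  powP 4 15, powP 5 4, powP 6 5,
  block [.const 16 0, .add 17 0 9],
  forTo 20 17 (block [.store 2 20 16, .add 16 16 0]),
  forTo 20 0 (block [.load 18 2 20, .add 18 18 20, .store 0 18 9]),
  block [.load 10 2 0, .add 10 10 9, .const 19 0],
  forTo 20 5 (.add 19 19 6),
  block [.add 7 19 13, .add 18 0 0, .add 18 18 3],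
  forTo 20 13 (.store 4 20 18),
  .sub 18 3 9,
  forTo 20 19 (block [.add 16 13 20, .store 4 16 18])]

-- Addresses are prepared for n + 1 rows: row n lies behind the input matrix and will serve as the
-- zero row. The ones on the diagonal keep a vertex from disagreeing with its own cluster. The
-- parameters are iterated powers of two because the machine reaches these by doubling, without
-- multiplication.
set_option maxHeartbeats 1000000 in
theorem setupP_spec (k c : ℕ) {s : RamStore} {n d m G q L : ℕ} (h0 : s.reg 0 = n)
    (h2 : s.reg 2 = d) (h8 : s.reg 8 = 0) (h11 : s.reg 11 = 0) (h4 : ∀ j, s.arr 4 j = 0)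
    (hm : m = 2 ^ (d + c)) (hG : G = 2 ^ m) (hq : q = 2 ^ G) (hL : L = 6 * k + 3 + G * q) :
    Spec (setupP k c) s ((n + d + c + m + G + L) * 50 + 500) fun s' =>
      Env k n m G q L s' ∧ s'.reg 8 = 0 ∧ s'.reg 10 = n * n + 1 ∧
      s'.arr 4 = digitBound k n (G * q) ∧
      (∀ u < n, ∀ v < n, mat s' u v = if u = v then 1 else s.arr 0 (u * n + v)) ∧
      (∀ v < n, mat s' n v = s.arr 0 (n * n + v)) := by
  apply Spec.le
  · apply Spec.seq_run
    · rfl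
    intro hF1
    apply Spec.seq (powP_spec (N := d + c) (by simp [block, run, h2]) (by decide) (by decide)
      (by decide) (by decide) (by decide))
    intro s2 h24 hF2
    rw [← hm] at h24
    apply Spec.seq (powP_spec (N := m) h24 (by decide) (by decide)
      (by decide) (by decide) (by decide))
    intro s3 h35 hF3
    rw [← hG] at h35
    apply Spec.seq (powP_spec (N := G) h35 (by decide) (by decide)
      (by decide) (by decide) (by decide))
    intro s4 h46 hF4
    rw [← hq] at h46
    have e0 : s4.reg 0 = n := ((hF4.reg 0 rfl).trans ((hF3.reg 0 rfl).trans
      ((hF2.reg 0 rfl).trans (hF1.reg 0 rfl)))).trans h0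
    have e8 : s4.reg 8 = 0 := ((hF4.reg 8 rfl).trans ((hF3.reg 8 rfl).trans
      ((hF2.reg 8 rfl).trans (hF1.reg 8 rfl)))).trans h8
    have e11 : s4.reg 11 = 0 := ((hF4.reg 11 rfl).trans ((hF3.reg 11 rfl).trans
      ((hF2.reg 11 rfl).trans (hF1.reg 11 rfl)))).trans h11
    have e3 : s4.reg 3 = k := ((hF4.reg 3 rfl).trans ((hF3.reg 3 rfl).trans
      (hF2.reg 3 rfl))).trans (by simp [block, run])
    have e9 : s4.reg 9 = 1 := ((hF4.reg 9 rfl).trans ((hF3.reg 9 rfl).trans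
      (hF2.reg 9 rfl))).trans (by simp [block, run])
    have e12 : s4.reg 12 = 2 * k := ((hF4.reg 12 rfl).trans ((hF3.reg 12 rfl).trans
      (hF2.reg 12 rfl))).trans (by simp [block, run])
    have e13 : s4.reg 13 = 6 * k + 3 := ((hF4.reg 13 rfl).trans ((hF3.reg 13 rfl).trans
      (hF2.reg 13 rfl))).trans (by simp [block, run])
    have e4 : s4.reg 4 = m := ((hF4.reg 4 rfl).trans (hF3.reg 4 rfl)).trans h24
    have e5 : s4.reg 5 = G := (hF4.reg 5 rfl).trans h35
    have a4 : ∀ j, s4.arr 4 j = 0 := fun j => by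
      rw [(hF4.arr 4 rfl), (hF3.arr 4 rfl), (hF2.arr 4 rfl), (hF1.arr 4 rfl), h4]
    have a0 : s4.arr 0 = s.arr 0 := by
      rw [(hF4.arr 0 rfl), (hF3.arr 0 rfl), (hF2.arr 0 rfl), (hF1.arr 0 rfl)]
    clear hF1 hF2 hF3 hF4 h24 h35
    apply Spec.seq_run
    · rfl
    intro hF5
    apply Spec.seq
    · apply spec_forTo (n + 1) (Q := fun s' => ∀ u ≤ n, s'.arr 2 u = u * n)
        (fun j s' => (∀ u < j, s'.arr 2 u = u * n) ∧ s'.reg 16 = j * n)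
        (by simp [block, run, e0, e9]) rfl (by simp [block, run])
      · rintro j hj s' ⟨hI, h16⟩ hi - hF
        apply Spec.of_run
        · rfl
        intro _
        refine ⟨fun u hu => ?_, ?_⟩
        · rcases Nat.lt_succ_iff_lt_or_eq.1 hu with h | h
          · simp [block, run, hi, h.ne, hI u h]
          · simp [block, run, hi, h, h16]
        · simp [block, run, h16, Nat.succ_mul, (hF.reg 0 rfl).trans ((hF5.reg 0 rfl).trans e0)]
      · rintro s' ⟨h, -⟩ - u hu
        exact h u (by omega)
    intro s6 h62 hF6
    have e60 : s6.reg 0 = n := (hF6.reg 0 rfl).trans ((hF5.reg 0 rfl).trans e0)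
    have e69 : s6.reg 9 = 1 := (hF6.reg 9 rfl).trans ((hF5.reg 9 rfl).trans e9)
    have a60 : s6.arr 0 = s.arr 0 := (hF6.arr 0 rfl).trans ((hF5.arr 0 rfl).trans a0)
    apply Spec.seq
    · apply spec_forTo n (Q := fun s' => (∀ u < n, s'.arr 0 (u * n + u) = 1) ∧
          ∀ i, (∀ u < n, i ≠ u * n + u) → s'.arr 0 i = s.arr 0 i)
        (fun j s' => (∀ u < j, s'.arr 0 (u * n + u) = 1) ∧
          ∀ i, (∀ u < n, i ≠ u * n + u) → s'.arr 0 i = s.arr 0 i)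
        e60 rfl (by simp [a60])
      · rintro j hj s' ⟨hI, hI'⟩ hi - hF
        have b2 := hF.arr 2 rfl
        have b9 := (hF.reg 9 rfl).trans e69
        apply Spec.of_run
        · rfl
        intro _
        refine ⟨fun u hu => ?_, fun i hi' => ?_⟩
        · rcases Nat.lt_succ_iff_lt_or_eq.1 hu with h | h
          · have : u * n + u ≠ j * n + j := fun he => h.ne (rowIndex_inj (h.trans hj) hj he).1
            simp [block, run, hi, b2, h62 j hj.le, this, hI u h]
          · simp [block, run, hi, b2, h62 j hj.le, h, b9]
        · simp [block, run, hi, b2, h62 j hj.le, hi' j hj, hI' i hi']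
      · exact fun s' h _ => h
    rintro s7 ⟨hd, hd'⟩ hF7
    apply Spec.seq_run
    · rfl
    intro hF8
    apply Spec.seq
    · apply spec_forTo G (Q := fun s' => s'.reg 19 = G * q) (fun j s' => s'.reg 19 = j * q)
        ((hF8.reg 5 rfl).trans ((hF7.reg 5 rfl).trans ((hF6.reg 5 rfl).trans
        ((hF5.reg 5 rfl).trans e5)))) rfl (by simp [block, run])
      · intro j hj s' hI hi _ hF
        apply Spec.of_run
        · rfl
        intro _
        have : s'.reg 6 = q := (hF.reg 6 rfl).trans ((hF8.reg 6 rfl).trans ((hF7.reg 6 rfl).trans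
          ((hF6.reg 6 rfl).trans ((hF5.reg 6 rfl).trans h46))))
        simp [run, hI, this, Nat.succ_mul]
      · exact fun s' h _ => h
    intro s9 h19 hF9
    apply Spec.seq_run
    · rfl
    intro hF10
    have tr : ∀ r, (writesReg r (block [.const 16 0, .add 17 0 9]) || writesReg r (forTo 20 17
        (block [.store 2 20 16, .add 16 16 0])) || writesReg r (forTo 20 0 (block [.load 18 2 20,
        .add 18 18 20, .store 0 18 9])) || writesReg r (block [.load 10 2 0, .add 10 10 9,
        .const 19 0]) || writesReg r (forTo 20 5 (.add 19 19 6))) = false →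
        s9.reg r = s4.reg r := by
      intro r hr
      simp only [Bool.or_eq_false_iff] at hr
      rw [hF9.reg r hr.2, hF8.reg r hr.1.2, hF7.reg r hr.1.1.2, hF6.reg r hr.1.1.1.2,
        hF5.reg r hr.1.1.1.1]
    have b0 := (tr 0 rfl).trans e0
    have b3 := (tr 3 rfl).trans e3
    have b4 := (tr 4 rfl).trans e4
    have b5 := (tr 5 rfl).trans e5
    have b6 := (tr 6 rfl).trans h46
    have b8 := (tr 8 rfl).trans e8
    have b9 := (tr 9 rfl).trans e9
    have b11 := (tr 11 rfl).trans e11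
    have b12 := (tr 12 rfl).trans e12
    have b13 := (tr 13 rfl).trans e13
    have b17 : s9.reg 17 = n + 1 := by
      rw [hF9.reg 17 rfl, hF8.reg 17 rfl, hF7.reg 17 rfl, hF6.reg 17 rfl]
      simp [block, run, e0, e9]
    have b10 : s9.reg 10 = n * n + 1 := by
      rw [hF9.reg 10 rfl]
      simp [block, run, (hF7.reg 0 rfl).trans e60, (hF7.reg 9 rfl).trans e69,
        hF7.arr 2 rfl, h62 n le_rfl]
    have c2 : ∀ u ≤ n, s9.arr 2 u = u * n := fun u hu => by
      rw [hF9.arr 2 rfl, hF8.arr 2 rfl, hF7.arr 2 rfl, h62 u hu]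
    have c0 : s9.arr 0 = s7.arr 0 := by rw [hF9.arr 0 rfl, hF8.arr 0 rfl]
    have c4 : ∀ j, s9.arr 4 j = 0 := fun j => by
      rw [hF9.arr 4 rfl, hF8.arr 4 rfl, hF7.arr 4 rfl, hF6.arr 4 rfl, hF5.arr 4 rfl, a4]
    apply Spec.seq
    · apply spec_forTo (6 * k + 3) (Q := fun s' => ∀ i, s'.arr 4 i =
          if i < 6 * k + 3 then 2 * n + k else 0) (fun j s' => ∀ i, s'.arr 4 i =
          if i < j then 2 * n + k else 0) ((hF10.reg 13 rfl).trans b13) rfl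
        (by simp [block, run, c4])
      · intro j hj s' hI hi _ hF
        apply Spec.of_run
        · rfl
        intro _ i
        have : s'.reg 18 = 2 * n + k := (hF.reg 18 rfl).trans (by simp [block, run, b0, b3, two_mul])
        simp only [run, RamStore.arr_setReg, RamStore.arr_setArr, if_true, hi, this,
          Function.update_apply, hI]
        split_ifs <;> omega
      · exact fun s' h _ => h
    intro s11 h114 hF11
    apply Spec.seq_run
    · rfl
    intro hF12
    apply Spec.last
    have b1119 : s11.reg 19 = G * q := (hF11.reg 19 rfl).trans ((hF10.reg 19 rfl).trans h19)
    -- `digitBound` with a word of length `j` is itself the invariant.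
    apply spec_forTo (G * q) (fun j s' => ∀ i, s'.arr 4 i = digitBound k n j i)
        ((hF12.reg 19 rfl).trans b1119) rfl
    · intro i
      simp only [run, RamStore.arr_setReg, h114, digitBound]
      split_ifs <;> omega
    · intro j hj s' hI hi _ hF
      apply Spec.of_run
      · rfl
      intro _ i
      have h18 : s'.reg 18 = k - 1 := by
        rw [hF.reg 18 rfl]
        simp [run, (hF11.reg 3 rfl).trans ((hF10.reg 3 rfl).trans b3),
          (hF11.reg 9 rfl).trans ((hF10.reg 9 rfl).trans b9)]
      have h13 : s'.reg 13 = 6 * k + 3 := by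
        rw [hF.reg 13 rfl, hF12.reg 13 rfl, hF11.reg 13 rfl, hF10.reg 13 rfl, b13]
      simp [block, run, hi, h18, h13, Function.update_apply, hI, digitBound]
      split_ifs <;> omega
    · intro s' hI hF
      have e10 : ∀ r, (writesReg r (block [.add 7 19 13, .add 18 0 0, .add 18 18 3]) ||
          writesReg r (forTo 20 13 (.store 4 20 18)) || writesReg r (.sub 18 3 9) ||
          writesReg r (forTo 20 19 (block [.add 16 13 20, .store 4 16 18]))) = false →
          s'.reg r = s9.reg r := by
        intro r hr
        simp only [Bool.or_eq_false_iff] at hr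
        rw [hF.reg r hr.2, hF12.reg r hr.1.2, hF11.reg r hr.1.1.2, hF10.reg r hr.1.1.1]
      have h7 : s'.reg 7 = L := by
        rw [hF.reg 7 rfl, hF12.reg 7 rfl, hF11.reg 7 rfl]
        simp [block, run, h19, b13, hL, Nat.add_comm]
      have d0 : s'.arr 0 = s7.arr 0 := by
        rw [hF.arr 0 rfl, hF12.arr 0 rfl, hF11.arr 0 rfl, hF10.arr 0 rfl, c0]
      have d2 : ∀ u ≤ n, s'.arr 2 u = u * n := by
        intro u hu
        rw [hF.arr 2 rfl, hF12.arr 2 rfl, hF11.arr 2 rfl, hF10.arr 2 rfl, c2 u hu]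
      refine ⟨⟨(e10 0 rfl).trans b0, (e10 3 rfl).trans b3, (e10 4 rfl).trans b4,
        (e10 5 rfl).trans b5, (e10 6 rfl).trans b6, h7, (e10 9 rfl).trans b9,
        (e10 11 rfl).trans b11, (e10 12 rfl).trans b12, (e10 13 rfl).trans b13,
        (e10 17 rfl).trans b17⟩, (e10 8 rfl).trans b8, (e10 10 rfl).trans b10, funext hI, ?_, ?_⟩
      · intro u hu v hv
        rw [mat, d2 u hu.le, d0]
        split_ifs with huv
        · rw [← huv, hd u hu]
        · apply hd'
          intro w hw h
          obtain ⟨h1, h2⟩ := rowIndex_inj hv hw h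
          exact huv (h1.trans h2.symm)
      · intro v hv
        rw [mat, d2 n le_rfl, d0]
        apply hd'
        intro w hw h
        exact hw.ne' (rowIndex_inj hv hw h).1
  · simp [size, block]
    omega

end RamProg

/-! ### The exhaustive search -/

namespace RamProg

open Finset CorrClust

/-- One round: compute and evaluate the clustering that is described by the digits, and pass to the
next digits. -/
def roundP : RamProg := block [peelP, sampleColorP, costP, updateP, nextP]

theorem roundP_spec {k n m G q L t : ℕ} {s : RamStore} (he : Env k n m G q L s) (hq : 0 < q)
    (h3 : ∀ j, s.arr 3 j = digit (s.arr 4) t j) (hub : ∀ j ≥ L, s.arr 4 j = 0) :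
    Spec roundP s (2 * k * (n * (n * 50 + 130) + 120) + n * (n * 50 + m * 50 + 320) + L * 40 + 300)
      fun s' => Env k n m G q L s' ∧ mat s' = mat s ∧ s'.arr 4 = s.arr 4 ∧
      (∀ j, s'.arr 3 j = digit (s.arr 4) (t + 1) j) ∧
      (t + 1 < place (s.arr 4) L → s'.reg 8 = s.reg 8) ∧
      (t + 1 = place (s.arr 4) L → s'.reg 8 = 1) ∧
      (cost n (mat s) (candidate k n m G q (mat s) (digit (s.arr 4) t)) < s.reg 10 →
        s'.reg 10 = cost n (mat s) (candidate k n m G q (mat s) (digit (s.arr 4) t)) ∧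
        ∀ u < n, s'.arr 1 u = candidate k n m G q (mat s) (digit (s.arr 4) t) u) ∧
      (¬ cost n (mat s) (candidate k n m G q (mat s) (digit (s.arr 4) t)) < s.reg 10 →
        s'.reg 10 = s.reg 10 ∧ s'.arr 1 = s.arr 1) := by
  have hmat : ∀ {s s' : RamStore}, s'.arr 0 = s.arr 0 → s'.arr 2 = s.arr 2 → mat s' = mat s := by
    intro s s' h0 h2
    funext u v
    simp [mat, h0, h2]
  have h3' : s.arr 3 = digit (s.arr 4) t := funext h3
  apply Spec.le
  · apply Spec.seq (peelP_spec he)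
    intro s1 h1 hF1
    have he1 := he.frame hF1 rfl
    apply Spec.seq (sampleColorP_spec he1 hq)
    intro s2 h2 hF2
    have he2 := he1.frame hF2 rfl
    rw [hmat (hF1.arr 0 rfl) (hF1.arr 2 rfl), hF1.arr 3 rfl] at h2
    have hcol : ∀ u < n, s2.arr 5 u = candidate k n m G q (mat s) (digit (s.arr 4) t) u := by
      intro u hu
      rw [h2, ← h3']
      exact sampleColor_congr (fun u hu => (h1 u hu).1) hu
    apply Spec.seq (costP_spec he2)
    intro s3 h47 hF3
    have he3 := he2.frame hF3 rfl
    rw [cost_congr hcol, hmat (hF2.arr 0 rfl) (hF2.arr 2 rfl),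
      hmat (hF1.arr 0 rfl) (hF1.arr 2 rfl)] at h47
    apply Spec.seq (updateP_spec he3)
    intro s4 h4 hF4
    have he4 := he3.frame hF4 rfl
    have h10 : s3.reg 10 = s.reg 10 := by
      rw [hF3.reg 10 rfl, hF2.reg 10 rfl, hF1.reg 10 rfl]
    have a5 : s3.arr 5 = s2.arr 5 := hF3.arr 5 rfl
    have a1 : s3.arr 1 = s.arr 1 := by rw [hF3.arr 1 rfl, hF2.arr 1 rfl, hF1.arr 1 rfl]
    have a4 : s4.arr 4 = s.arr 4 := by
      rw [hF4.arr 4 rfl, hF3.arr 4 rfl, hF2.arr 4 rfl, hF1.arr 4 rfl]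
    have a3 : s4.arr 3 = s.arr 3 := by
      rw [hF4.arr 3 rfl, hF3.arr 3 rfl, hF2.arr 3 rfl, hF1.arr 3 rfl]
    have e8 : s4.reg 8 = s.reg 8 := by
      rw [hF4.reg 8 rfl, hF3.reg 8 rfl, hF2.reg 8 rfl, hF1.reg 8 rfl]
    rw [h47, h10, a5, a1] at h4
    apply Spec.last
    apply (nextP_spec (t := t) he4 (by rw [a3, a4]; exact h3) (by rw [a4]; exact hub)).mono le_rfl
    rintro s5 ⟨g1, g2, g3⟩ hF5
    rw [a4] at g1 g2 g3
    rw [e8] at g2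
    refine ⟨he4.frame hF5 rfl, ?_, by rw [hF5.arr 4 rfl, a4], g1, g2, g3, fun h => ?_, fun h => ?_⟩
    · rw [hmat (hF5.arr 0 rfl) (hF5.arr 2 rfl), hmat (hF4.arr 0 rfl) (hF4.arr 2 rfl),
        hmat (hF3.arr 0 rfl) (hF3.arr 2 rfl), hmat (hF2.arr 0 rfl) (hF2.arr 2 rfl),
        hmat (hF1.arr 0 rfl) (hF1.arr 2 rfl)]
    · obtain ⟨g4, g5⟩ := h4.1 h
      refine ⟨(hF5.reg 10 rfl).trans g4, fun u hu => ?_⟩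
      rw [hF5.arr 1 rfl, g5 u hu, hcol u hu]
    · obtain ⟨g4, g5⟩ := h4.2 h
      exact ⟨(hF5.reg 10 rfl).trans g4, (hF5.arr 1 rfl).trans g5⟩
  · nlinarith

/-- The whole program. -/
def clusterP (k c : ℕ) : RamProg := block [setupP k c, .loop 8 9 roundP]

/-- A bound for the running time of `clusterP`. -/
def clusterTime (k n d c m G L : ℕ) (ub : ℕ → ℕ) : ℕ :=
  (n + d + c + m + G + L) * 50 + place ub L *
    (2 * k * (n * (n * 50 + 130) + 120) + n * (n * 50 + m * 50 + 320) + L * 40 + 300 + 1) + 504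

/-- After t rounds the stored clustering is the cheapest of the first t candidates. On exit all
digit strings have been tried, so the output is at least as good as any admissible advice. -/
theorem clusterP_spec (k c : ℕ) (hk : 0 < k) {s : RamStore} {n d m G q L : ℕ} (h0 : s.reg 0 = n)
    (h2 : s.reg 2 = d) (h8 : s.reg 8 = 0) (h11 : s.reg 11 = 0) (h3 : ∀ j, s.arr 3 j = 0)
    (h4 : ∀ j, s.arr 4 j = 0)
    (hm : m = 2 ^ (d + c)) (hG : G = 2 ^ m) (hq : q = 2 ^ G) (hL : L = 6 * k + 3 + G * q)
    (ha1 : ∀ i, s.arr 0 i ≤ 1) :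
    Spec (clusterP k c) s (clusterTime k n d c m G L (digitBound k n (G * q))) fun s' =>
      (∀ u < n, s'.arr 1 u < k) ∧ ∃ a : ℕ → ℕ → ℕ,
        (∀ u < n, ∀ v < n, a u v = if u = v then 1 else s.arr 0 (u * n + v)) ∧
        (∀ v < n, a n v = s.arr 0 (n * n + v)) ∧
        ∀ z : ℕ → ℕ, (∀ j, z j ≤ digitBound k n (G * q) j) →
          cost n a (s'.arr 1) ≤ cost n a (candidate k n m G q a z) := by
  have hq0 : 0 < q := by rw [hq]; positivity
  set ub := digitBound k n (G * q) with hub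
  have hubL : ∀ j ≥ L, ub j = 0 := by
    intro j hj
    rw [hub, digitBound, if_neg (by omega), if_neg (by omega)]
  have hubk : ∀ i, ub (6 * k + 3 + i) < k := by
    intro i
    rw [hub, digitBound]
    split_ifs <;> omega
  have hcand : ∀ (a : ℕ → ℕ → ℕ) t, ∀ u < n, candidate k n m G q a (digit ub t) u < k := by
    intro a t u hu
    exact sampleColor_lt (fun i => (digit_le ub t _).trans_lt (hubk i)) hu
  apply Spec.le
  · apply Spec.seq (setupP_spec k c h0 h2 h8 h11 h4 hm hG hq hL)
    rintro s1 ⟨he1, h18, h10, h14, hA, hA'⟩ hF1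
    apply Spec.last
    set A := mat s1
    have hA1 : ∀ u < n, ∀ v < n, A u v ≤ 1 := by
      intro u hu v hv
      rw [hA u hu v hv]
      split_ifs
      · exact le_rfl
      · exact ha1 _
    -- Register 8 is the stop flag, set exactly when the last string has been used; register 10 is
    -- the least cost so far. The clause for t = 0 records the initial value of register 10, when no
    -- clustering is stored yet.
    apply spec_loop (N := place ub L) (fun t s' => t ≤ place ub L ∧ Env k n m G q L s' ∧
      mat s' = A ∧ s'.arr 4 = ub ∧ (∀ j, s'.arr 3 j = digit ub t j) ∧
      (t < place ub L → s'.reg 8 = 0) ∧ (t = place ub L → s'.reg 8 = 1) ∧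
      (∀ t' < t, s'.reg 10 ≤ cost n A (candidate k n m G q A (digit ub t'))) ∧
      (0 < t → (∀ u < n, s'.arr 1 u < k) ∧ cost n A (s'.arr 1) = s'.reg 10) ∧
      (t = 0 → s'.reg 10 = n * n + 1))
    · refine ⟨Nat.zero_le _, he1, rfl, h14, fun j => ?_, fun _ => h18, fun h => ?_, by simp,
        by simp, fun _ => h10⟩
      · rw [hF1.arr 3 rfl, h3]
        simp [digit]
      · exact absurd h.symm (place_pos ub L).ne'
    · rintro t s' ⟨ht, he', hm', hu', h3', h8', h8'', hbest, hout, hinit⟩ hguard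
      have htL : t < place ub L := by
        rcases ht.lt_or_eq with h | h
        · exact h
        · rw [h8'' h, he'.r9] at hguard
          omega
      refine ⟨htL, fun _ => ?_⟩
      apply (roundP_spec (t := t) he' hq0 (by rw [hu']; exact h3') (by rw [hu']; exact hubL)).mono
        le_rfl
      rw [hu', hm']
      rintro s'' ⟨g0, g1, g2, g3, g4, g5, g6, g7⟩ -
      refine ⟨htL, g0, g1, g2, g3, fun h => (g4 h).trans (h8' htL), g5, ?_⟩
      by_cases hlt : cost n A (candidate k n m G q A (digit ub t)) < s'.reg 10
      · obtain ⟨g8, g9⟩ := g6 hlt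
        refine ⟨fun t' ht' => ?_, fun _ => ⟨fun u hu => ?_, ?_⟩, by simp⟩
        · rw [g8]
          rcases Nat.lt_succ_iff_lt_or_eq.1 ht' with h | rfl
          · exact hlt.le.trans (hbest t' h)
          · exact le_rfl
        · rw [g9 u hu]
          exact hcand A t u hu
        · rw [cost_congr g9, g8]
      · obtain ⟨g8, g9⟩ := g7 hlt
        -- A rejected candidate cannot be the first one, since n² + 1 exceeds every cost.
        have ht0 : 0 < t := by
          rcases Nat.eq_zero_or_pos t with h | h
          · rw [hinit h] at hlt
            exact absurd (Nat.lt_succ_of_le (cost_le hA1 _)) hlt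
          · exact h
        rw [g8, g9]
        refine ⟨fun t' ht' => ?_, fun _ => hout ht0, by simp⟩
        rcases Nat.lt_succ_iff_lt_or_eq.1 ht' with h | rfl
        · exact hbest t' h
        · exact not_lt.1 hlt
    · rintro t s' ⟨ht, he', hm', hu', h3', h8', h8'', hbest, hout, hinit⟩ hguard
      have htL : t = place ub L := by
        rcases ht.lt_or_eq with h | h
        · rw [h8' h, he'.r9] at hguard
          omega
        · exact h
      obtain ⟨o1, o2⟩ := hout (by rw [htL]; exact place_pos ub L)
      refine ⟨o1, A, hA, hA', fun z hz => ?_⟩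
      obtain ⟨t', ht', hd⟩ := exists_digit_eq ub z hz L
      have : digit ub t' = z := by
        funext j
        by_cases hj : j < L
        · exact hd j hj
        · have h1 := digit_le ub t' j
          have h2 := hz j
          rw [hubL j (by omega)] at h1 h2
          omega
      rw [o2, ← this]
      exact hbest t' (by omega)
  · simp only [clusterTime]
    omega

end RamProg

/-! ## Sampling along arithmetic progressions -/

namespace CorrClust

open Finset

/-- The values of a function on arithmetic progressions of prime modulus are pairwise
uncorrelated. -/
theorem sum_sq_progression {p : ℕ} [Fact p.Prime] {m : ℕ} (hm : m ≤ p) (f : ZMod p → ℝ)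
    (hf : ∑ x, f x = 0) :
    ∑ x : ZMod p, ∑ b : ZMod p, (∑ j ∈ range m, f (x + j * b)) ^ 2 = m * p * ∑ x, f x ^ 2 := by
  have hexp : ∀ x b : ZMod p, (∑ j ∈ range m, f (x + j * b)) ^ 2 =
      ∑ i ∈ range m, ∑ j ∈ range m, f (x + i * b) * f (x + j * b) := by
    intro x b
    rw [sq, sum_mul_sum]
  simp only [hexp]
  have hpair : ∀ i ∈ range m, ∀ j ∈ range m,
      ∑ x : ZMod p, ∑ b : ZMod p, f (x + i * b) * f (x + j * b) =
        if i = j then p * ∑ x, f x ^ 2 else 0 := by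
    intro i hi j hj
    have hshift : ∑ x : ZMod p, ∑ b : ZMod p, f (x + i * b) * f (x + j * b) =
        ∑ b : ZMod p, ∑ x : ZMod p, f x * f (x + (j - i) * b) := by
      rw [sum_comm]
      refine sum_congr rfl fun b _ => ?_
      refine Fintype.sum_equiv (Equiv.addRight (i * b : ZMod p)) _ _ fun x => ?_
      simp only [Equiv.coe_addRight]
      congr 2
      ring
    rw [hshift]
    split_ifs with hij
    · subst hij
      simp [sq, ZMod.card]
    -- Distinct i, j < m ≤ p differ by a unit, so x + (j - i)b runs over all residues as b does: the
    -- two sample points are independent and the mean-zero function averages out.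
    · have hne : ((j : ZMod p) - i) ≠ 0 := by
        intro h
        rw [sub_eq_zero, ZMod.natCast_eq_natCast_iff'] at h
        rw [mem_range] at hi hj
        rw [Nat.mod_eq_of_lt (by omega), Nat.mod_eq_of_lt (by omega)] at h
        exact hij h.symm
      rw [sum_comm]
      refine sum_eq_zero fun x _ => ?_
      rw [← mul_sum]
      have : ∑ b : ZMod p, f (x + (j - i) * b) = ∑ y, f y := by
        refine Fintype.sum_equiv ((Equiv.mulLeft₀ _ hne).trans (Equiv.addLeft x)) _ _ fun b => ?_
        simp
      rw [this, hf, mul_zero]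
  have hcomm : ∑ x : ZMod p, ∑ b : ZMod p, ∑ i ∈ range m, ∑ j ∈ range m,
      f (x + i * b) * f (x + j * b) = ∑ i ∈ range m, ∑ j ∈ range m, ∑ x : ZMod p, ∑ b : ZMod p,
      f (x + i * b) * f (x + j * b) := by
    simp only [sum_comm (s := (univ : Finset (ZMod p))) (t := range m)]
  rw [hcomm, sum_congr rfl fun i hi => sum_congr rfl fun j hj => hpair i hi j hj]
  simp only [sum_ite_eq, mem_range]
  rw [sum_congr rfl fun i hi => if_pos (mem_range.1 hi)]
  simp [mul_assoc]

/-- Some progression of length `m` estimates a whole family of means well on average. -/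
theorem exists_progression {p : ℕ} [Fact p.Prime] {m : ℕ} (hm : m ≤ p) {ι : Type*} (I : Finset ι)
    (φ : ι → ZMod p → ℝ) {V : ℝ} (hV : ∀ i ∈ I, ∑ x, φ i x ^ 2 ≤ V) (hVp : V ≤ p) :
    ∃ x b : ZMod p, ∑ i ∈ I, (∑ j ∈ range m, φ i (x + j * b) - m / p * ∑ y, φ i y) ^ 2 ≤
      #I * m := by
  have hp : (0 : ℝ) < p := by exact_mod_cast (Fact.out : p.Prime).pos
  have hsum : ∑ x : ZMod p, ∑ b : ZMod p,
      ∑ i ∈ I, (∑ j ∈ range m, φ i (x + j * b) - m / p * ∑ y, φ i y) ^ 2 ≤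
      ∑ x : ZMod p, ∑ b : ZMod p, ((#I * m : ℝ)) := by
    -- Subtracting the mean from each function makes `sum_sq_progression` applicable; the m means
    -- add up to the subtracted term.
    have h1 : ∑ x : ZMod p, ∑ b : ZMod p,
        ∑ i ∈ I, (∑ j ∈ range m, φ i (x + j * b) - m / p * ∑ y, φ i y) ^ 2 =
        ∑ i ∈ I, ∑ x : ZMod p, ∑ b : ZMod p,
          (∑ j ∈ range m, (φ i (x + j * b) - (∑ y, φ i y) / p)) ^ 2 := by
      simp only [sum_comm (s := (univ : Finset (ZMod p))) (t := I)]
      refine sum_congr rfl fun i _ => sum_congr rfl fun x _ => sum_congr rfl fun b _ => ?_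
      rw [sum_sub_distrib]
      simp
      ring
    rw [h1]
    have h2 : ∀ i ∈ I, ∑ x : ZMod p, ∑ b : ZMod p,
        (∑ j ∈ range m, (φ i (x + j * b) - (∑ y, φ i y) / p)) ^ 2 ≤ m * p * p := by
      intro i hi
      rw [sum_sq_progression hm (fun x => φ i x - (∑ y, φ i y) / p)
        (by rw [sum_sub_distrib]; simp [ZMod.card]; field_simp; simp)]
      gcongr
      refine le_trans ?_ ((hV i hi).trans hVp)
      -- The variance is at most the second moment.
      have : ∑ x, (φ i x - (∑ y, φ i y) / p) ^ 2 = ∑ x, φ i x ^ 2 - (∑ y, φ i y) ^ 2 / p := by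
        simp only [sub_sq, sum_add_distrib, sum_sub_distrib, ← sum_mul, ← mul_sum]
        simp [ZMod.card]
        field_simp
        ring
      rw [this]
      have : 0 ≤ (∑ y, φ i y) ^ 2 / p := by positivity
      linarith
    refine (sum_le_sum h2).trans (le_of_eq ?_)
    simp [ZMod.card]
    ring
  -- The bound holds on average over all (x, b), hence for some pair.
  obtain ⟨x, -, hx⟩ := exists_le_of_sum_le univ_nonempty hsum
  obtain ⟨b, -, hb⟩ := exists_le_of_sum_le univ_nonempty hx
  exact ⟨x, b, hb⟩

theorem walk_eq {p b x : ℕ} (hb : b < p) (hx : x < p) (j : ℕ) :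
    walk p b x j < p ∧ ((walk p b x j : ℕ) : ZMod p) = x + j * b := by
  induction j with
  | zero => simp [walk, hx]
  | succ j ih =>
    obtain ⟨h1, h2⟩ := ih
    rw [walk]
    split_ifs with h
    · refine ⟨h, ?_⟩
      push_cast
      rw [h2]
      ring
    · refine ⟨by omega, ?_⟩
      rw [Nat.cast_sub (by omega)]
      push_cast
      rw [h2, ZMod.natCast_self]
      ring

/-! ## Vertices of the same type are interchangeable -/

section Types

variable {N : ℕ} {m : ℕ}

/-- If the sample `b` estimates the codegrees of `a` well, then a function whose sums over the
types are small is almost annihilated by `a`. -/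
theorem sum_sq_mulVec_le (a : ℕ → ℕ → ℝ) (b : ℕ → ℕ → ℝ) {p : ℝ}
    (hp : 0 < p) (hm : 0 < m)
    (hR : ∑ u ∈ range N, ∑ w ∈ range N, (∑ j ∈ range m, b j u * b j w -
      m / p * ∑ x ∈ range N, a x u * a x w) ^ 2 ≤ N ^ 2 * m)
    (f : ℕ → ℝ) (hf : ∀ u, |f u| ≤ 1) {S : ℝ}
    (hS : ∀ j < m, |∑ u ∈ range N, f u * b j u| ≤ S) :
    ∑ x ∈ range N, (∑ u ∈ range N, a x u * f u) ^ 2 ≤ p * S ^ 2 + p * N ^ 2 / √m := by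
  set R : ℕ → ℕ → ℝ := fun u w => ∑ j ∈ range m, b j u * b j w -
      m / p * ∑ x ∈ range N, a x u * a x w with hRdef
  have hm' : (0 : ℝ) < m := by exact_mod_cast hm
  -- Both squares expand into quadratic forms in f, one with the true codegrees and one with the
  -- sampled codegrees; `R` is the difference of the two matrices.
  have hid : m / p * ∑ x ∈ range N, (∑ u ∈ range N, a x u * f u) ^ 2 =
      ∑ j ∈ range m, (∑ u ∈ range N, f u * b j u) ^ 2 -
      ∑ u ∈ range N, ∑ w ∈ range N, f u * f w * R u w := by
    have e1 : ∑ x ∈ range N, (∑ u ∈ range N, a x u * f u) ^ 2 =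
        ∑ u ∈ range N, ∑ w ∈ range N, f u * f w * ∑ x ∈ range N, a x u * a x w := by
      simp only [sq, sum_mul_sum]
      simp only [mul_sum]
      rw [sum_comm]
      refine sum_congr rfl fun u _ => ?_
      rw [sum_comm]
      exact sum_congr rfl fun w _ => sum_congr rfl fun x _ => by ring
    have e2 : ∑ j ∈ range m, (∑ u ∈ range N, f u * b j u) ^ 2 =
        ∑ u ∈ range N, ∑ w ∈ range N, f u * f w * ∑ j ∈ range m, b j u * b j w := by
      simp only [sq, sum_mul_sum]
      simp only [mul_sum]
      rw [sum_comm]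
      refine sum_congr rfl fun u _ => ?_
      rw [sum_comm]
      exact sum_congr rfl fun w _ => sum_congr rfl fun x _ => by ring
    rw [e1, e2, mul_sum, ← sum_sub_distrib]
    refine sum_congr rfl fun u _ => ?_
    rw [mul_sum, ← sum_sub_distrib]
    refine sum_congr rfl fun w _ => ?_
    simp only [hRdef]
    ring
  -- Cauchy–Schwarz over the N² pairs, where |f(u) f(w)| ≤ 1.
  have hCS : |∑ u ∈ range N, ∑ w ∈ range N, f u * f w * R u w| ≤ N ^ 2 * √m := by
    simp only [← sum_product']
    rw [← sum_product' (range N) (range N) (fun u w => (R u w) ^ 2)] at hR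
    refine abs_le_of_sq_le_sq ?_ (by positivity)
    refine (sum_mul_sq_le_sq_mul_sq _ _ _).trans ?_
    have h1 : ∑ i ∈ range N ×ˢ range N, (f i.1 * f i.2) ^ 2 ≤ N ^ 2 := by
      refine (sum_le_card_nsmul _ _ 1 fun i _ => ?_).trans (by simp [sq])
      have := abs_mul (f i.1) (f i.2)
      have : |f i.1 * f i.2| ≤ 1 := by
        rw [abs_mul]
        exact mul_le_one₀ (hf _) (abs_nonneg _) (hf _)
      rw [← sq_abs]
      exact pow_le_one₀ (abs_nonneg _) this
    calc _ ≤ (N ^ 2 : ℝ) * (N ^ 2 * m) := mul_le_mul h1 hR (sum_nonneg fun _ _ => sq_nonneg _)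
            (by positivity)
      _ = (N ^ 2 * √m) ^ 2 := by rw [mul_pow, Real.sq_sqrt hm'.le]; ring
  have h3 : ∑ j ∈ range m, (∑ u ∈ range N, f u * b j u) ^ 2 ≤ m * S ^ 2 := by
    refine (sum_le_card_nsmul _ _ (S ^ 2) fun j hj => ?_).trans (by simp)
    rw [← sq_abs]
    exact pow_le_pow_left₀ (abs_nonneg _) (hS j (mem_range.1 hj)) 2
  have h4 : m / p * ∑ x ∈ range N, (∑ u ∈ range N, a x u * f u) ^ 2 ≤ m * S ^ 2 + N ^ 2 * √m := by
    rw [hid]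
    have := neg_le_of_abs_le hCS
    linarith
  have h5 : ∑ x ∈ range N, (∑ u ∈ range N, a x u * f u) ^ 2 =
      p / m * (m / p * ∑ x ∈ range N, (∑ u ∈ range N, a x u * f u) ^ 2) := by
    field_simp
  rw [h5]
  calc _ ≤ p / m * (m * S ^ 2 + N ^ 2 * √m) := by gcongr
    _ = p * S ^ 2 + p * N ^ 2 / √m := by
      have : √(m : ℝ) * √m = m := Real.mul_self_sqrt hm'.le
      have h0 : √(m : ℝ) ≠ 0 := (Real.sqrt_pos.2 hm').ne'
      field_simp
      linear_combination (N : ℝ) ^ 2 * this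

end Types

end CorrClust

/-! ### Comparing the costs of similar clusterings -/

namespace CorrClust

open Finset

/-- The cost of a clustering of `0, …, N - 1`, as a real number. -/
theorem cost_sub_cost {N k : ℕ} {a : ℕ → ℕ → ℕ} (ha : ∀ u < N, ∀ v < N, a u v ≤ 1)
    (hsymm : ∀ u < N, ∀ v < N, a u v = a v u) {c c' : ℕ → ℕ} (hc : ∀ u < N, c u < k)
    (hc' : ∀ u < N, c' u < k) :
    (cost N a c : ℝ) - cost N a c' = ∑ i ∈ range k, ∑ v ∈ range N,
      ((if c v = i then 1 else 0) + (if c' v = i then 1 else 0)) * ∑ u ∈ range N,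
      ((if c u = i then 1 else 0) - (if c' u = i then (1 : ℝ) else 0)) * (1 - 2 * a v u) := by
  -- With x_i the indicator of the color i, the truth value of c(v) = c(u) is ∑ x_i(v) x_i(u). The
  -- cost thus becomes a constant plus the quadratic forms of 1 - 2a at the x_i.
  have h1 : ∀ {c : ℕ → ℕ}, (∀ u < N, c u < k) → (cost N a c : ℝ) = ∑ u ∈ range N, ∑ v ∈ range N,
      (a v u + (∑ i ∈ range k, (if c v = i then 1 else 0) * (if c u = i then (1 : ℝ) else 0)) *
        (1 - 2 * a v u)) := by
    intro c hc
    rw [cost]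
    push_cast
    rw [sum_comm]
    refine sum_congr rfl fun u hu => sum_congr rfl fun v hv => ?_
    rw [mem_range] at hu hv
    have : ∑ i ∈ range k, (if c v = i then 1 else 0) * (if c u = i then (1 : ℝ) else 0) =
        if c v = c u then 1 else 0 := by
      rw [sum_eq_single (c v) (fun i _ hi => by simp [hi.symm])
        fun h => absurd (mem_range.2 (hc v hv)) h]
      simp [eq_comm]
    rw [this]
    split_ifs
    · rw [Nat.cast_sub (ha v hv u hu)]
      push_cast
      ring
    · ring
  have h2 : ∀ (i : ℕ) (x y : ℕ → ℝ), ∑ v ∈ range N, ∑ u ∈ range N, x v * y u * (1 - 2 * a v u) =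
      ∑ v ∈ range N, ∑ u ∈ range N, y v * x u * (1 - 2 * (a v u : ℝ)) := by
    intro i x y
    rw [sum_comm]
    refine sum_congr rfl fun u hu => sum_congr rfl fun v hv => ?_
    rw [hsymm v (mem_range.1 hv) u (mem_range.1 hu)]
    ring
  have h3 : ∀ {c : ℕ → ℕ}, (∀ u < N, c u < k) → (cost N a c : ℝ) =
      ∑ u ∈ range N, ∑ v ∈ range N, (a v u : ℝ) + ∑ i ∈ range k, ∑ v ∈ range N, ∑ u ∈ range N,
        (if c v = i then 1 else 0) * (if c u = i then (1 : ℝ) else 0) * (1 - 2 * a v u) := by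
    intro c hc
    rw [h1 hc]
    simp only [sum_add_distrib]
    congr 1
    rw [sum_comm (s := range k)]
    rw [sum_comm]
    refine sum_congr rfl fun v _ => ?_
    rw [sum_comm (s := range k)]
    exact sum_congr rfl fun u _ => by rw [sum_mul]
  rw [h3 hc, h3 hc', add_sub_add_left_eq_sub, ← sum_sub_distrib]
  refine sum_congr rfl fun i _ => ?_
  -- For a symmetric matrix B, xᵀBx - yᵀBy = (x + y)ᵀB(x - y), because the mixed terms cancel.
  have h4 := h2 i (fun v => if c v = i then 1 else 0) (fun v => if c' v = i then 1 else 0)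
  simp only [mul_sum]
  refine sub_eq_zero.1 (Eq.trans ?_ (sub_eq_zero.2 h4))
  simp only [← sum_sub_distrib]
  refine sum_congr rfl fun v _ => sum_congr rfl fun u _ => ?_
  ring

/-- Clusterings with almost the same number of vertices of each color in each type have almost the
same cost. -/
theorem cost_le_of_types {N k m h : ℕ} {a : ℕ → ℕ → ℕ} (ha : ∀ u < N, ∀ v < N, a u v ≤ 1)
    (hsymm : ∀ u < N, ∀ v < N, a u v = a v u) {c c' : ℕ → ℕ} (hc : ∀ u < N, c u < k)
    (hc' : ∀ u < N, c' u < k) (b : ℕ → ℕ → ℝ) {p : ℝ} (hp : 0 < p) (hpN : p ≤ 2 * N)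
    (hh : 0 < h) (hm : h ^ 4 ≤ m)
    (hR : ∑ u ∈ range N, ∑ w ∈ range N, (∑ j ∈ range m, b j u * b j w -
      m / p * ∑ x ∈ range N, (a x u : ℝ) * a x w) ^ 2 ≤ N ^ 2 * m)
    (hS : ∀ i < k, ∀ j < m, |∑ u ∈ range N,
      ((if c u = i then 1 else 0) - (if c' u = i then (1 : ℝ) else 0)) * b j u| ≤ N / h)
    (hS' : ∀ i < k, |∑ u ∈ range N,
      ((if c u = i then 1 else 0) - (if c' u = i then (1 : ℝ) else 0))| ≤ N / h) :
    (cost N a c : ℝ) ≤ cost N a c' + 10 * k * N ^ 2 / h := by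
  have hh' : (0 : ℝ) < h := by exact_mod_cast hh
  have hm0 : 0 < m := lt_of_lt_of_le (by positivity) hm
  -- The condition h⁴ ≤ m makes the sampling error N²p/√m as small as the contribution of S = N/h.
  have hsq : (h : ℝ) ^ 2 ≤ √m := by
    apply Real.le_sqrt_of_sq_le
    rw [← pow_mul]
    exact_mod_cast hm
  suffices hmain : ∀ i ∈ range k, ∑ v ∈ range N,
      ((if c v = i then 1 else 0) + (if c' v = i then 1 else 0)) * ∑ u ∈ range N,
      ((if c u = i then 1 else 0) - (if c' u = i then (1 : ℝ) else 0)) * (1 - 2 * a v u) ≤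
      10 * N ^ 2 / h by
    have := sum_le_card_nsmul _ _ _ hmain
    rw [← cost_sub_cost ha hsymm hc hc', card_range, nsmul_eq_mul] at this
    have e : (k : ℝ) * (10 * N ^ 2 / h) = 10 * k * N ^ 2 / h := by ring
    linarith
  intro i hi
  rw [mem_range] at hi
  set f : ℕ → ℝ := fun u => (if c u = i then 1 else 0) - (if c' u = i then (1 : ℝ) else 0) with hf
  have hf1 : ∀ u, |f u| ≤ 1 := by
    intro u
    simp only [hf]
    split_ifs <;> simp
  have hb := sum_sq_mulVec_le (fun u v => (a u v : ℝ)) b hp hm0 hR f hf1 (hS i hi)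
  have hb' : ∑ x ∈ range N, (∑ u ∈ range N, (a x u : ℝ) * f u) ^ 2 ≤ 4 * N ^ 3 / h ^ 2 := by
    refine hb.trans ?_
    have e1 : p * (N / h : ℝ) ^ 2 ≤ 2 * N * (N / h) ^ 2 := by gcongr
    have e2 : p * (N : ℝ) ^ 2 / √m ≤ 2 * N * N ^ 2 / h ^ 2 := by gcongr
    calc _ ≤ 2 * N * (N / h : ℝ) ^ 2 + 2 * N * N ^ 2 / h ^ 2 := add_le_add e1 e2
      _ = 4 * N ^ 3 / h ^ 2 := by field_simp; ring
  -- Cauchy–Schwarz passes from the ℓ² bound to an ℓ¹ bound.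
  have hl1 : ∑ x ∈ range N, |∑ u ∈ range N, (a x u : ℝ) * f u| ≤ 2 * N ^ 2 / h := by
    refine le_of_sq_le_sq ?_ (by positivity)
    have h1 := sum_mul_sq_le_sq_mul_sq (range N) (fun _ => (1 : ℝ))
      (fun x => |∑ u ∈ range N, (a x u : ℝ) * f u|)
    simp only [one_mul, one_pow, sum_const, card_range, nsmul_eq_mul, mul_one, sq_abs] at h1
    refine h1.trans ((mul_le_mul_of_nonneg_left hb' (by positivity)).trans (le_of_eq ?_))
    field_simp
    ring
  -- The sum of two indicators is at most 2. The all-ones part then contributes 2N²/h and the part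
  -- with `a` contributes 4 · 2N²/h.
  calc _ ≤ ∑ v ∈ range N, 2 * |∑ u ∈ range N, f u * (1 - 2 * (a v u : ℝ))| := by
        refine sum_le_sum fun v _ => ?_
        refine (le_abs_self _).trans ?_
        rw [abs_mul]
        gcongr
        split_ifs <;> norm_num
    _ ≤ ∑ v ∈ range N, (2 * (N / h : ℝ) + 4 * |∑ u ∈ range N, (a v u : ℝ) * f u|) := by
        refine sum_le_sum fun v _ => ?_
        have e : ∑ u ∈ range N, f u * (1 - 2 * (a v u : ℝ)) =
            ∑ u ∈ range N, f u - 2 * ∑ u ∈ range N, (a v u : ℝ) * f u := by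
          rw [mul_sum, ← sum_sub_distrib]
          exact sum_congr rfl fun u _ => by ring
        have h1 : |∑ u ∈ range N, f u| ≤ N / h := hS' i hi
        have h2 := abs_sub (∑ u ∈ range N, f u) (2 * ∑ u ∈ range N, (a v u : ℝ) * f u)
        rw [abs_mul, abs_two] at h2
        rw [e]
        linarith
    _ = 2 * N ^ 2 / h + 4 * ∑ v ∈ range N, |∑ u ∈ range N, (a v u : ℝ) * f u| := by
        simp only [sum_add_distrib, ← mul_sum, sum_const, card_range, nsmul_eq_mul]
        ring
    _ ≤ 2 * N ^ 2 / h + 4 * (2 * N ^ 2 / h) := by gcongr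
    _ = 10 * N ^ 2 / h := by ring

/-- Cells of size at most `g` can be colored such that the colors have almost prescribed sizes. -/
theorem exists_coloring_cells {β : Type*} [DecidableEq β] (J : Finset ℕ) (hJ : J.Nonempty)
    (g : ℤ) (cells : Finset β) (s : β → ℤ) (hs0 : ∀ b, 0 ≤ s b) (hsg : ∀ b, s b ≤ g)
    (R : ℕ → ℤ) (hR : ∀ i ∈ J, -g ≤ R i) (hsum : ∑ i ∈ J, R i = ∑ b ∈ cells, s b) :
    ∃ w : β → ℕ, (∀ b, w b ∈ J) ∧
      ∀ i ∈ J, -g ≤ R i - ∑ b ∈ cells, if w b = i then s b else 0 := by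
  induction cells using Finset.induction_on generalizing R with
  | empty =>
    obtain ⟨i, hi⟩ := hJ
    exact ⟨fun _ => i, fun _ => hi, by simpa using hR⟩
  | insert b cells hb ih =>
    rw [sum_insert hb] at hsum
    -- `R` is the remaining demand. It sums to the total size of the remaining cells, so some color
    -- still has nonnegative demand; giving it a cell of size at most g leaves its demand at least
    -- -g.
    obtain ⟨i, hi, hRi⟩ : ∃ i ∈ J, 0 ≤ R i := by
      by_contra! hneg
      have h1 := sum_lt_sum_of_nonempty hJ hneg
      have h2 := sum_nonneg (s := cells) fun b _ => hs0 b
      have h3 := hs0 b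
      simp at h1
      omega
    obtain ⟨w, hw, hw'⟩ := ih (fun j => R j - if i = j then s b else 0) (by
      intro j hj
      have := hsg b
      have := hR j hj
      split_ifs with h
      · subst h; omega
      · omega) (by
      rw [sum_sub_distrib, sum_ite_eq, if_pos hi]
      omega)
    refine ⟨Function.update w b i, fun x => ?_, fun j hj => ?_⟩
    · rcases eq_or_ne x b with rfl | h
      · simpa using hi
      · simpa [h] using hw x
    · rw [sum_insert hb, Function.update_self]
      have : ∑ x ∈ cells, (if Function.update w b i x = j then s x else 0) =
          ∑ x ∈ cells, if w x = j then s x else 0 := by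
        refine sum_congr rfl fun x hx => ?_
        rw [Function.update_of_ne]
        rintro rfl
        exact hb hx
      rw [this]
      have := hw' j hj
      omega

end CorrClust

/-! ### Types, words and the additive approximation -/

namespace CorrClust

open Finset

/-- The bit that the sample vertex number `j` contributes to the type of `u`. -/
def typBit (N : ℕ) (a : ℕ → ℕ → ℕ) (p b x j u : ℕ) : ℕ :=
  if walk p b x j < N then a (walk p b x j) u else 0

/-- Pulling the matrix back along the list of uncolored vertices lets the sampling argument work on
0, …, N - 1. -/
theorem typ_comp (N : ℕ) (ls : ℕ → ℕ) (a : ℕ → ℕ → ℕ) (p b x u m : ℕ) :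
    typ N ls a p b x (ls u) m = typ N id (fun i j => a (ls i) (ls j)) p b x u m := by
  induction m with
  | zero => rfl
  | succ m ih => simp [typ, ih]

section Typ

variable {N : ℕ} {a : ℕ → ℕ → ℕ} (ha : ∀ u < N, ∀ v < N, a u v ≤ 1) {p b x : ℕ}
include ha

theorem typBit_le {j u : ℕ} (hu : u < N) : typBit N a p b x j u ≤ 1 := by
  rw [typBit]
  split_ifs with h
  · exact ha _ h _ hu
  · exact Nat.zero_le _

theorem typ_lt {u : ℕ} (hu : u < N) (m : ℕ) : typ N id a p b x u m < 2 ^ m := by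
  induction m with
  | zero => simp [typ]
  | succ m ih =>
    have := typBit_le ha (p := p) (b := b) (x := x) (j := m) hu
    have e : typ N id a p b x u (m + 1) = 2 * typ N id a p b x u m + typBit N a p b x m u := rfl
    rw [e, pow_succ]
    omega

/-- Binary expansions are unique because each bit is at most 1. So the sampled adjacencies are
constant on types. -/
theorem typBit_eq_of_typ_eq {u v : ℕ} (hu : u < N) (hv : v < N) {m : ℕ}
    (h : typ N id a p b x u m = typ N id a p b x v m) :
    ∀ j < m, typBit N a p b x j u = typBit N a p b x j v := by
  induction m with
  | zero => simp
  | succ m ih =>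
    have h1 := typBit_le ha (p := p) (b := b) (x := x) (j := m) hu
    have h2 := typBit_le ha (p := p) (b := b) (x := x) (j := m) hv
    have e1 : typ N id a p b x u (m + 1) = 2 * typ N id a p b x u m + typBit N a p b x m u := rfl
    have e2 : typ N id a p b x v (m + 1) = 2 * typ N id a p b x v m + typBit N a p b x m v := rfl
    intro j hj
    rcases Nat.lt_succ_iff_lt_or_eq.1 hj with hj | rfl
    · exact ih (by omega) j hj
    · omega

end Typ

/-- Functions whose sums over the fibers of `τ` are small. -/
theorem abs_sum_mul_le_of_fibers {N G : ℕ} (τ : ℕ → ℕ) (hτ : ∀ u < N, τ u < G) (f b : ℕ → ℝ)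
    (hb : ∀ u < N, ∀ v < N, τ u = τ v → b u = b v) (hb1 : ∀ u < N, |b u| ≤ 1) {s : ℝ}
    (hs : ∀ t < G, |∑ u ∈ range N with τ u = t, f u| ≤ s) :
    |∑ u ∈ range N, f u * b u| ≤ G * s := by
  rw [← sum_fiberwise_of_maps_to (t := range G) (g := τ)
    fun u hu => mem_range.2 (hτ u (mem_range.1 hu))]
  refine (abs_sum_le_sum_abs _ _).trans ?_
  refine (sum_le_card_nsmul _ _ s fun t ht => ?_).trans (by simp)
  have hst := hs t (mem_range.1 ht)
  rcases (filter (fun u => τ u = t) (range N)).eq_empty_or_nonempty with h | ⟨v, hv⟩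
  · rw [h] at hst ⊢
    simpa using hst
  · simp only [mem_filter, mem_range] at hv
    have : ∑ u ∈ range N with τ u = t, f u * b u = (∑ u ∈ range N with τ u = t, f u) * b v := by
      rw [sum_mul]
      refine sum_congr rfl fun u hu => ?_
      simp only [mem_filter, mem_range] at hu
      rw [hb u hu.1 v hv.1 (hu.2.trans hv.2.symm)]
    rw [this, abs_mul]
    calc _ ≤ |∑ u ∈ range N with τ u = t, f u| * 1 := by gcongr; exact hb1 v hv.1
      _ ≤ s := by rwa [mul_one]

/-- The word for one type: for any coloring `c'` there is a coloring of the blocks such that each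
color is used almost equally often on the set `U`. -/
theorem exists_block_colors (J : Finset ℕ) (hJ : J.Nonempty) {N g : ℕ} (hg : 0 < g)
    (U : Finset ℕ) (hU : U ⊆ range N) (c' : ℕ → ℕ) (hc' : ∀ u ∈ U, c' u ∈ J) :
    ∃ w : ℕ → ℕ, (∀ b, w b ∈ J) ∧ ∀ i, |∑ u ∈ U,
      ((if w (u / g) = i then 1 else 0) - (if c' u = i then (1 : ℝ) else 0))| ≤ #J * g := by
  -- The cells are the intersections of `U` with the intervals of length g.
  have hsize : ∀ b, #{u ∈ U | u / g = b} ≤ g := by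
    intro b
    have : {u ∈ U | u / g = b} ⊆ Ico (b * g) (b * g + g) := by
      intro u hu
      simp only [mem_filter] at hu
      have h1 := Nat.div_add_mod u g
      have h2 := Nat.mod_lt u hg
      rw [hu.2, Nat.mul_comm] at h1
      rw [mem_Ico]
      omega
    simpa using card_le_card this
  obtain ⟨w, hw, hw'⟩ := exists_coloring_cells J hJ g (range N) (fun b => #{u ∈ U | u / g = b})
    (fun b => by positivity) (fun b => by exact_mod_cast hsize b)
    (fun i => #{u ∈ U | c' u = i}) (fun i _ => by omega) (by
      have h1 : #U = ∑ i ∈ J, #{u ∈ U | c' u = i} := card_eq_sum_card_fiberwise hc'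
      have h2 : #U = ∑ b ∈ range N, #{u ∈ U | u / g = b} :=
        card_eq_sum_card_fiberwise fun u hu =>
          mem_coe.2 (mem_range.2 ((Nat.div_le_self _ _).trans_lt (mem_range.1 (hU hu))))
      rw [← Nat.cast_sum, ← Nat.cast_sum, ← h1, ← h2])
  have hcells : ∀ i, ∑ b ∈ range N, (if w b = i then (#{u ∈ U | u / g = b} : ℤ) else 0) =
      #{u ∈ U | w (u / g) = i} := by
    intro i
    rw [card_eq_sum_card_fiberwise (t := range N) (f := fun u => u / g) fun u hu =>
      mem_coe.2 (mem_range.2 ((Nat.div_le_self _ _).trans_lt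
        (mem_range.1 (hU (mem_filter.1 hu).1))))]
    push_cast
    refine sum_congr rfl fun b _ => ?_
    rw [filter_filter]
    split_ifs with h
    · congr 2
      ext u
      simp only [mem_filter]
      constructor
      · rintro ⟨h1, h2⟩
        exact ⟨h1, by rw [h2]; exact h, h2⟩
      · exact fun h => ⟨h.1, h.2.2⟩
    · symm
      rw [Nat.cast_eq_zero, card_eq_zero, filter_eq_empty_iff]
      rintro u - ⟨h1, h2⟩
      exact h (h2 ▸ h1)
  refine ⟨w, hw, fun i => ?_⟩
  -- `D i` is the demand for the color i that remains after all cells are used.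
  set D : ℕ → ℤ := fun i => #{u ∈ U | c' u = i} -
      ∑ b ∈ range N, (if w b = i then (#{u ∈ U | u / g = b} : ℤ) else 0) with hD
  have hdiff : ∑ u ∈ U, ((if w (u / g) = i then 1 else 0) -
      (if c' u = i then (1 : ℝ) else 0)) = -((D i : ℤ) : ℝ) := by
    simp only [hD]
    rw [hcells, sum_sub_distrib, sum_boole, sum_boole]
    push_cast
    ring
  have hJpos : 1 ≤ #J := hJ.card_pos
  rw [hdiff, abs_neg]
  suffices h : |D i| ≤ #J * g by exact_mod_cast h
  by_cases hi : i ∈ J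
  -- The remaining demands sum to zero and each is at least -g, so each is at most (#J - 1)g.
  · have hsum : ∑ i ∈ J, D i = 0 := by
      simp only [hD]
      rw [sum_sub_distrib]
      simp only [hcells]
      rw [← Nat.cast_sum, ← Nat.cast_sum, ← card_eq_sum_card_fiberwise hc',
        ← card_eq_sum_card_fiberwise fun u _ => hw _]
      simp
    rw [abs_le]
    have hgJ : (g : ℤ) ≤ #J * g := by nlinarith
    refine ⟨by linarith [hw' i hi], ?_⟩
    rw [← add_sum_erase _ _ hi] at hsum
    have h1 := card_nsmul_le_sum (J.erase i) D (-(g : ℤ)) fun j hj => hw' j (mem_of_mem_erase hj)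
    rw [card_erase_of_mem hi, nsmul_eq_mul, Nat.cast_sub hJpos] at h1
    push_cast at h1
    nlinarith
  · have h0 : D i = 0 := by
      simp only [hD]
      rw [hcells, sub_eq_zero]
      congr 1
      rw [filter_false_of_mem fun u hu (h : c' u = i) => hi (h ▸ hc' u hu),
        filter_false_of_mem fun u _ (h : w (u / g) = i) => hi (h ▸ hw _)]
    rw [h0, abs_zero]
    positivity

/-- The additive approximation: some sample and some word describe a clustering that is almost as
good as `c'`. -/
theorem exists_sample {N k m h q : ℕ} {a : ℕ → ℕ → ℕ} (ha : ∀ u < N, ∀ v < N, a u v ≤ 1)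
    (hsymm : ∀ u < N, ∀ v < N, a u v = a v u) (J : Finset ℕ) (hJ : J.Nonempty)
    (hJk : J ⊆ range k) {c' : ℕ → ℕ} (hc' : ∀ u < N, c' u ∈ J) (hh : 0 < h) (hm : h ^ 4 ≤ m)
    (hmq : m ≤ q) (hq : 2 * 2 ^ m * k * h ≤ q) :
    ∃ p b x : ℕ, p ≤ 2 * N ∧ b ≤ 2 * N ∧ x ≤ 2 * N ∧ ∃ w : ℕ → ℕ, (∀ i, w i ∈ J) ∧
      (cost N a (fun i => w (2 ^ m * (i / (N / q + 1)) + typ N id a p b x i m)) : ℝ) ≤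
        cost N a c' + 10 * k * N ^ 2 / h := by
  classical
  have hm0 : 0 < m := lt_of_lt_of_le (by positivity) hm
  have hq0 : 0 < q := hm0.trans_le hmq
  obtain ⟨i₀, hi₀⟩ := hJ
  set G := 2 ^ m with hG
  have hG0 : 0 < G := by positivity
  -- With fewer than q vertices the blocks are single vertices. Every vertex then has its own letter
  -- in the word, which can spell `c'` exactly; no sample is needed.
  by_cases hNq : N < q
  · set pos : ℕ → ℕ := fun i => G * (i / (N / q + 1)) + typ N id a 0 0 0 i m with hpos
    have hinj : ∀ i < N, ∀ j < N, pos i = pos j → i = j := by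
      intro i hi j hj hij
      simp only [hpos, Nat.div_eq_of_lt hNq, Nat.zero_add, Nat.div_one] at hij
      rw [Nat.mul_comm G i, Nat.mul_comm G j] at hij
      exact (RamProg.rowIndex_inj (typ_lt ha hi m) (typ_lt ha hj m) hij).1
    refine ⟨0, 0, 0, Nat.zero_le _, Nat.zero_le _, Nat.zero_le _,
      fun y => if hy : ∃ i < N, pos i = y then c' hy.choose else i₀, fun y => ?_, ?_⟩
    · dsimp only
      split_ifs with hy
      · exact hc' _ hy.choose_spec.1
      · exact hi₀
    · rw [cost_congr (c' := c')]
      · have : (0 : ℝ) ≤ 10 * k * N ^ 2 / h := by positivity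
        linarith
      · intro u hu
        have hy : ∃ i < N, pos i = pos u := ⟨u, hu, rfl⟩
        change (if hy : ∃ i < N, pos i = pos u then c' hy.choose else i₀) = c' u
        rw [dif_pos hy, hinj _ hy.choose_spec.1 _ hu hy.choose_spec.2]
  have hN0 : N ≠ 0 := by omega
  -- Bertrand's postulate: p > N ≥ q ≥ m makes the sample points distinct residues for b ≠ 0, while
  -- p ≤ 2N keeps the vertices dense among the residues.
  obtain ⟨p, hp, hNp, hpN⟩ := Nat.exists_prime_lt_and_le_two_mul N hN0
  have : Fact p.Prime := ⟨hp⟩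
  have hp0 : (0 : ℝ) < p := by exact_mod_cast hp.pos
  -- Residues from N on carry no vertex and contribute zero, so the sums of these functions are the
  -- codegrees.
  set φ : ℕ × ℕ → ZMod p → ℝ := fun i y =>
    if y.val < N then (a y.val i.1 : ℝ) * a y.val i.2 else 0 with hφ
  have hsumφ : ∀ (F : ℕ → ℝ), ∑ y : ZMod p, (if y.val < N then F y.val else 0) =
      ∑ y ∈ range N, F y := by
    intro F
    rw [← sum_filter]
    refine sum_bij (fun y _ => y.val) (fun y hy => ?_) (fun y _ y' _ h => ?_) (fun y hy => ?_)
      fun _ _ => rfl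
    · simpa using hy
    · exact ZMod.val_injective p h
    · rw [mem_range] at hy
      have : (y : ZMod p).val = y := ZMod.val_cast_of_lt (hy.trans hNp)
      exact ⟨y, by simp [this, hy], this⟩
  obtain ⟨x, b, hxb⟩ := exists_progression (p := p) (m := m) (by omega)
    (range N ×ˢ range N) φ (V := N) (by
      rintro ⟨u, v⟩ huv
      simp only [mem_product, mem_range] at huv
      have e : ∀ y, φ (u, v) y ^ 2 =
          if y.val < N then ((a y.val u : ℝ) * a y.val v) ^ 2 else 0 := by
        intro y
        simp only [hφ]
        split_ifs <;> simp
      simp only [e]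
      rw [hsumφ fun y => ((a y u : ℝ) * a y v) ^ 2]
      refine (sum_le_card_nsmul _ _ 1 fun y hy => ?_).trans (by simp)
      rw [mem_range] at hy
      have h1 : (a y u : ℝ) ≤ 1 := by exact_mod_cast ha y hy u huv.1
      have h2 : (a y v : ℝ) ≤ 1 := by exact_mod_cast ha y hy v huv.2
      exact pow_le_one₀ (by positivity) (mul_le_one₀ h1 (by positivity) h2))
    (by exact_mod_cast hNp.le)
  set τ : ℕ → ℕ := fun u => typ N id a p b.val x.val u m with hτ
  set g := N / q + 1 with hg
  have hbit : ∀ j u, ((typBit N a p b.val x.val j u : ℕ) : ℝ) =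
      if (x + j * b).val < N then (a (x + j * b).val u : ℝ) else 0 := by
    intro j u
    obtain ⟨h1, h2⟩ := walk_eq (ZMod.val_lt b) (ZMod.val_lt x) j
    have h3 : walk p b.val x.val j = (x + j * b).val := by
      rw [← ZMod.val_cast_of_lt h1, h2]
      simp
    rw [typBit, h3]
    split_ifs <;> simp
  have hR : ∑ u ∈ range N, ∑ w ∈ range N, (∑ j ∈ range m,
      (typBit N a p b.val x.val j u : ℝ) * typBit N a p b.val x.val j w -
      m / p * ∑ y ∈ range N, (a y u : ℝ) * a y w) ^ 2 ≤ N ^ 2 * m := by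
    rw [← sum_product' (range N) (range N) (fun u w => (∑ j ∈ range m,
      (typBit N a p b.val x.val j u : ℝ) * typBit N a p b.val x.val j w -
      m / p * ∑ y ∈ range N, (a y u : ℝ) * a y w) ^ 2)]
    refine le_trans (le_of_eq ?_) (hxb.trans (le_of_eq ?_))
    · refine sum_congr rfl fun i _ => ?_
      simp only [hφ]
      rw [hsumφ fun y => (a y i.1 : ℝ) * a y i.2]
      congr 2
      refine sum_congr rfl fun j _ => ?_
      rw [hbit, hbit]
      split_ifs <;> simp
    · simp [sq]
  choose W hW hW' using fun t => exists_block_colors J ⟨i₀, hi₀⟩ (N := N) (g := g)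
    (Nat.succ_pos _) {u ∈ range N | τ u = t} (filter_subset _ _) c'
    fun u hu => hc' u (mem_range.1 (mem_filter.1 hu).1)
  have hJcard : #J ≤ k := by simpa using card_le_card hJk
  -- Each of the G types errs by at most #J · g, and N ≥ q gives qg ≤ 2N; the lower bound on q does
  -- the rest.
  have hGs : (G : ℝ) * (#J * g) ≤ N / h := by
    have hh' : (0 : ℝ) < h := by exact_mod_cast hh
    rw [le_div_iff₀ hh']
    have h1 : q * g ≤ 2 * N := by
      have := Nat.mul_div_le N q
      rw [hg, Nat.mul_succ]
      omega
    have h2 : q * (G * (#J * g) * h) ≤ q * N := by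
      calc q * (G * (#J * g) * h) ≤ q * (G * (k * g) * h) := by gcongr
        _ = (q * g) * (G * k * h) := by ring
        _ ≤ 2 * N * (G * k * h) := by gcongr
        _ = (2 * G * k * h) * N := by ring
        _ ≤ q * N := by gcongr
    exact_mod_cast Nat.le_of_mul_le_mul_left h2 hq0
  -- A position in the word encodes the type as its remainder modulo G and the block as its
  -- quotient.
  have hcol : ∀ u < N, (fun y => W (y % G) (y / G)) (G * (u / g) + τ u) = W (τ u) (u / g) := by
    intro u hu
    have := typ_lt ha (p := p) (b := b.val) (x := x.val) hu m
    simp only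
    rw [Nat.mul_add_mod, Nat.mod_eq_of_lt this, Nat.mul_add_div hG0, Nat.div_eq_of_lt this,
      Nat.add_zero]
  have hfib : ∀ i, ∀ t < G, |∑ u ∈ range N with τ u = t,
      ((if W (τ u) (u / g) = i then 1 else 0) - (if c' u = i then (1 : ℝ) else 0))| ≤
        #J * g := by
    intro i t _
    refine le_trans (le_of_eq ?_) (hW' t i)
    congr 1
    exact sum_congr rfl fun u hu => by rw [(mem_filter.1 hu).2]
  refine ⟨p, b.val, x.val, hpN, ((ZMod.val_lt b).le.trans hpN), ((ZMod.val_lt x).le.trans hpN),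
    fun y => W (y % G) (y / G), fun y => hW _ _, ?_⟩
  rw [cost_congr hcol]
  refine cost_le_of_types ha hsymm (fun u _ => mem_range.1 (hJk (hW _ _)))
    (fun u hu => mem_range.1 (hJk (hc' u hu))) (fun j u => (typBit N a p b.val x.val j u : ℝ)) hp0
    (by exact_mod_cast hpN) hh hm hR (fun i _ j hj => ?_) fun i _ => ?_
  · refine (abs_sum_mul_le_of_fibers τ (fun u hu => typ_lt ha hu m) _ _ (fun u hu v hv huv => ?_)
      (fun u hu => ?_) (hfib i)).trans hGs
    · rw [typBit_eq_of_typ_eq ha hu hv huv j hj]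
    · rw [Nat.abs_cast]
      exact_mod_cast typBit_le ha hu
  · have := (abs_sum_mul_le_of_fibers τ (fun u hu => typ_lt ha hu m) _ (fun _ => 1)
      (fun _ _ _ _ _ => rfl) (fun _ _ => by simp) (hfib i)).trans hGs
    simpa using this

end CorrClust

/-! ## Instances with few disagreements -/

namespace CorrClust

open Finset

/-- The cost of the clustering `c` of `W`. -/
def costOn (W : Finset ℕ) (a : ℕ → ℕ → ℕ) (c : ℕ → ℕ) : ℕ :=
  ∑ u ∈ W, ∑ v ∈ W, if c u = c v then 1 - a u v else a u v

/-- The number of disagreements at the row `r`, if it is put into the cluster `j` of `D`. -/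
def disOn (W : Finset ℕ) (a : ℕ → ℕ → ℕ) (D : ℕ → ℕ) (r j : ℕ) : ℕ :=
  ∑ v ∈ W, if j = D v then 1 - a r v else a r v

/-- The distance of two rows. -/
def estOn (W : Finset ℕ) (a : ℕ → ℕ → ℕ) (u v : ℕ) : ℕ :=
  ∑ x ∈ W, if a u x ≠ a v x then 1 else 0

theorem costOn_eq_sum_disOn (W : Finset ℕ) (a : ℕ → ℕ → ℕ) (D : ℕ → ℕ) :
    costOn W a D = ∑ u ∈ W, disOn W a D u (D u) := rfl

section Regroup

variable {W : Finset ℕ} {a : ℕ → ℕ → ℕ} {D : ℕ → ℕ}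

/-- `disOn` is the Hamming distance between a row and the indicator of a cluster, and `estOn` that
between two rows; this and `estOn_le_add` are triangle inequalities. -/
theorem disOn_le_add {r r' : ℕ} (hr : ∀ v ∈ W, a r v ≤ 1) (hr' : ∀ v ∈ W, a r' v ≤ 1) (j : ℕ) :
    disOn W a D r j ≤ estOn W a r r' + disOn W a D r' j := by
  rw [disOn, estOn, disOn, ← sum_add_distrib]
  refine sum_le_sum fun v hv => ?_
  have := hr v hv
  have := hr' v hv
  split_ifs <;> omega

theorem estOn_le_add {r r' : ℕ} (hr : ∀ v ∈ W, a r v ≤ 1) (hr' : ∀ v ∈ W, a r' v ≤ 1) (j : ℕ) :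
    estOn W a r r' ≤ disOn W a D r j + disOn W a D r' j := by
  rw [disOn, estOn, disOn, ← sum_add_distrib]
  refine sum_le_sum fun v hv => ?_
  have := hr v hv
  have := hr' v hv
  split_ifs <;> omega

/-- The indicators of two distinct clusters differ on all of the cluster i, so a row is wrong there
for one of them. A vertex that fits two clusters almost equally well is therefore expensive. -/
theorem card_le_disOn_add {r : ℕ} (hr : ∀ v ∈ W, a r v ≤ 1) {i j : ℕ} (hij : i ≠ j) :
    #{v ∈ W | D v = i} ≤ disOn W a D r i + disOn W a D r j := by
  rw [card_filter, disOn, disOn, ← sum_add_distrib]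
  refine sum_le_sum fun v hv => ?_
  have := hr v hv
  split_ifs <;> omega

/-- Moving the vertices in `M` to other clusters. -/
theorem costOn_move_le {D' : ℕ → ℕ} {M : Finset ℕ} (ha : ∀ u ∈ W, ∀ v ∈ W, a u v ≤ 1)
    (hsymm : ∀ u ∈ W, ∀ v ∈ W, a u v = a v u) (hM : M ⊆ W) (hD : ∀ u ∈ W, u ∉ M → D' u = D u) :
    (costOn W a D' : ℝ) ≤ costOn W a D +
      2 * ∑ u ∈ M, ((disOn W a D u (D' u) : ℝ) - disOn W a D u (D u)) + 2 * #M ^ 2 := by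
  classical
  set d : ℕ → ℕ → ℕ → ℤ := fun u j v => ((if j = D v then 1 - a u v else a u v : ℕ) : ℤ) with hd
  -- A pair with one moved vertex is charged to that vertex exactly; a pair inside `M` may be
  -- misjudged, but by at most 2.
  have hpt : ∀ u ∈ W, ∀ v ∈ W, ((if D' u = D' v then 1 - a u v else a u v : ℕ) : ℤ) ≤
      d u (D u) v + (if u ∈ M then d u (D' u) v - d u (D u) v else 0) +
        (if v ∈ M then d v (D' v) u - d v (D v) u else 0) +
        2 * ((if u ∈ M then 1 else 0) * (if v ∈ M then 1 else 0)) := by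
    intro u hu v hv
    have h1 := ha u hu v hv
    have h2 := hsymm u hu v hv
    have h3 := hD u hu
    have h4 := hD v hv
    simp only [hd, ← h2]
    by_cases hum : u ∈ M <;> by_cases hvm : v ∈ M <;> simp only [hum, hvm, if_true, if_false]
    · split_ifs <;> omega
    · rw [h4 hvm]
      simp
    · rw [h3 hum]
      simp only [eq_comm (a := D' v), eq_comm (a := D v)]
      split_ifs <;> omega
    · rw [h3 hum, h4 hvm]
      simp
  have hsum := sum_le_sum fun u hu => sum_le_sum fun v hv => hpt u hu v hv
  have hdis : ∀ u j, ∑ v ∈ W, d u j v = disOn W a D u j := by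
    intro u j
    rw [disOn, Nat.cast_sum]
  have hMW : {u ∈ W | u ∈ M} = M := by
    rw [filter_mem_eq_inter, inter_eq_right.2 hM]
  have e1 : ∑ u ∈ W, ∑ v ∈ W, (if u ∈ M then d u (D' u) v - d u (D u) v else 0) =
      ∑ u ∈ M, ((disOn W a D u (D' u) : ℤ) - disOn W a D u (D u)) := by
    rw [← hMW, sum_filter, hMW]
    refine sum_congr rfl fun u _ => ?_
    split_ifs
    · rw [sum_sub_distrib, hdis, hdis]
    · simp
  have e2 : ∑ u ∈ W, ∑ v ∈ W, (if v ∈ M then d v (D' v) u - d v (D v) u else 0) =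
      ∑ u ∈ M, ((disOn W a D u (D' u) : ℤ) - disOn W a D u (D u)) := by
    rw [sum_comm, ← e1]
  have e3 : ∑ u ∈ W, ∑ v ∈ W, 2 * ((if u ∈ M then 1 else 0) * (if v ∈ M then (1 : ℤ) else 0)) =
      2 * #M ^ 2 := by
    simp only [← mul_sum, ← sum_mul, sum_boole, hMW]
    ring
  simp only [sum_add_distrib, e1, e2, e3, hdis] at hsum
  have hfin : (costOn W a D' : ℤ) ≤ costOn W a D +
      2 * ∑ u ∈ M, ((disOn W a D u (D' u) : ℤ) - disOn W a D u (D u)) + 2 * #M ^ 2 := by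
    rw [costOn_eq_sum_disOn W a D, costOn]
    simp only [Nat.cast_sum] at hsum ⊢
    linarith
  have := (Int.cast_le (R := ℝ)).2 hfin
  push_cast at this
  exact this

/-- If every vertex chooses the cluster whose representative has the most similar row, then a
clustering with few disagreements hardly gets worse. -/
theorem exists_regroup (ha : ∀ u ∈ W, ∀ v ∈ W, a u v ≤ 1)
    (hsymm : ∀ u ∈ W, ∀ v ∈ W, a u v = a v u) {J Lg : Finset ℕ} (hD : ∀ u ∈ W, D u ∈ J)
    (hLg : Lg ⊆ J) {rep ch : ℕ → ℕ} {z : ℕ} (hrep1 : ∀ j ∈ J, ∀ v ∈ W, a (rep j) v ≤ 1)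
    {Θ ξ γ e : ℝ} (hΘ : 0 < Θ) (hξ : 0 ≤ ξ) (he : e ≤ 1) (hnum : 4 * (8 * γ / Θ + 4 * ξ) ≤ e * Θ)
    (hγ : 0 ≤ γ)
    (hrep : ∀ j ∈ J, (disOn W a D (rep j) j : ℝ) ≤ ξ * #W)
    (hsmall : ∀ j ∈ J, j ∉ Lg → rep j = z)
    (hbig : ∀ j ∈ Lg, Θ * #W ≤ #{v ∈ W | D v = j})
    (hcost : (costOn W a D : ℝ) ≤ γ * #W ^ 2)
    (hch : ∀ u ∈ W, (ch u ∈ Lg ∧ ∀ j ∈ J, estOn W a u (rep (ch u)) ≤ estOn W a u (rep j)) ∨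
      (ch u ∉ Lg ∧ (∃ j ∈ J, j ∉ Lg) ∧ ∀ j ∈ J, estOn W a u z ≤ estOn W a u (rep j))) :
    ∃ D' : ℕ → ℕ, (∀ u ∈ W, ch u ∈ Lg → D' u = ch u) ∧
      (∀ u ∈ W, ch u ∉ Lg → D' u ∈ J ∧ D' u ∉ Lg) ∧
      (costOn W a D' : ℝ) ≤ (1 + e) * costOn W a D := by
  classical
  rcases W.eq_empty_or_nonempty with rfl | hW
  · exact ⟨D, by simp, by simp, by simp [costOn]⟩
  have hN : (0 : ℝ) < #W := by exact_mod_cast hW.card_pos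
  -- A vertex that leaves a large cluster for the small ones may go to any of them, since they share
  -- the representative `z`.
  obtain ⟨j₀, hj₀⟩ : ∃ j₀, (∃ j ∈ J, j ∉ Lg) → j₀ ∈ J ∧ j₀ ∉ Lg := by
    by_cases h : ∃ j ∈ J, j ∉ Lg
    · obtain ⟨j, h1, h2⟩ := h
      exact ⟨j, fun _ => ⟨h1, h2⟩⟩
    · exact ⟨0, fun h' => absurd h' h⟩
  set D' : ℕ → ℕ := fun u => if ch u ∈ Lg then ch u else if D u ∈ Lg then j₀ else D u with hD'
  have hD'1 : ∀ u ∈ W, ch u ∈ Lg → D' u = ch u := fun u _ h => by simp [hD', h]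
  have hD'2 : ∀ u ∈ W, ch u ∉ Lg → D' u ∈ J ∧ D' u ∉ Lg := by
    intro u hu h
    rcases hch u hu with h' | ⟨-, h', -⟩
    · exact absurd h'.1 h
    · simp only [hD', h, if_false]
      split_ifs with h3
      · exact hj₀ h'
      · exact ⟨hD u hu, h3⟩
  refine ⟨D', hD'1, hD'2, ?_⟩
  set M := {u ∈ W | D' u ≠ D u} with hM
  have hξΘ : 16 * ξ ≤ Θ := by
    have h1 : 0 ≤ 8 * γ / Θ := by positivity
    nlinarith
  -- Comparing with the two representatives shows that a moved vertex loses at most 2ξ|W|. Its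
  -- disagreements for the old and the new cluster together are at least Θ|W|, so it already had at
  -- least Θ|W|/4 of them.
  have key : ∀ u ∈ M, (disOn W a D u (D' u) : ℝ) ≤ disOn W a D u (D u) + 2 * ξ * #W ∧
      Θ / 4 * #W ≤ disOn W a D u (D u) := by
    intro u huM
    obtain ⟨hu, hne⟩ := mem_filter.1 huM
    have hDu := hD u hu
    have hu1 := ha u hu
    have hD'J : D' u ∈ J := by
      by_cases h : ch u ∈ Lg
      · rw [hD'1 u hu h]
        exact hLg h
      · exact (hD'2 u hu h).1
    have hest : estOn W a u (rep (D' u)) ≤ estOn W a u (rep (D u)) := by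
      rcases hch u hu with ⟨h1, h2⟩ | ⟨h1, -, h2⟩
      · rw [hD'1 u hu h1]
        exact h2 _ hDu
      · rw [hsmall _ hD'J (hD'2 u hu h1).2]
        exact h2 _ hDu
    have h1 := disOn_le_add (D := D) hu1 (hrep1 _ hD'J) (D' u)
    have h2 := estOn_le_add (D := D) hu1 (hrep1 _ hDu) (D u)
    have h3 : disOn W a D u (D' u) ≤ disOn W a D u (D u) + disOn W a D (rep (D u)) (D u) +
        disOn W a D (rep (D' u)) (D' u) := by omega
    have h4 : (disOn W a D u (D' u) : ℝ) ≤ disOn W a D u (D u) + disOn W a D (rep (D u)) (D u) +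
        disOn W a D (rep (D' u)) (D' u) := by exact_mod_cast h3
    have h5 : (disOn W a D u (D' u) : ℝ) ≤ disOn W a D u (D u) + 2 * ξ * #W := by
      linarith [hrep _ hDu, hrep _ hD'J]
    refine ⟨h5, ?_⟩
    -- Either the old or the new cluster is large, because `D'` never exchanges two small ones.
    have h6 : Θ * #W ≤ disOn W a D u (D u) + disOn W a D u (D' u) := by
      by_cases hL : D u ∈ Lg
      · refine (hbig _ hL).trans ?_
        exact_mod_cast card_le_disOn_add (D := D) hu1 hne.symm
      · have hL' : D' u ∈ Lg := by
          by_contra hL'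
          have : ch u ∉ Lg := fun h => hL' (hD'1 u hu h ▸ h)
          apply hne
          simp only [hD', this, hL, if_false]
        refine (hbig _ hL').trans ?_
        rw [add_comm]
        exact_mod_cast card_le_disOn_add (D := D) hu1 hne
    nlinarith
  have hmove := costOn_move_le (D' := D') ha hsymm (filter_subset _ _ : M ⊆ W) fun u hu h => by
    by_contra hne
    exact h (mem_filter.2 ⟨hu, hne⟩)
  have hsum1 : ∑ u ∈ M, ((disOn W a D u (D' u) : ℝ) - disOn W a D u (D u)) ≤
      #M * (2 * ξ * #W) := by
    rw [← nsmul_eq_mul]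
    exact sum_le_card_nsmul _ _ _ fun u hu => by linarith [(key u hu).1]
  have hsum2 : #M * (Θ / 4 * #W) ≤ (costOn W a D : ℝ) := by
    rw [costOn_eq_sum_disOn, ← nsmul_eq_mul]
    push_cast
    refine (card_nsmul_le_sum _ _ _ fun u hu => (key u hu).2).trans ?_
    exact sum_le_sum_of_subset_of_nonneg (filter_subset _ _) fun _ _ _ => by positivity
  set K : ℝ := ((costOn W a D : ℕ) : ℝ) with hK
  set μ : ℝ := ((#M : ℕ) : ℝ) with hμ
  set N : ℝ := ((#W : ℕ) : ℝ) with hNdef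
  have hμ0 : 0 ≤ μ := by positivity
  -- Few vertices move; this turns the quadratic error 2μ² into a multiple of μN, which can be
  -- charged to the disagreements of the moved vertices.
  have hμN : μ ≤ 4 * γ / Θ * N := by
    rw [div_mul_eq_mul_div, le_div_iff₀ hΘ]
    have : μ * Θ * N ≤ 4 * γ * N * N := by nlinarith
    exact le_of_mul_le_mul_right this hN
  have h7 : 2 * μ * (2 * ξ * N) + 2 * μ ^ 2 ≤ μ * N * (8 * γ / Θ + 4 * ξ) := by
    have : 2 * μ ^ 2 ≤ 2 * (μ * (4 * γ / Θ * N)) := by nlinarith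
    have e2 : 2 * (μ * (4 * γ / Θ * N)) = μ * N * (8 * γ / Θ) := by ring
    nlinarith
  have h8 : μ * N * (8 * γ / Θ + 4 * ξ) ≤ μ * N * (e * Θ / 4) := by
    apply mul_le_mul_of_nonneg_left _ (by positivity)
    linarith
  have he0 : 0 ≤ e := by
    have h1 : 0 ≤ 8 * γ / Θ := by positivity
    have : 0 ≤ e * Θ := by linarith
    exact nonneg_of_mul_nonneg_left this hΘ
  have h9 : μ * N * (e * Θ / 4) ≤ e * K := by nlinarith
  nlinarith

end Regroup

end CorrClust

/-! ## The operations that lead to a good clustering -/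

namespace CorrClust

open Finset

/-- There is a gap in the sizes of at most `k` sets. -/
theorem exists_gap {k : ℕ} (J : Finset ℕ) (hJ : #J ≤ k) (s : ℕ → ℝ) {κ N : ℝ} (hκ : 0 < κ)
    (hκ1 : κ ≤ 1) (hN : 0 ≤ N) :
    ∃ t ≤ k, ∀ j ∈ J, κ ^ (t + 1) * N ≤ s j ∨ s j ≤ κ ^ (t + 2) * N := by
  by_contra! h
  choose! f hf hf' using h
  -- The k + 1 open intervals between consecutive scales are disjoint, so one of at most k sizes
  -- would have to lie in two of them.
  obtain ⟨t, ht, t', ht', hne, heq⟩ := exists_ne_map_eq_of_card_lt_of_maps_to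
    (s := range (k + 1)) (t := J) (f := f) (by simpa using Nat.lt_succ_of_le hJ)
    fun t ht => hf t (Nat.lt_succ_iff.1 (mem_range.1 ht))
  rw [mem_range, Nat.lt_succ_iff] at ht ht'
  have key : ∀ t ≤ k, ∀ t' ≤ k, t < t' → f t = f t' → False := by
    intro t ht t' ht' hlt heq
    have h1 := (hf' t ht).2
    have h2 := (hf' t' ht').1
    rw [heq] at h1
    have h3 : κ ^ (t' + 1) * N ≤ κ ^ (t + 2) * N :=
      mul_le_mul_of_nonneg_right (pow_le_pow_of_le_one hκ.le hκ1 (by omega)) hN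
    linarith
  rcases lt_or_gt_of_ne hne with h | h
  · exact key t ht t' ht' h heq
  · exact key t' ht' t ht h heq.symm

/-- A large cluster contains a vertex with few disagreements. -/
theorem exists_pivot {W : Finset ℕ} {a : ℕ → ℕ → ℕ} {D : ℕ → ℕ} {j : ℕ} {Θ γ : ℝ} (hΘ : 0 < Θ)
    (hW : W.Nonempty) (hbig : Θ * #W ≤ #{v ∈ W | D v = j})
    (hcost : (costOn W a D : ℝ) ≤ γ * #W ^ 2) :
    ∃ v ∈ W, (disOn W a D v j : ℝ) ≤ γ / Θ * #W := by
  have hN : (0 : ℝ) < #W := by exact_mod_cast hW.card_pos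
  have hs : (0 : ℝ) < #{v ∈ W | D v = j} := lt_of_lt_of_le (by positivity) hbig
  have hne : {v ∈ W | D v = j}.Nonempty := by
    rw [← card_pos]
    exact_mod_cast hs
  have hγ : 0 ≤ γ := by
    have : 0 ≤ γ * (#W : ℝ) ^ 2 := le_trans (by positivity) hcost
    exact nonneg_of_mul_nonneg_left this (by positivity)
  -- The disagreements at the vertices of the cluster sum to at most the cost; a vertex with at most
  -- average disagreements is chosen.
  obtain ⟨v, hv, hle⟩ := exists_le_of_sum_le (f := fun v => (disOn W a D v j : ℝ))
    (g := fun _ => γ / Θ * (#W : ℝ)) hne (by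
    have h1 : ∑ v ∈ W with D v = j, (disOn W a D v j : ℝ) ≤ costOn W a D := by
      rw [costOn_eq_sum_disOn]
      push_cast
      rw [sum_congr rfl fun v hv => by rw [← (mem_filter.1 hv).2]]
      exact sum_le_sum_of_subset_of_nonneg (filter_subset _ _) fun _ _ _ => by positivity
    refine (h1.trans hcost).trans ?_
    rw [sum_const, nsmul_eq_mul]
    calc γ * (#W : ℝ) ^ 2 = Θ * #W * (γ / Θ * #W) := by field_simp
      _ ≤ _ := by gcongr)
  exact ⟨v, (mem_filter.1 hv).1, hle⟩

/-- Replacing a clustering on a part `W'` that shares no cluster with the rest. -/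
theorem costOn_le_of_part {W W' : Finset ℕ} (hW' : W' ⊆ W) {a : ℕ → ℕ → ℕ} {F D : ℕ → ℕ}
    {J' : Finset ℕ} (hF : ∀ u ∈ W', F u ∈ J') (hD : ∀ u ∈ W', D u ∈ J')
    (hFD : ∀ u ∈ W, u ∉ W' → F u = D u ∧ D u ∉ J') {r : ℝ} (hr : 1 ≤ r)
    (h : (costOn W' a F : ℝ) ≤ r * costOn W' a D) : (costOn W a F : ℝ) ≤ r * costOn W a D := by
  classical
  -- The pairs not inside W' cost the same in both clusterings: across the boundary the colors
  -- always differ, and outside W' the clusterings agree.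
  set R : ℕ := ∑ u ∈ W, ∑ v ∈ W, if u ∈ W' ∧ v ∈ W' then 0 else
    if D u = D v then 1 - a u v else a u v with hR
  have hsub : ∀ t : ℕ → ℕ → ℕ, ∑ u ∈ W', ∑ v ∈ W', t u v =
      ∑ u ∈ W, ∑ v ∈ W, if u ∈ W' ∧ v ∈ W' then t u v else 0 := by
    intro t
    rw [← sum_subset hW' fun u _ hu => sum_eq_zero fun v _ => by simp [hu]]
    refine sum_congr rfl fun u hu => ?_
    rw [← sum_subset hW' fun v _ hv => by simp [hv]]
    exact sum_congr rfl fun v hv => by simp [hu, hv]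
  have h1 : costOn W a F = costOn W' a F + R := by
    rw [costOn, costOn, hsub, hR, ← sum_add_distrib]
    refine sum_congr rfl fun u hu => ?_
    rw [← sum_add_distrib]
    refine sum_congr rfl fun v hv => ?_
    by_cases h1 : u ∈ W' <;> by_cases h2 : v ∈ W' <;> simp only [h1, h2, and_self, and_true,
      and_false, if_true, if_false, Nat.add_zero, Nat.zero_add]
    · obtain ⟨e, e'⟩ := hFD v hv h2
      rw [if_neg fun e2 : F u = F v => e' (by rw [← e, ← e2]; exact hF u h1),
        if_neg fun e2 : D u = D v => e' (by rw [← e2]; exact hD u h1)]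
    · obtain ⟨e, e'⟩ := hFD u hu h1
      rw [if_neg fun e2 : F u = F v => e' (by rw [← e, e2]; exact hF v h2),
        if_neg fun e2 : D u = D v => e' (by rw [e2]; exact hD v h2)]
    · rw [(hFD u hu h1).1, (hFD v hv h2).1]
  have h2 : costOn W a D = costOn W' a D + R := by
    rw [costOn, costOn, hsub, hR, ← sum_add_distrib]
    refine sum_congr rfl fun u hu => ?_
    rw [← sum_add_distrib]
    refine sum_congr rfl fun v hv => ?_
    split_ifs <;> simp
  rw [h1, h2]
  push_cast
  have : (0 : ℝ) ≤ R := by positivity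
  nlinarith

/-! ### Sequences of peeling operations -/

/-- Perform a list of peeling operations. -/
def runOps (k n : ℕ) (a : ℕ → ℕ → ℕ) (ops : List (ℕ × ℕ × ℕ)) (st : PeelState) : PeelState :=
  ops.foldl (fun st o => peelOp k n a o.1 o.2.1 o.2.2 st) st

theorem runOps_append (k n : ℕ) (a : ℕ → ℕ → ℕ) (ops ops' : List (ℕ × ℕ × ℕ)) (st : PeelState) :
    runOps k n a (ops ++ ops') st = runOps k n a ops' (runOps k n a ops st) :=
  List.foldl_append

/-- The uncolored vertices. -/
def uncolored (k n : ℕ) (st : PeelState) : Finset ℕ := {u ∈ range n | k ≤ st.col u}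

theorem rowDist_eq_estOn {n : ℕ} {a : ℕ → ℕ → ℕ} {al : ℕ → ℕ} {W : Finset ℕ} (hW : W ⊆ range n)
    (hal : ∀ x < n, 0 < al x ↔ x ∈ W) (u v : ℕ) : rowDist n a al u v = estOn W a u v := by
  rw [rowDist, estOn, ← sum_subset hW fun x hx hx' => by
    simp [(hal x (mem_range.1 hx)).not.2 hx']]
  exact sum_congr rfl fun x hx => by simp [(hal x (mem_range.1 (hW hx))).2 hx]

theorem estOn_le {n : ℕ} {a : ℕ → ℕ → ℕ} {W : Finset ℕ} (hW : W ⊆ range n) (u v : ℕ) :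
    estOn W a u v ≤ n := by
  refine (sum_le_card_nsmul _ _ 1 fun x _ => by split_ifs <;> omega).trans ?_
  simpa using card_le_card hW

/-- The initial value n + 1 exceeds every row distance, so the first pivot colors the whole level.
Later pivots take over only on strict improvement, so the final color belongs to a nearest pivot. -/
theorem foldl_pivot_spec {n : ℕ} {a : ℕ → ℕ → ℕ} {W : Finset ℕ} (hW : W ⊆ range n)
    {st : PeelState} (hal : ∀ x < n, 0 < st.alive x ↔ x ∈ W) (hbest : ∀ u, st.best u = n + 1)
    (L : List (ℕ × ℕ)) :
    (L.foldl (fun st o => pivot n a o.1 o.2 st) st).alive = st.alive ∧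
    (∀ u < n, u ∉ W → (L.foldl (fun st o => pivot n a o.1 o.2 st) st).col u = st.col u) ∧
    ∀ u ∈ W, (L = [] → (L.foldl (fun st o => pivot n a o.1 o.2 st) st).best u = n + 1) ∧
      (∀ o ∈ L, (L.foldl (fun st o => pivot n a o.1 o.2 st) st).best u ≤ estOn W a u o.1) ∧
      (L ≠ [] → ∃ o ∈ L, (L.foldl (fun st o => pivot n a o.1 o.2 st) st).col u = o.2 ∧
        (L.foldl (fun st o => pivot n a o.1 o.2 st) st).best u = estOn W a u o.1) := by
  induction L using List.reverseRecOn with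
  | nil => simp [hbest]
  | append_singleton L o ih =>
    rw [List.foldl_append]
    simp only [List.foldl_cons, List.foldl_nil]
    generalize L.foldl (fun st o => pivot n a o.1 o.2 st) st = st' at ih
    obtain ⟨h1, h2, h3⟩ := ih
    refine ⟨h1, fun u hu huW => ?_, fun u hu => ?_⟩
    · have := (hal u hu).not.2 huW
      simp only [pivot, h1, this, false_and, if_false]
      exact h2 u hu huW
    · obtain ⟨h4, h5, h6⟩ := h3 u hu
      have hpos := (hal u (mem_range.1 (hW hu))).2 hu
      have hd : ∀ v, rowDist n a st.alive u v = estOn W a u v := fun v =>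
        rowDist_eq_estOn hW hal u v
      have hle := estOn_le (a := a) hW u o.1
      simp only [pivot, h1, hd, hpos, true_and]
      refine ⟨by simp, ?_, fun _ => ?_⟩
      · intro o' ho'
        rcases List.mem_append.1 ho' with h | h
        · have := h5 o' h
          split_ifs <;> omega
        · rw [List.mem_singleton.1 h]
          split_ifs <;> omega
      · by_cases hlt : estOn W a u o.1 < st'.best u
        · exact ⟨o, by simp, by simp [hlt], by simp [hlt]⟩
        · obtain ⟨o', ho', h7, h8⟩ := h6 fun hnil => by
            have := h4 hnil
            omega
          exact ⟨o', by simp [ho'], by simp [hlt, h7], by rw [if_neg hlt, h8]⟩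

/-- One level of the peeling phase. -/
def levelOps : List (ℕ × ℕ) → List (ℕ × ℕ × ℕ)
  | [] => []
  | o :: L => (1, o.1, o.2) :: L.map fun o => (0, o.1, o.2)

/-- The flag 1 on the first operation freezes the set of uncolored vertices for the whole level;
distances are measured on this set even while its vertices receive colors. -/
theorem levelOps_spec {k n : ℕ} {a : ℕ → ℕ → ℕ} {st : PeelState} {L : List (ℕ × ℕ)} (hL : L ≠ []) :
    (∀ u < n, u ∉ uncolored k n st → (runOps k n a (levelOps L) st).col u = st.col u) ∧
    ∀ u ∈ uncolored k n st, ∃ o ∈ L, (runOps k n a (levelOps L) st).col u = o.2 ∧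
      ∀ o' ∈ L, estOn (uncolored k n st) a u o.1 ≤ estOn (uncolored k n st) a u o'.1 := by
  have hrun : runOps k n a (levelOps L) st =
      L.foldl (fun st o => pivot n a o.1 o.2 st) (newLevel k n st) := by
    cases L with
    | nil => exact absurd rfl hL
    | cons o L =>
      simp only [runOps, levelOps, List.foldl_cons, List.foldl_map]
      rfl
  obtain ⟨-, h1, h2⟩ := foldl_pivot_spec (n := n) (a := a) (st := newLevel k n st)
    (filter_subset _ _ : uncolored k n st ⊆ range n) (fun x hx => by
      simp only [newLevel, mem_filter, mem_range, hx, true_and]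
      split_ifs <;> omega) (fun _ => rfl) L
  rw [hrun]
  refine ⟨h1, fun u hu => ?_⟩
  obtain ⟨-, h4, h5⟩ := h2 u hu
  obtain ⟨o, ho, h6, h7⟩ := h5 hL
  exact ⟨o, ho, h6, fun o' ho' => h7 ▸ h4 o' ho'⟩

theorem peel_eq_runOps (k n : ℕ) (a : ℕ → ℕ → ℕ) (z : ℕ → ℕ) (t : ℕ) :
    peel k n a z t = runOps k n a ((List.range t).map fun i => (z (3 * i), z (3 * i + 1),
      z (3 * i + 2))) ⟨fun _ => k, fun _ => 0, fun _ => 0⟩ := by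
  induction t with
  | zero => rfl
  | succ t ih =>
    rw [List.range_succ, List.map_append, runOps_append, ← ih]
    rfl

/-- No vertex is alive in the initial state, so a pivot without a new level is idle. This pads
shorter sequences to exactly 2k operations. -/
theorem runOps_replicate (k n : ℕ) (a : ℕ → ℕ → ℕ) (t : ℕ) :
    runOps k n a (List.replicate t (0, 0, k)) ⟨fun _ => k, fun _ => 0, fun _ => 0⟩ =
      ⟨fun _ => k, fun _ => 0, fun _ => 0⟩ := by
  induction t with
  | zero => rfl
  | succ t ih =>
    rw [List.replicate_succ, ← List.singleton_append, runOps_append]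
    exact ih

end CorrClust

/-! ### Approximating an arbitrary clustering by peeling and sampling -/

namespace CorrClust

open Finset

theorem sampleColor_of_lt {k n m G q : ℕ} {a : ℕ → ℕ → ℕ} {p b x : ℕ} {w col : ℕ → ℕ} {u : ℕ}
    (hu : col u < k) : sampleColor k n m G q a p b x w col u = col u := by
  rw [sampleColor, fill_of_forall_ne]
  rintro i hi rfl
  have := nth_spec (P := fun u => u < n ∧ k ≤ col u) (fun u h => h.1) hi
  omega

/-- A clustering of the uncolored vertices that is found by sampling. -/
theorem exists_sampleColor {k n m h q : ℕ} {a : ℕ → ℕ → ℕ} (ha : ∀ u < n, ∀ v < n, a u v ≤ 1)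
    (hsymm : ∀ u < n, ∀ v < n, a u v = a v u) (hh : 0 < h) (hm : h ^ 4 ≤ m) (hmq : m ≤ q)
    (hq : 2 * 2 ^ m * k * h ≤ q) (st : PeelState) {J : Finset ℕ} (hJ : J.Nonempty)
    (hJk : J ⊆ range k) {D : ℕ → ℕ} (hD : ∀ u ∈ uncolored k n st, D u ∈ J) :
    ∃ p b x : ℕ, p ≤ 2 * n ∧ b ≤ 2 * n ∧ x ≤ 2 * n ∧ ∃ w : ℕ → ℕ, (∀ i, w i < k) ∧
      (∀ u ∈ uncolored k n st, sampleColor k n m (2 ^ m) q a p b x w st.col u ∈ J) ∧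
      (costOn (uncolored k n st) a (sampleColor k n m (2 ^ m) q a p b x w st.col) : ℝ) ≤
        costOn (uncolored k n st) a D + 10 * k * #(uncolored k n st) ^ 2 / h := by
  set P : ℕ → Prop := fun u => u < n ∧ k ≤ st.col u with hPdef
  have hP : ∀ u, P u → u < n := fun u h => h.1
  set W := uncolored k n st with hW
  have hmem : ∀ u, u ∈ W ↔ P u := fun u => by simp [hW, uncolored, hPdef]
  set N := Nat.count P n with hN
  set ls := Nat.nth P with hls
  have hinj := nth_inj hP
  have hlsW : ∀ i < N, ls i ∈ W := fun i hi => (hmem _).2 (nth_spec hP hi)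
  have hlsn : ∀ i < N, ls i < n := fun i hi => hP _ (nth_spec hP hi)
  -- The increasing enumeration of the uncolored vertices transports the problem to 0, …, N - 1.
  have himg : W = (range N).image ls := by
    ext u
    rw [hmem, mem_image]
    constructor
    · intro hu
      obtain ⟨i, hi, he⟩ := exists_nth_eq hP hu
      exact ⟨i, mem_range.2 hi, he⟩
    · rintro ⟨i, hi, rfl⟩
      exact nth_spec hP (mem_range.1 hi)
  have hinj' : Set.InjOn ls (range N) := fun i hi j hj h =>
    hinj i (by simpa using hi) j (by simpa using hj) h
  have hcard : #W = N := by rw [himg, card_image_of_injOn hinj', card_range]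
  have hcost : ∀ c : ℕ → ℕ, costOn W a c =
      cost N (fun i j => a (ls i) (ls j)) fun i => c (ls i) := by
    intro c
    rw [costOn, cost, himg, sum_image hinj']
    exact sum_congr rfl fun i _ => sum_image hinj'
  have hNn : N ≤ n := by
    rw [← hcard]
    simpa [hW, uncolored] using card_filter_le (range n) fun u => k ≤ st.col u
  obtain ⟨p, b, x, hp, hb, hx, w, hw, hle⟩ := exists_sample (N := N)
    (a := fun i j => a (ls i) (ls j)) (c' := fun i => D (ls i))
    (fun i hi j hj => ha _ (hlsn i hi) _ (hlsn j hj))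
    (fun i hi j hj => hsymm _ (hlsn i hi) _ (hlsn j hj)) J hJ hJk
    (fun i hi => hD _ (hlsW i hi)) hh hm hmq hq
  have hF : ∀ i < N, sampleColor k n m (2 ^ m) q a p b x w st.col (ls i) =
      w (2 ^ m * (i / (N / q + 1)) + typ N id (fun i j => a (ls i) (ls j)) p b x i m) := by
    intro i hi
    rw [← typ_comp]
    exact fill_apply hinj hi
  refine ⟨p, b, x, by omega, by omega, by omega, w, fun i => mem_range.1 (hJk (hw i)),
    fun u hu => ?_, ?_⟩
  · obtain ⟨i, hi, rfl⟩ := exists_nth_eq hP ((hmem u).1 hu)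
    rw [← hls, hF i hi]
    exact hw _
  · rw [hcost, hcost, hcard]
    rwa [cost_congr hF]

/-- A clustering `D` of the uncolored vertices is approximated by peeling and sampling. -/
theorem exists_ops {k n m h q : ℕ} {a : ℕ → ℕ → ℕ} (ha : ∀ u < n, ∀ v < n, a u v ≤ 1)
    (hsymm : ∀ u < n, ∀ v < n, a u v = a v u) (hz : ∀ v < n, a n v = 0) (hk : 0 < k) (hh : 0 < h)
    (hm : h ^ 4 ≤ m) (hmq : m ≤ q) (hq : 2 * 2 ^ m * k * h ≤ q) {κ e : ℝ} (hκ : 0 < κ)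
    (he : 0 < e) (he1 : e ≤ 1) (hκe : 64 * κ ≤ e) (hκk : κ * k < 1)
    (hhe : 10 * k / h ≤ e * κ ^ (2 * k + 4)) (J : Finset ℕ) (hJk : J ⊆ range k) (st : PeelState)
    (D : ℕ → ℕ) (hD : ∀ u ∈ uncolored k n st, D u ∈ J) :
    ∃ ops : List (ℕ × ℕ × ℕ), ops.length ≤ 2 * #J ∧
      (∀ o ∈ ops, o.1 ≤ 1 ∧ o.2.1 ≤ n ∧ o.2.2 ≤ k) ∧
      ∃ p b x : ℕ, p ≤ 2 * n ∧ b ≤ 2 * n ∧ x ≤ 2 * n ∧ ∃ w : ℕ → ℕ, (∀ i, w i < k) ∧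
      (∀ u < n, st.col u < k →
        sampleColor k n m (2 ^ m) q a p b x w (runOps k n a ops st).col u = st.col u) ∧
      (∀ u ∈ uncolored k n st,
        sampleColor k n m (2 ^ m) q a p b x w (runOps k n a ops st).col u ∈ J) ∧
      (costOn (uncolored k n st) a
          (sampleColor k n m (2 ^ m) q a p b x w (runOps k n a ops st).col) : ℝ) ≤
        (1 + e) ^ #J * costOn (uncolored k n st) a D := by
  -- Each level uses up the nonempty set of large colors; the state and the clustering to be matched
  -- change with it.
  induction J using Finset.strongInduction generalizing st D with
  | H J ih =>
  have hpow1 : ∀ s : ℕ, 1 ≤ (1 + e) ^ s := fun s => one_le_pow₀ (by linarith)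
  set W := uncolored k n st with hW
  have hWn : W ⊆ range n := filter_subset _ _
  have hWlt : ∀ u ∈ W, u < n := fun u hu => mem_range.1 (hWn hu)
  rcases W.eq_empty_or_nonempty with hWe | hWne
  · refine ⟨[], by simp, by simp, 0, 0, 0, by simp, by simp, by simp, fun _ => 0, fun _ => hk,
      fun u hu hc => sampleColor_of_lt hc, by simp [hWe], by simp [hWe, costOn]⟩
  have hJne : J.Nonempty := hWne.elim fun u hu => ⟨D u, hD u hu⟩
  have hNpos : (0 : ℝ) < #W := by exact_mod_cast hWne.card_pos
  have hκ1 : κ ≤ 1 := by linarith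
  rcases lt_or_ge (κ ^ (2 * k + 4) * (#W : ℝ) ^ 2) (costOn W a D) with hhigh | hlow
  · obtain ⟨p, b, x, hp, hb, hx, w, hw, hF, hle⟩ :=
      exists_sampleColor ha hsymm hh hm hmq hq st hJne hJk hD
    refine ⟨[], by simp, by simp, p, b, x, hp, hb, hx, w, hw,
      fun u hu hc => sampleColor_of_lt hc, hF, hle.trans ?_⟩
    have h1 : 10 * k * (#W : ℝ) ^ 2 / h ≤ e * costOn W a D := by
      calc 10 * k * (#W : ℝ) ^ 2 / h = 10 * k / h * (#W : ℝ) ^ 2 := by ring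
        _ ≤ e * κ ^ (2 * k + 4) * (#W : ℝ) ^ 2 := by gcongr
        _ = e * (κ ^ (2 * k + 4) * (#W : ℝ) ^ 2) := by ring
        _ ≤ _ := by gcongr
    have h2 : (1 + e) * costOn W a D ≤ (1 + e) ^ #J * costOn W a D := by
      gcongr
      exact le_self_pow₀ (by linarith) hJne.card_pos.ne'
    linarith
  -- few disagreements: peel off the large clusters
  have hJcard : #J ≤ k := by simpa using card_le_card hJk
  obtain ⟨t, ht, hgap⟩ := exists_gap J hJcard (fun j => (#{v ∈ W | D v = j} : ℝ)) hκ hκ1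
    hNpos.le
  set Θ := κ ^ (t + 1) with hΘdef
  have hΘ : 0 < Θ := by positivity
  have hθ : κ ^ (t + 2) = κ * Θ := by rw [hΘdef, pow_succ κ (t + 1)]; ring
  -- κΘ² = κ^(2t + 3), and the threshold exponent 2k + 4 is large enough for every scale t ≤ k.
  have hγΘ : κ ^ (2 * k + 4) / Θ ≤ κ * Θ := by
    rw [div_le_iff₀ hΘ, hΘdef]
    calc κ ^ (2 * k + 4) ≤ κ ^ (2 * t + 3) := pow_le_pow_of_le_one hκ.le hκ1 (by omega)
      _ = _ := by ring
  set Lg : Finset ℕ := {j ∈ J | Θ * #W ≤ #{v ∈ W | D v = j}} with hLg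
  have hLgJ : Lg ⊆ J := filter_subset _ _
  have hbig : ∀ j ∈ Lg, Θ * #W ≤ #{v ∈ W | D v = j} := fun j hj => (mem_filter.1 hj).2
  have hsmall : ∀ j ∈ J, j ∉ Lg → (#{v ∈ W | D v = j} : ℝ) ≤ κ * Θ * #W := by
    intro j hj hj'
    rw [← hθ]
    exact (hgap j hj).resolve_left fun h => hj' (mem_filter.2 ⟨hj, h⟩)
  -- Otherwise at most k clusters of size at most κ|W| would cover W, against κk < 1.
  have hLgne : Lg.Nonempty := by
    by_contra hne
    rw [not_nonempty_iff_eq_empty] at hne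
    have h1 : (#W : ℝ) = ∑ j ∈ J, (#{v ∈ W | D v = j} : ℝ) := by
      exact_mod_cast card_eq_sum_card_fiberwise hD
    have h2 : ∑ j ∈ J, (#{v ∈ W | D v = j} : ℝ) ≤ ∑ j ∈ J, κ * #W := by
      refine sum_le_sum fun j hj => (hsmall j hj (by simp [hne])).trans ?_
      have : Θ ≤ 1 := pow_le_one₀ hκ.le hκ1
      nlinarith [mul_pos hκ hNpos]
    rw [sum_const, nsmul_eq_mul] at h2
    have h3 : (#J : ℝ) * (κ * #W) ≤ k * (κ * #W) := by gcongr
    nlinarith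
  have hpiv : ∀ j, ∃ v, j ∈ Lg → v ∈ W ∧ (disOn W a D v j : ℝ) ≤ κ ^ (2 * k + 4) / Θ * #W := by
    intro j
    by_cases hj : j ∈ Lg
    · obtain ⟨v, hv, h⟩ := exists_pivot hΘ hWne (hbig j hj) hlow
      exact ⟨v, fun _ => ⟨hv, h⟩⟩
    · exact ⟨0, fun h => absurd h hj⟩
  choose pv hpv using hpiv
  classical
  set rep : ℕ → ℕ := fun j => if j ∈ Lg then pv j else n with hrep
  -- Row `n` is zero and stands for all small clusters; the color `k` leaves a vertex uncolored.
  -- This entry is dropped when every cluster is large, since then no color would remain for the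
  -- uncolored vertices.
  set L : List (ℕ × ℕ) := (if Lg = J then [] else [(n, k)]) ++ Lg.toList.map fun j => (pv j, j)
    with hL
  have hLne : L ≠ [] := by
    have : Lg.toList ≠ [] := by simpa using hLgne.ne_empty
    simp [hL, this]
  have hLmem : ∀ o ∈ L, (o = (n, k) ∧ Lg ≠ J) ∨ ∃ j ∈ Lg, o = (pv j, j) := by
    intro o ho
    rw [hL, List.mem_append, List.mem_map] at ho
    rcases ho with h | ⟨j, hj, rfl⟩
    · split_ifs at h with h'
      · simp at h
      · exact Or.inl ⟨by simpa using h, h'⟩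
    · exact Or.inr ⟨j, by simpa using hj, rfl⟩
  have hrepL : ∀ j ∈ J, ∃ o ∈ L, o.1 = rep j := by
    intro j hj
    by_cases h : j ∈ Lg
    · exact ⟨(pv j, j), by simp [hL, h], by simp [hrep, h]⟩
    · refine ⟨(n, k), ?_, by simp [hrep, h]⟩
      have : Lg ≠ J := fun h' => h (h' ▸ hj)
      simp [hL, this]
  have hkLg : k ∉ Lg := fun h => by simpa using hJk (hLgJ h)
  set st' := runOps k n a (levelOps L) st with hst'
  obtain ⟨hold, hnew⟩ := levelOps_spec (k := k) (n := n) (a := a) (st := st) hLne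
  rw [← hst', ← hW] at hold hnew
  have hnew' : ∀ u ∈ W, (st'.col u ∈ Lg ∧
        ∀ j ∈ J, estOn W a u (rep (st'.col u)) ≤ estOn W a u (rep j)) ∨
      (st'.col u = k ∧ (∃ j ∈ J, j ∉ Lg) ∧ ∀ j ∈ J, estOn W a u n ≤ estOn W a u (rep j)) := by
    intro u hu
    obtain ⟨o, ho, hcol, hmin⟩ := hnew u hu
    have hmin' : ∀ j ∈ J, estOn W a u o.1 ≤ estOn W a u (rep j) := fun j hj => by
      obtain ⟨o', ho', he⟩ := hrepL j hj
      exact he ▸ hmin o' ho'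
    rcases hLmem o ho with ⟨rfl, hne⟩ | ⟨j, hj, rfl⟩
    · refine Or.inr ⟨hcol, ?_, hmin'⟩
      by_contra! hall
      exact hne (hLgJ.antisymm hall)
    · refine Or.inl ⟨hcol ▸ hj, ?_⟩
      have hc : st'.col u = j := hcol
      have : rep (st'.col u) = pv j := by rw [hc]; simp [hrep, hj]
      rwa [this]
  have hcolk : ∀ u ∈ W, st'.col u ∉ Lg → k ≤ st'.col u := fun u hu h => by
    rcases hnew' u hu with h' | h'
    · exact absurd h'.1 h
    · exact h'.1.ge
  set W' := uncolored k n st' with hW'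
  have hW'mem : ∀ u, u ∈ W' ↔ u ∈ W ∧ st'.col u ∉ Lg := by
    intro u
    constructor
    · intro hu
      obtain ⟨hun, huk⟩ := mem_filter.1 hu
      rw [mem_range] at hun
      refine ⟨?_, fun h => absurd (mem_range.1 (hJk (hLgJ h))) (by omega)⟩
      by_contra huW
      have := hold u hun huW
      exact huW (mem_filter.2 ⟨mem_range.2 hun, by omega⟩)
    · rintro ⟨hu, h⟩
      exact mem_filter.2 ⟨hWn hu, hcolk u hu h⟩
  have hW'W : W' ⊆ W := fun u hu => ((hW'mem u).1 hu).1
  obtain ⟨D', hD'1, hD'2, hD'3⟩ := exists_regroup (W := W) (a := a) (D := D) (J := J) (Lg := Lg)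
    (rep := rep) (ch := st'.col) (z := n) (Θ := Θ)
    -- The first term is the error at a pivot; the second is the size of a small cluster, which is
    -- the error of the zero row. Both are at most κΘ, so the numerical condition of
    -- `exists_regroup` becomes 64κΘ ≤ eΘ.
    (ξ := κ ^ (2 * k + 4) / Θ + κ * Θ) (γ := κ ^ (2 * k + 4)) (e := e)
    (fun u hu v hv => ha u (hWlt u hu) v (hWlt v hv))
    (fun u hu v hv => hsymm u (hWlt u hu) v (hWlt v hv)) hD hLgJ
    (fun j hj v hv => by
      by_cases h : j ∈ Lg
      · simp only [hrep, h, if_true]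
        exact ha _ (hWlt _ (hpv j h).1) v (hWlt v hv)
      · simp [hrep, h, hz v (hWlt v hv)])
    hΘ (by positivity) he1
    (by
      have h1 : 64 * κ * Θ ≤ e * Θ := by gcongr
      have h2 : 8 * κ ^ (2 * k + 4) / Θ = 8 * (κ ^ (2 * k + 4) / Θ) := by ring
      rw [h2]
      linarith)
    (by positivity)
    (fun j hj => by
      by_cases h : j ∈ Lg
      · simp only [hrep, h, if_true]
        refine (hpv j h).2.trans ?_
        gcongr
        have : 0 < κ * Θ := by positivity
        linarith
      · simp only [hrep, h, if_false]
        have h1 : disOn W a D n j = #{v ∈ W | D v = j} := by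
          rw [disOn, card_filter]
          refine sum_congr rfl fun v hv => ?_
          simp [hz v (hWlt v hv), eq_comm]
        rw [h1]
        refine (hsmall j hj h).trans ?_
        gcongr
        have : 0 < κ ^ (2 * k + 4) / Θ := by positivity
        linarith)
    (fun j hj h => by simp [hrep, h]) hbig hlow
    (fun u hu => (hnew' u hu).imp id fun h => ⟨by rw [h.1]; exact hkLg, h.2⟩)
  obtain ⟨ops, hlen, hops, p, b, x, hp, hb, hx, w, hw, hF1, hF2, hF3⟩ :=
    ih (J \ Lg) (sdiff_ssubset hLgJ hLgne) (sdiff_subset.trans hJk) st' D' fun u hu => by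
      obtain ⟨h1, h2⟩ := (hW'mem u).1 hu
      exact mem_sdiff.2 (hD'2 u h1 h2)
  rw [← hW'] at hF2 hF3
  have hcard : #(J \ Lg) + #Lg = #J := card_sdiff_add_card_eq_card hLgJ
  have hLgpos := hLgne.card_pos
  have hFlarge : ∀ u ∈ W, st'.col u ∈ Lg →
      sampleColor k n m (2 ^ m) q a p b x w (runOps k n a ops st').col u = st'.col u :=
    fun u hu h => hF1 u (hWlt u hu) (mem_range.1 (hJk (hLgJ h)))
  refine ⟨levelOps L ++ ops, ?_, ?_, p, b, x, hp, hb, hx, w, hw, ?_, ?_, ?_⟩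
  · have h1 : (levelOps L).length = L.length := by cases L <;> simp [levelOps]
    -- A level takes at most 1 + #Lg ≤ 2 #Lg operations, which yields 2 #J in total.
    have h2 : L.length ≤ 1 + #Lg := by
      rw [hL]
      split_ifs <;> simp
    rw [List.length_append, h1]
    omega
  · intro o ho
    rcases List.mem_append.1 ho with h | h
    · have h1 : ∃ o' ∈ L, o.1 ≤ 1 ∧ o.2 = o' := by
        clear_value L
        cases L with
        | nil => simp [levelOps] at h
        | cons o' L =>
          rcases List.mem_cons.1 h with rfl | h
          · exact ⟨o', by simp, le_rfl, rfl⟩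
          · obtain ⟨o'', h1, rfl⟩ := List.mem_map.1 h
            exact ⟨o'', by simp [h1], by simp, rfl⟩
      obtain ⟨o', ho', h2, h3⟩ := h1
      refine ⟨h2, ?_⟩
      rw [h3]
      rcases hLmem o' ho' with ⟨rfl, -⟩ | ⟨j, hj, rfl⟩
      · exact ⟨le_rfl, le_rfl⟩
      · exact ⟨(hWlt _ (hpv j hj).1).le, (mem_range.1 (hJk (hLgJ hj))).le⟩
    · exact hops o h
  · intro u hu hc
    have huW : u ∉ W := fun h => absurd (mem_filter.1 h).2 (by omega)
    rw [runOps_append, ← hst', hF1 u hu (by rw [hold u hu huW]; exact hc), hold u hu huW]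
  · intro u hu
    rw [runOps_append, ← hst']
    by_cases h : st'.col u ∈ Lg
    · rw [hFlarge u hu h]
      exact hLgJ h
    · exact (mem_sdiff.1 (hF2 u ((hW'mem u).2 ⟨hu, h⟩))).1
  · rw [runOps_append, ← hst']
    -- On W' both clusterings use only colors outside `Lg`, while the rest of W has colors in `Lg`;
    -- the factor gained on W' thus carries over to W.
    refine (costOn_le_of_part hW'W hF2 (fun u hu => ?_) (fun u hu hu' => ?_) (hpow1 #(J \ Lg))
      hF3).trans ?_
    · obtain ⟨h1, h2⟩ := (hW'mem u).1 hu
      exact mem_sdiff.2 (hD'2 u h1 h2)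
    · have h : st'.col u ∈ Lg := by
        by_contra h
        exact hu' ((hW'mem u).2 ⟨hu, h⟩)
      rw [hFlarge u hu h, hD'1 u hu h]
      exact ⟨rfl, fun h' => (mem_sdiff.1 h').2 h⟩
    · calc (1 + e) ^ #(J \ Lg) * (costOn W a D' : ℝ)
          ≤ (1 + e) ^ #(J \ Lg) * ((1 + e) * costOn W a D) := by gcongr
        _ = (1 + e) ^ (#(J \ Lg) + 1) * costOn W a D := by ring
        _ ≤ _ := by
          gcongr
          · linarith
          · omega

end CorrClust

/-! ## Advice strings -/

namespace CorrClust

open Finset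

/-- Some advice string leads to a good clustering. -/
theorem exists_advice {k n m h q : ℕ} {a : ℕ → ℕ → ℕ} (ha : ∀ u < n, ∀ v < n, a u v ≤ 1)
    (hsymm : ∀ u < n, ∀ v < n, a u v = a v u) (hz : ∀ v < n, a n v = 0) (hk : 2 ≤ k) (hh : 0 < h)
    (hm : h ^ 4 ≤ m) (hmq : m ≤ q) (hq : 2 * 2 ^ m * k * h ≤ q) {κ e : ℝ} (hκ : 0 < κ)
    (he : 0 < e) (he1 : e ≤ 1) (hκe : 64 * κ ≤ e) (hκk : κ * k < 1)
    (hhe : 10 * k / h ≤ e * κ ^ (2 * k + 4)) {c : ℕ → ℕ} (hc : ∀ u < n, c u < k) :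
    ∃ z : ℕ → ℕ, (∀ j, z j ≤ digitBound k n (2 ^ m * q) j) ∧
      (cost n a (candidate k n m (2 ^ m) q a z) : ℝ) ≤ (1 + e) ^ k * cost n a c := by
  have hq0 : 0 < q := lt_of_lt_of_le (by positivity) hq
  set st₀ : PeelState := ⟨fun _ => k, fun _ => 0, fun _ => 0⟩ with hst₀
  have hW : uncolored k n st₀ = range n := by simp [uncolored, hst₀]
  obtain ⟨ops, hlen, hops, p, b, x, hp, hb, hx, w, hw, -, -, hF⟩ :=
    exists_ops ha hsymm hz (by omega) hh hm hmq hq hκ he he1 hκe hκk hhe (range k) subset_rfl st₀ c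
      fun u hu => by
        rw [hW, mem_range] at hu
        exact mem_range.2 (hc u hu)
  rw [hW] at hF
  rw [card_range] at hF hlen
  set full := List.replicate (2 * k - ops.length) (0, 0, k) ++ ops with hfull
  have hfulllen : full.length = 2 * k := by simp [hfull]; omega
  have hrun : runOps k n a full st₀ = runOps k n a ops st₀ := by
    rw [hfull, runOps_append, runOps_replicate]
  have hfullmem : ∀ o ∈ full, o.1 ≤ 1 ∧ o.2.1 ≤ n ∧ o.2.2 ≤ k := by
    intro o ho
    rcases List.mem_append.1 ho with h | h
    · rw [(List.mem_replicate.1 h).2]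
      simp
    · exact hops o h
  -- Three digits per operation, then p, b, x, then the word, cut off where the digit bound drops to
  -- 0.
  set z : ℕ → ℕ := fun j =>
    if j < 6 * k then
      if j % 3 = 0 then (full.getD (j / 3) (0, 0, 0)).1
      else if j % 3 = 1 then (full.getD (j / 3) (0, 0, 0)).2.1
      else (full.getD (j / 3) (0, 0, 0)).2.2
    else if j = 6 * k then p else if j = 6 * k + 1 then b else if j = 6 * k + 2 then x
    else if j < 6 * k + 3 + 2 ^ m * q then w (j - (6 * k + 3)) else 0 with hzdef
  have hpeel : peel k n a z (2 * k) = runOps k n a ops st₀ := by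
    rw [peel_eq_runOps, ← hrun]
    congr 1
    refine List.ext_getElem (by simp [hfulllen]) fun i h1 h2 => ?_
    have hi : i < 2 * k := by simpa using h1
    have e0 : z (3 * i) = full[i].1 := by
      simp [hzdef, show 3 * i < 6 * k by omega, h2]
    have e1 : z (3 * i + 1) = full[i].2.1 := by
      simp [hzdef, show 3 * i + 1 < 6 * k by omega, show (3 * i + 1) % 3 = 1 by omega,
        show (3 * i + 1) / 3 = i by omega, h2]
    have e2 : z (3 * i + 2) = full[i].2.2 := by
      simp [hzdef, show 3 * i + 2 < 6 * k by omega, show (3 * i + 2) % 3 = 2 by omega,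
        show (3 * i + 2) / 3 = i by omega, h2]
    simp [e0, e1, e2]
  refine ⟨z, fun j => ?_, ?_⟩
  · by_cases h1 : j < 6 * k
    · have hj : j / 3 < full.length := by omega
      obtain ⟨b1, b2, b3⟩ := hfullmem _ (List.getElem_mem hj)
      simp only [hzdef, digitBound, if_pos h1, if_pos (show j < 6 * k + 3 by omega),
        List.getD_eq_getElem _ _ hj]
      split_ifs <;> omega
    · have := hw (j - (6 * k + 3))
      simp only [hzdef, digitBound, if_neg h1]
      split_ifs <;> omega
  · have hcand : ∀ u < n, candidate k n m (2 ^ m) q a z u =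
        sampleColor k n m (2 ^ m) q a p b x w (runOps k n a ops st₀).col u := by
      intro u hu
      have ep : z (6 * k) = p := by simp [hzdef]
      have eb : z (6 * k + 1) = b := by simp [hzdef]
      have ex : z (6 * k + 2) = x := by simp [hzdef]
      have ew : ∀ i < 2 ^ m * q, z (6 * k + 3 + i) = w i := by
        intro i hi
        simp only [hzdef, show ¬ 6 * k + 3 + i < 6 * k by omega,
          show ¬ 6 * k + 3 + i = 6 * k by omega, show ¬ 6 * k + 3 + i = 6 * k + 1 by omega,
          show ¬ 6 * k + 3 + i = 6 * k + 2 by omega,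
          show 6 * k + 3 + i < 6 * k + 3 + 2 ^ m * q by omega, if_true, if_false]
        congr 1
        omega
      rw [candidate, hpeel, ep, eb, ex]
      generalize (runOps k n a ops st₀).col = col
      have hP : ∀ u, (u < n ∧ k ≤ col u) → u < n := fun u h => h.1
      by_cases h : k ≤ col u
      · obtain ⟨i, hi, he⟩ := exists_nth_eq hP (u := u) ⟨hu, h⟩
        simp only [sampleColor]
        rw [← he, fill_apply (nth_inj hP) hi, fill_apply (nth_inj hP) hi]
        apply ew
        -- Only the first 2^m · q letters are ever read: there are at most q blocks, and types are
        -- below 2^m.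
        have h1 : i / (Nat.count (fun u => u < n ∧ k ≤ col u) n / q + 1) < q := by
          apply Nat.div_lt_of_lt_mul
          rw [mul_comm]
          exact hi.trans (Nat.lt_mul_div_succ _ hq0)
        have h2 := typ_lt (N := Nat.count (fun u => u < n ∧ k ≤ col u) n)
          (a := fun i j => a (Nat.nth (fun u => u < n ∧ k ≤ col u) i)
            (Nat.nth (fun u => u < n ∧ k ≤ col u) j)) (p := p) (b := b) (x := x)
          (fun i hi j hj => ha _ (hP _ (nth_spec hP hi)) _ (hP _ (nth_spec hP hj))) hi m
        rw [← typ_comp] at h2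
        calc _ < 2 ^ m * (i / (Nat.count (fun u => u < n ∧ k ≤ col u) n / q + 1)) + 2 ^ m := by
              omega
          _ = 2 ^ m * (i / (Nat.count (fun u => u < n ∧ k ≤ col u) n / q + 1) + 1) := by ring
          _ ≤ _ := Nat.mul_le_mul_left _ h1
      · rw [sampleColor_of_lt (by omega), sampleColor_of_lt (by omega)]
    rw [cost_congr hcand]
    exact hF

/-- The power is at most a rising factorial, which is p! times a binomial coefficient, and the
latter is at most 2^(d + p). -/
theorem pow_le_mul_two_pow (p d : ℕ) : d ^ p ≤ p.factorial * 2 ^ p * 2 ^ d := by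
  have h1 : (d + 1) ^ p ≤ (d + 1).ascFactorial p := Nat.pow_succ_le_ascFactorial (d + 1) p
  rw [Nat.ascFactorial_eq_factorial_mul_choose] at h1
  calc d ^ p ≤ (d + 1) ^ p := Nat.pow_le_pow_left (by omega) p
    _ ≤ p.factorial * (d + p).choose p := h1
    _ ≤ p.factorial * 2 ^ (d + p) := Nat.mul_le_mul_left _ (Nat.choose_le_two_pow _ _)
    _ = _ := by ring

/-- The choice of the parameters. -/
theorem exists_parameters {k : ℕ} (hk : 0 < k) : ∃ c : ℕ, ∀ d m : ℕ, 0 < d → m = 2 ^ (d + c) →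
    ∃ h : ℕ, 0 < h ∧ h ^ 4 ≤ m ∧ m ≤ 2 ^ 2 ^ m ∧ 2 * 2 ^ m * k * h ≤ 2 ^ 2 ^ m ∧
      ∃ κ e : ℝ, 0 < κ ∧ 0 < e ∧ e ≤ 1 ∧ 64 * κ ≤ e ∧ κ * k < 1 ∧
        10 * k / h ≤ e * κ ^ (2 * k + 4) ∧ (1 + e) ^ k ≤ 1 + 1 / (d : ℝ) := by
  -- Chosen such that 10k/h = eκ^(2k + 4) holds with equality for h = A d^(2k + 5).
  set A := 10 * k * 2 ^ k * (128 * 2 ^ k) ^ (2 * k + 4) with hA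
  set p := (2 * k + 5) * 4 with hp
  -- The summand in front makes 2^c absorb the constant in h⁴ = A⁴d^p ≤ A⁴ p! 2^p 2^d; the
  -- additional 1 ensures m ≥ 4.
  refine ⟨A ^ 4 * (p.factorial * 2 ^ p) + 1, fun d m hd hm => ?_⟩
  have hA0 : 0 < A := by positivity
  have hkA : k ≤ A := by
    calc k = k * 1 := by simp
      _ ≤ k * (10 * 2 ^ k * (128 * 2 ^ k) ^ (2 * k + 4)) := Nat.mul_le_mul_left _ (by
        exact Nat.succ_le_of_lt (by positivity))
      _ = A := by rw [hA]; ring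
  set h := A * d ^ (2 * k + 5) with hh
  have hh0 : 0 < h := by positivity
  have hkh : k ≤ h := hkA.trans (Nat.le_mul_of_pos_right _ (by positivity))
  have hhm : h ^ 4 ≤ m := by
    calc h ^ 4 = A ^ 4 * d ^ p := by rw [hh, mul_pow, ← pow_mul]
      _ ≤ A ^ 4 * (p.factorial * 2 ^ p * 2 ^ d) := Nat.mul_le_mul_left _ (pow_le_mul_two_pow p d)
      _ = A ^ 4 * (p.factorial * 2 ^ p) * 2 ^ d := by ring
      _ ≤ 2 ^ (A ^ 4 * (p.factorial * 2 ^ p)) * 2 ^ d :=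
        Nat.mul_le_mul_right _ Nat.lt_two_pow_self.le
      _ = 2 ^ (d + A ^ 4 * (p.factorial * 2 ^ p)) := by ring
      _ ≤ m := by
        rw [hm]
        exact Nat.pow_le_pow_right (by norm_num) (by omega)
  have hm4 : 4 ≤ m := by
    rw [hm]
    calc 4 = 2 ^ 2 := rfl
      _ ≤ _ := Nat.pow_le_pow_right (by norm_num) (by omega)
  have h2m : 2 * m + 1 ≤ 2 ^ m := by
    clear hm hhm
    induction m, hm4 using Nat.le_induction with
    | base => norm_num
    | succ m hm ih =>
      rw [pow_succ]
      omega
  -- Here e = 1/(2^k d), so that 2^k e = 1/d, and κ = e/128.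
  refine ⟨h, hh0, hhm, Nat.lt_two_pow_self.le.trans Nat.lt_two_pow_self.le, ?_,
    1 / (128 * 2 ^ k * d), 1 / (2 ^ k * d), by positivity, by positivity, ?_, ?_, ?_, ?_, ?_⟩
  · calc 2 * 2 ^ m * k * h ≤ 2 * 2 ^ m * h * h := by gcongr
      _ = 2 * 2 ^ m * h ^ 2 := by ring
      _ ≤ 2 * 2 ^ m * h ^ 4 := Nat.mul_le_mul_left _ (Nat.pow_le_pow_right hh0 (by norm_num))
      _ ≤ 2 * 2 ^ m * 2 ^ m := Nat.mul_le_mul_left _ (hhm.trans Nat.lt_two_pow_self.le)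
      _ = 2 ^ (2 * m + 1) := by ring
      _ ≤ _ := Nat.pow_le_pow_right (by norm_num) h2m
  · rw [div_le_one (by positivity)]
    exact_mod_cast Nat.succ_le_of_lt (by positivity : 0 < 2 ^ k * d)
  · have hd' : (0 : ℝ) < d := by exact_mod_cast hd
    rw [mul_one_div, div_le_div_iff₀ (by positivity) (by positivity)]
    have : 0 < (2 : ℝ) ^ k * d := by positivity
    linarith
  · rw [one_div_mul_eq_div, div_lt_one (by positivity)]
    have h1 : k < 2 ^ k := Nat.lt_two_pow_self
    have h2 : k < 128 * 2 ^ k * d :=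
      calc k < 2 ^ k := h1
        _ = 1 * 2 ^ k * 1 := by ring
        _ ≤ 128 * 2 ^ k * d := by gcongr <;> omega
    exact_mod_cast h2
  · have hd' : (0 : ℝ) < d := by exact_mod_cast hd
    have hk' : (0 : ℝ) < k := by exact_mod_cast hk
    apply le_of_eq
    rw [hh, hA]
    push_cast
    rw [one_div_pow, mul_pow _ (d : ℝ), pow_succ (d : ℝ) (2 * k + 4)]
    field_simp
  · have hd' : (0 : ℝ) < d := by exact_mod_cast hd
    -- The chord bound for the convex function (1 + e)^s on [0, 1].
    have key : ∀ s : ℕ, ∀ e : ℝ, 0 ≤ e → e ≤ 1 → (1 + e) ^ s ≤ 1 + (2 ^ s - 1) * e := by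
      intro s e he he1
      induction s with
      | zero => simp
      | succ s ih =>
        have h1 : (1 : ℝ) ≤ 2 ^ s := one_le_pow₀ (by norm_num)
        calc (1 + e) ^ (s + 1) = (1 + e) ^ s * (1 + e) := pow_succ _ _
          _ ≤ (1 + (2 ^ s - 1) * e) * (1 + e) := by gcongr
          _ ≤ 1 + (2 ^ (s + 1) - 1) * e := by
            rw [pow_succ]
            nlinarith [mul_nonneg (sub_nonneg.2 h1) (mul_nonneg he (sub_nonneg.2 he1))]
    have h1 : 1 / ((2 : ℝ) ^ k * d) ≤ 1 := by
      rw [div_le_one (by positivity)]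
      exact_mod_cast Nat.succ_le_of_lt (by positivity : 0 < 2 ^ k * d)
    refine (key k _ (by positivity) h1).trans ?_
    have : (2 : ℝ) ^ k * (1 / (2 ^ k * d)) = 1 / d := by field_simp
    have h0 : 0 ≤ 1 / ((2 : ℝ) ^ k * d) := by positivity
    linarith

end CorrClust

/-! ## The main theorem -/

namespace CorrClust

open Finset RamProg

/-- The algorithm runs in polynomial time if all parameters but the number of vertices are fixed. -/
theorem exists_clusterTime_le (k d c m G K : ℕ) (hk : 0 < k) : ∃ B : ℕ, ∀ n : ℕ,
    clusterTime k n d c m G (6 * k + 3 + K) (digitBound k n K) ≤ B * (n + 1) ^ (6 * k + 5) := by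
  set L := 6 * k + 3 + K with hL
  set X := d + c + m + G + L with hX
  set Y := 600 * k + 50 * m + 40 * L + 671 with hY
  refine ⟨50 * X + 554 + (k + 2) ^ (6 * k + 3) * k ^ K * Y, fun n => ?_⟩
  -- The number of advice strings: the word contributes a constant factor, and only 6k + 3 digits
  -- depend on n. A round adds a factor of order n².
  have hplace : place (digitBound k n K) L = (2 * n + k + 1) ^ (6 * k + 3) * k ^ K := by
    rw [place, hL, prod_range_add]
    congr 1
    · rw [prod_congr rfl fun i hi => by
        rw [digitBound, if_pos (mem_range.1 hi)]]
      simp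
    · rw [prod_congr rfl fun i hi => by
        rw [digitBound, if_neg (by omega), if_pos (by have := mem_range.1 hi; omega),
          Nat.sub_add_cancel hk]]
      simp
  have h1 : 1 ≤ (n + 1) ^ (6 * k + 5) := Nat.one_le_pow _ _ (by omega)
  have h2 : n + 1 ≤ (n + 1) ^ (6 * k + 5) := Nat.le_self_pow (by omega) _
  have h3 : (2 * n + k + 1) ^ (6 * k + 3) ≤ (k + 2) ^ (6 * k + 3) * (n + 1) ^ (6 * k + 3) := by
    rw [← mul_pow]
    exact Nat.pow_le_pow_left (by nlinarith) _
  have h4 : 2 * k * (n * (n * 50 + 130) + 120) + n * (n * 50 + m * 50 + 320) + L * 40 + 300 + 1 ≤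
      Y * (n + 1) ^ 2 := by
    have e : Y * (n + 1) ^ 2 = 2 * k * (n * (n * 50 + 130) + 120) +
        n * (n * 50 + m * 50 + 320) + L * 40 + 300 + 1 + (2 * k * (250 * n ^ 2 + 470 * n + 180) +
          m * (50 * n ^ 2 + 50 * n + 50) + L * (40 * n ^ 2 + 80 * n) +
          (621 * n ^ 2 + 1022 * n + 370)) := by
      rw [hY]
      ring
    rw [e]
    exact Nat.le_add_right _ _
  have h5 : (n + d + c + m + G + L) * 50 + 504 ≤ (50 * X + 554) * (n + 1) ^ (6 * k + 5) := by
    have h6 : X * 1 ≤ X * (n + 1) ^ (6 * k + 5) := Nat.mul_le_mul_left _ h1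
    have h7 : (50 * X + 554) * (n + 1) ^ (6 * k + 5) =
      50 * (X * (n + 1) ^ (6 * k + 5)) + 554 * (n + 1) ^ (6 * k + 5) := by ring
    omega
  rw [clusterTime, hplace]
  calc _ = ((n + d + c + m + G + L) * 50 + 504) + (2 * n + k + 1) ^ (6 * k + 3) * k ^ K *
        (2 * k * (n * (n * 50 + 130) + 120) + n * (n * 50 + m * 50 + 320) + L * 40 + 300 + 1) := by
        ring
    _ ≤ (50 * X + 554) * (n + 1) ^ (6 * k + 5) +
        (k + 2) ^ (6 * k + 3) * (n + 1) ^ (6 * k + 3) * k ^ K * (Y * (n + 1) ^ 2) := by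
        gcongr
    _ = _ := by ring

/-- A polynomial bound in terms of the exponent of the main theorem. -/
theorem exists_le_rpow_mul_log {f : ℕ → ℕ} {B r : ℕ} {E : ℝ} (hf : ∀ n, f n ≤ B * (n + 1) ^ r)
    (hE : (r + 1 : ℕ) ≤ E) : ∃ n₀ : ℕ, ∀ n : ℕ, n₀ ≤ n → (f n : ℝ) ≤ (n : ℝ) ^ E * Real.log n := by
  -- From n ≥ 3 follows log n ≥ 1; the constant B · 2^r, with 2^r from n + 1 ≤ 2n, is absorbed by
  -- one more power of n.
  refine ⟨max 3 (B * 2 ^ r), fun n hn => ?_⟩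
  have h3 : 3 ≤ n := (le_max_left _ _).trans hn
  have hB : B * 2 ^ r ≤ n := (le_max_right _ _).trans hn
  have hn1 : (1 : ℝ) ≤ n := by exact_mod_cast (by omega : 1 ≤ n)
  have h1 : f n ≤ n ^ (r + 1) := by
    calc f n ≤ B * (n + 1) ^ r := hf n
      _ ≤ B * (2 * n) ^ r := by gcongr; omega
      _ = B * 2 ^ r * n ^ r := by ring
      _ ≤ n * n ^ r := by gcongr
      _ = _ := by ring
  have h2 : 1 ≤ Real.log n := by
    rw [Real.le_log_iff_exp_le (by linarith)]
    have : (3 : ℝ) ≤ n := by exact_mod_cast h3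
    linarith [Real.exp_one_lt_d9]
  calc (f n : ℝ) ≤ (n : ℝ) ^ (r + 1) := by exact_mod_cast h1
    _ = (n : ℝ) ^ ((r + 1 : ℕ) : ℝ) := (Real.rpow_natCast _ _).symm
    _ ≤ (n : ℝ) ^ E := Real.rpow_le_rpow_of_exponent_le hn1 hE
    _ ≤ _ := le_mul_of_one_le_right (by positivity) h2

/-- Ordered pairs count every edge twice, and the ones on the diagonal make the pairs (u, u) free.
-/
theorem cost_eq_two_mul_disagreements {n : ℕ} {L : EdgeLabeling n} {a : ℕ → ℕ → ℕ}
    (ha : ∀ u v : Fin n, a u v = if u = v then 1 else if L s(u, v) = true then 1 else 0)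
    (c : ℕ → ℕ) : cost n a c = 2 * disagreements L fun v : Fin n => c v := by
  set g : Fin n → Fin n → ℕ := fun u v =>
    if u < v ∧ ¬ (L s(u, v) = true ↔ c u = c v) then 1 else 0 with hg
  have h1 : disagreements L (fun v : Fin n => c v) = ∑ u : Fin n, ∑ v : Fin n, g u v := by
    rw [disagreements, card_filter, ← univ_product_univ, sum_product]
  have h2 : cost n a c = ∑ u : Fin n, ∑ v : Fin n, (g u v + g v u) := by
    rw [cost, sum_range]
    refine sum_congr rfl fun u _ => ?_
    rw [sum_range]
    refine sum_congr rfl fun v _ => ?_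
    rw [ha u v, hg]
    simp only
    rw [Sym2.eq_swap (a := v) (b := u)]
    have h5 : c v = c u ↔ c u = c v := eq_comm
    rcases lt_trichotomy u v with h | rfl | h
    · by_cases h3 : L s(u, v) = true <;> by_cases h4 : c u = c v <;>
        simp [h, h.ne, h.not_gt, h3, h4]
    · simp
    · by_cases h3 : L s(u, v) = true <;> by_cases h4 : c u = c v <;>
        simp [h, h.ne', h.not_gt, h3, h4, h5]
  rw [h1, h2]
  simp only [sum_add_distrib]
  rw [sum_comm (f := fun u v => g v u), two_mul]

theorem exists_disagreements_eq_min {n k : ℕ} (hk : 0 < k) (L : EdgeLabeling n) :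
    ∃ c : ℕ → ℕ, (∀ u < n, c u < k) ∧
      disagreements L (fun v : Fin n => c v) = minDisagreements k L := by
  have : Nonempty (Fin n → Fin k) := ⟨fun _ => ⟨0, hk⟩⟩
  obtain ⟨c, hc⟩ := Nat.sInf_mem (Set.range_nonempty fun c : Fin n → Fin k => disagreements L c)
  refine ⟨fun u => if h : u < n then c ⟨u, h⟩ else 0, fun u hu => by simp [hu], ?_⟩
  rw [minDisagreements, iInf, ← hc]
  simp [disagreements, Fin.ext_iff]

theorem clusterInput_arr_le {n : ℕ} (ε : ℚ) (L : EdgeLabeling n) (b i : ℕ) :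
    (clusterInput ε L).arr b i ≤ 1 := by
  classical
  simp only [clusterInput]
  split_ifs <;> simp

theorem clusterInput_arr_zero {n : ℕ} (ε : ℚ) (L : EdgeLabeling n) {u v : Fin n} (h : u ≠ v) :
    (clusterInput ε L).arr 0 (u * n + v) = if L s(u, v) = true then 1 else 0 := by
  classical
  simp only [clusterInput]
  congr 1
  rw [eq_iff_iff]
  constructor
  · rintro ⟨-, u', v', -, hL, he⟩
    obtain ⟨h1, h2⟩ := rowIndex_inj v.isLt v'.isLt he
    rwa [Fin.ext h1, Fin.ext h2]
  · intro hL
    exact ⟨trivial, u, v, h, hL, rfl⟩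

/-- This supplies the zero row that represents the small clusters. -/
theorem clusterInput_arr_last {n : ℕ} (ε : ℚ) (L : EdgeLabeling n) {v : ℕ} (hv : v < n) :
    (clusterInput ε L).arr 0 (n * n + v) = 0 := by
  classical
  simp only [clusterInput]
  rw [if_neg]
  rintro ⟨-, u', v', -, -, he⟩
  exact absurd (rowIndex_inj hv v'.isLt he).1 u'.isLt.ne'

/-- The algorithm finds a good clustering. -/
theorem exists_clusterP_spec {k : ℕ} (hk : 2 ≤ k) : ∃ c : ℕ, ∀ ε : ℚ, 0 < ε →
    ∀ (n m G q : ℕ) (L : EdgeLabeling n), m = 2 ^ (ε.den + c) → G = 2 ^ m → q = 2 ^ G →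
      Spec (clusterP k c) (clusterInput ε L)
        (clusterTime k n ε.den c m G (6 * k + 3 + G * q) (digitBound k n (G * q))) fun s =>
        IsApproxClustering k ε L (clusterOutput n s) := by
  obtain ⟨c, hc⟩ := exists_parameters (k := k) (by omega)
  refine ⟨c, fun ε hε n m G q L hm hG hq => ?_⟩
  obtain ⟨h, hh, hhm, hmq, hhq, κ, e, hκ, he, he1, hκe, hκk, hhe, hek⟩ := hc ε.den m ε.den_pos hm
  rw [← hG, ← hq] at hmq hhq
  rw [hG] at hhq
  obtain ⟨t, s, hev, ht, hlt, a, ha, han, hbest⟩ := clusterP_spec k c (by omega)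
    (s := clusterInput ε L) (n := n) (d := ε.den) (by simp [clusterInput])
    (by simp [clusterInput]) (by simp [clusterInput]) (by simp [clusterInput])
    (fun j => by simp [clusterInput]) (fun j => by simp [clusterInput]) hm hG hq rfl
    (clusterInput_arr_le ε L 0)
  have ha' : ∀ u v : Fin n, a u v = if u = v then 1 else if L s(u, v) = true then 1 else 0 := by
    intro u v
    rw [ha u u.isLt v v.isLt]
    by_cases huv : u = v
    · simp [huv]
    · rw [if_neg huv, if_neg fun h => huv (Fin.ext h), clusterInput_arr_zero ε L huv]
  obtain ⟨c₀, hc₀, hmin⟩ := exists_disagreements_eq_min (by omega : 0 < k) L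
  obtain ⟨z, hz, hle⟩ := exists_advice (k := k) (n := n) (a := a) (q := q)
    (fun u hu v hv => by
      rw [ha' ⟨u, hu⟩ ⟨v, hv⟩]
      split_ifs <;> simp)
    (fun u hu v hv => by
      rw [ha' ⟨u, hu⟩ ⟨v, hv⟩, ha' ⟨v, hv⟩ ⟨u, hu⟩, Sym2.eq_swap]
      simp only [eq_comm (a := (⟨u, hu⟩ : Fin n))])
    (fun v hv => by rw [han v hv, clusterInput_arr_last ε L hv])
    hk hh hhm hmq hhq hκ he he1 hκe hκk hhe hc₀
  rw [← hG] at hz hle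
  refine ⟨t, s, hev, ht, fun v => hlt v v.isLt, ?_⟩
  have h1 : (cost n a (s.arr 1) : ℝ) ≤ (1 + e) ^ k * cost n a c₀ :=
    le_trans (by exact_mod_cast hbest z hz) hle
  rw [cost_eq_two_mul_disagreements ha', cost_eq_two_mul_disagreements ha', hmin] at h1
  push_cast at h1
  -- A positive numerator is at least 1, so accuracy 1/d for the denominator d suffices; the program
  -- never uses the numerator.
  have hε1 : 1 / (ε.den : ℝ) ≤ ε := by
    have h2 : (1 : ℝ) ≤ ε.num := by exact_mod_cast Int.add_one_le_iff.2 (Rat.num_pos.2 hε)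
    have h3 : (ε : ℝ) = ε.num / ε.den := by exact_mod_cast (Rat.num_div_den ε).symm
    rw [h3]
    gcongr
  have h2 : (1 + e) ^ k * (minDisagreements k L : ℝ) ≤ (1 + ε) * minDisagreements k L := by
    gcongr
    linarith
  have h3 : (disagreements L (clusterOutput n s) : ℝ) =
    disagreements L fun v : Fin n => s.arr 1 v := rfl
  rw [h3]
  linarith

end CorrClust

/-- The exponent 6k + 6 is independent of ε and below 100^k, so C = 1 works. The program depends on
k only, as m, G and q are computed from the denominator of ε. -/
theorem mainTheorem1 :
    ∃ C : ℝ, ∀ k : ℕ, 2 ≤ k →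
      ∃ P : RamProg, ∀ ε : ℚ, 0 < ε → ε ≤ 1 →
        ∃ T : ℕ → ℕ,
          (∃ n₀ : ℕ, ∀ n : ℕ, n₀ ≤ n →
            (T n : ℝ) ≤ (n : ℝ) ^ (C * 100 ^ k / (ε : ℝ) ^ 2) * Real.log n) ∧
          ∀ (n : ℕ) (L : EdgeLabeling n),
            (∀ cfg ∈ (ramRun (T n) ([P], clusterInput ε L)).support, cfg.1 = []) ∧
            1 - (n : ENNReal)⁻¹ ≤
              (ramRun (T n) ([P], clusterInput ε L)).toOuterMeasure
                {cfg | IsApproxClustering k ε L (clusterOutput n cfg.2)} := by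
  refine ⟨1, fun k hk => ?_⟩
  obtain ⟨c, hc⟩ := CorrClust.exists_clusterP_spec hk
  refine ⟨RamProg.clusterP k c, fun ε hε hε1 => ?_⟩
  obtain ⟨m, hm⟩ : ∃ m, m = 2 ^ (ε.den + c) := ⟨_, rfl⟩
  obtain ⟨G, hG⟩ : ∃ G, G = 2 ^ m := ⟨_, rfl⟩
  obtain ⟨q, hq⟩ : ∃ q, q = 2 ^ G := ⟨_, rfl⟩
  obtain ⟨B, hB⟩ := CorrClust.exists_clusterTime_le k ε.den c m G (G * q) (by omega)
  refine ⟨fun n => RamProg.clusterTime k n ε.den c m G (6 * k + 3 + G * q)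
    (CorrClust.digitBound k n (G * q)), CorrClust.exists_le_rpow_mul_log hB ?_, fun n L => ?_⟩
  · have h1 : 6 * k + 5 + 1 ≤ 100 ^ k := by
      induction k, hk using Nat.le_induction with
      | base => norm_num
      | succ k hk ih =>
        clear ih hc hB hm
        have : k < 100 ^ k := Nat.lt_pow_self (by norm_num)
        rw [pow_succ]
        omega
    have hε0 : (0 : ℝ) < ε := by exact_mod_cast hε
    have hε1' : (ε : ℝ) ≤ 1 := by exact_mod_cast hε1
    rw [one_mul]
    calc ((6 * k + 5 + 1 : ℕ) : ℝ) ≤ 100 ^ k := by exact_mod_cast h1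
      _ ≤ _ := le_div_self (by positivity) (by positivity) (pow_le_one₀ hε0.le hε1')
  -- The run is deterministic, so the final distribution is a point mass and the success probability
  -- is 1.
  · obtain ⟨t, s, hev, ht, hs⟩ := hc ε hε n m G q L hm hG hq
    simp only [hev.ramRun_of_le ht]
    refine ⟨fun cfg hcfg => ?_, ?_⟩
    · rw [PMF.support_pure, Set.mem_singleton_iff] at hcfg
      rw [hcfg]
    · rw [PMF.toOuterMeasure_pure_apply, if_pos (by exact hs)]
      exact tsub_le_self
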